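/- **Theorem.** Let $K\ge 1$ and let $Y_{k1},Y_{k2},\dots$ ($1\le k\le K$) be independent rewards with $Y_{kt}\sim N(\mu_k,\sigma_k^2)$, where the means $\mu_k\in\mathbb R$ and the (possibly unequal) standard deviations $\sigma_k>0$ are not known to the procedure. Put $\mu_*=\max_k\mu_k$. Let $(c_n)$ be a non-negative monotone increasing sequence with $c_n=o(\log n)$ and $c_n/\log\log n\to\infty$. Write $\bar Y_{k,t:u}$ for the sample mean of $Y_{kt},\dots,Y_{ku}$, $\hat\sigma_{k,t:u}^2=\frac1{u-t}\sum_{v=t}^u(Y_{kv}-\bar Y_{k,t:u})^2$, $\bar Y_{kt}=\bar Y_{k,1:t}$ and $\hat\sigma_{kt}=\hat\sigma_{k,1:t}$. The *subsample-$t$ comparison procedure* (SSTC) runs in rounds $r=1,2,\dots$. In round 1 every arm is sampled once. At the beginning of round $r$ let $n_k=n_k^r$ be the number of observations from arm $k$ and $n=n^r=\sum_k n_k^r$. In round $r\ge2$ the leader $\zeta$ is the arm with the most observations, ties being resolved, in order, by the larger sample mean $\bar Y_{kn_k}$, by the leader of the previous round, and by uniform randomization. Each arm $k\ne\zeta$ challenges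 $\zeta$: it loses if $n_k=n_\zeta$; it wins if $n_k<n_\zeta$ and $n_k<c_n$; if $c_n\le n_k<n_\zeta$ it wins exactly when $\bar Y_{kn_k}\ge\bar Y_{\zeta n_\zeta}$ or $$\frac{\bar Y_{kn_k}-\bar Y_{\zeta n_\zeta}}{\hat\sigma_{kn_k}}\ \ge\ \frac{\bar Y_{\zeta,t:(t+n_k-1)}-\bar Y_{\zeta n_\zeta}}{\hat\sigma_{\zeta,t:(t+n_k-1)}}\quad\text{for some }1\le t\le n_\zeta-n_k+1$$ (with the convention that a challenger with $n_k=1<n_\zeta$, for which these ratios are undefined, wins). All arms that win their challenge are sampled once; if there is none, $\zeta$ is sampled once. For a total of $N$ observations, let $N_k$ be the number of observations from arm $k$: $N_k=n_k^r$ if $N=n^r$, and if $n^r<N<n^{r+1}$, then $N-n^r$ arms chosen uniformly at random among the $n^{r+1}-n^r$ arms sampled in round $r$ are added to the counts $n_k^r$. The randomizations are independent of the rewards and, between rounds, of each other. The regret is $R_N=\sum_k(\mu_*-\mu_k)\,E N_k$. Let $M(g)=\frac12\log(1+g^2)$. Then for every arm $k$ with $\mu_k<\mu_*$, $$\limsup_{r\to\infty}\frac{E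 n_k^r}{\log r}\le\frac1{M\big((\mu_*-\mu_k)/\sigma_k\big)},$$ and SSTC is efficient, that is, its regret attains the Burnetas–Katehakis lower bound: $$\lim_{N\to\infty}\frac{R_N}{\log N}=\sum_{k:\,\mu_k<\mu_*}\frac{\mu_*-\mu_k}{M\big((\mu_*-\mu_k)/\sigma_k\big)}.$$ -/

import Mathlib

open MeasureTheory ProbabilityTheory Filter Topology Asymptotics
open scoped NNReal ENNReal

/-- Admissible sampling thresholds `c_n`: non-negative, monotone increasing, `c_n = o(log n)` and
`c_n / log log n → ∞`. -/
structure IsSamplingThreshold (c : ℕ → ℝ) : Prop where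
  nonneg : ∀ n, 0 ≤ c n
  monotone : Monotone c
  isLittleO_log : c =o[atTop] (fun n : ℕ => Real.log n)
  tendsto_div_log_log : Tendsto (fun n : ℕ => c n / Real.log (Real.log n)) atTop atTop

namespace SSTC

noncomputable section

section Path

open scoped Classical

/-! ### The procedure along one sample path

There are `K` arms. Rewards are indexed from `0`: `y k t` is the `(t + 1)`-st reward of arm `k`.
`n k` denotes the current number of observations from arm `k`. -/

/-- Mean of the `m` consecutive values `x s, …, x (s + m - 1)`. -/
def blockMean (x : ℕ → ℝ) (s m : ℕ) : ℝ :=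
  (∑ i ∈ Finset.range m, x (s + i)) / m

/-- Standard error estimate (divisor `m - 1`) of the `m` consecutive values
`x s, …, x (s + m - 1)`. -/
def blockSd (x : ℕ → ℝ) (s m : ℕ) : ℝ :=
  Real.sqrt ((∑ i ∈ Finset.range m, (x (s + i) - blockMean x s m) ^ 2) / ((m : ℝ) - 1))

/-- `t`-statistic, centred at `a`, of the `m` consecutive values `x s, …, x (s + m - 1)`. -/
def tStat (x : ℕ → ℝ) (s m : ℕ) (a : ℝ) : ℝ :=
  (blockMean x s m - a) / blockSd x s m

variable {K : ℕ}

/-- The arms with the largest number of observations. -/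
def mostSampled (n : Fin K → ℕ) : Finset (Fin K) :=
  Finset.univ.filter fun k => ∀ j, n j ≤ n k

/-- Among the arms with the most observations, those with the largest sample mean. -/
def candidates (y : Fin K → ℕ → ℝ) (n : Fin K → ℕ) : Finset (Fin K) :=
  (mostSampled n).filter fun k =>
    ∀ j ∈ mostSampled n, blockMean (y j) 0 (n j) ≤ blockMean (y k) 0 (n k)

/-- The leader: the arm with the most observations, ties being resolved in order by the larger
sample mean, by the leader `prev` of the previous round (if there is one), and by randomization:
`pick S` is the arm drawn at random from the set `S`. -/
def leader (y : Fin K → ℕ → ℝ) (pick : Finset (Fin K) → Fin K) (n : Fin K → ℕ)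
    (prev : Option (Fin K)) : Fin K :=
  match prev with
  | none => pick (candidates y n)
  | some z => if z ∈ candidates y n then z else pick (candidates y n)

/-- Arm `k` wins its challenge against the leader `z`. It loses when `n k = n z`; for `n k < n z`
it wins automatically when `n k` is below the threshold, and otherwise by a comparison of sample
means or of subsample `t`-statistics over some block of `n k` consecutive rewards among the
first `n z` rewards of the leader.
(The `t`-statistics of a single reward are undefined in the usual sense; here both are `0`, so that
a challenger with just one observation wins. As `c n → ∞`, this convention matters in finitely many
rounds only, and only if the threshold is at most `1` there.) -/
def WinsChallenge (c : ℕ → ℝ) (y : Fin K → ℕ → ℝ) (n : Fin K → ℕ) (z k : Fin K) : Prop :=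
  n k < n z ∧
    ((n k : ℝ) < c (∑ j, n j) ∨
      blockMean (y z) 0 (n z) ≤ blockMean (y k) 0 (n k) ∨
      ∃ s, s + n k ≤ n z ∧
        tStat (y z) s (n k) (blockMean (y z) 0 (n z)) ≤
          tStat (y k) 0 (n k) (blockMean (y z) 0 (n z)))

/-- The challengers of `z` that win their challenge. -/
def winners (c : ℕ → ℝ) (y : Fin K → ℕ → ℝ) (n : Fin K → ℕ) (z : Fin K) : Finset (Fin K) :=
  Finset.univ.filter fun k => k ≠ z ∧ WinsChallenge c y n z k

/-- The arms sampled when the leader is `z`: the winning challengers, or `z` alone if it wins all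
its challenges. -/
def sampled (c : ℕ → ℝ) (y : Fin K → ℕ → ℝ) (n : Fin K → ℕ) (z : Fin K) : Finset (Fin K) :=
  if winners c y n z = ∅ then {z} else winners c y n z

/-- What is remembered at the beginning of a round: the numbers of observations and the leader of
the previous round. -/
structure State (K : ℕ) where
  count : Fin K → ℕ
  prev : Option (Fin K)

/-- The arms sampled in a round `r ≥ 2` that begins in the state `s`. -/
def sampledAt (c : ℕ → ℝ) (y : Fin K → ℕ → ℝ) (pick : Finset (Fin K) → Fin K) (s : State K) :
    Finset (Fin K) :=
  sampled c y s.count (leader y pick s.count s.prev)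

/-- The state at the beginning of round `r`. Rounds are numbered from `1` (the value at `0` is
irrelevant); in round `1` every arm is sampled once. `pick r S` is the arm drawn at random from `S`
in round `r`. -/
def state (c : ℕ → ℝ) (y : Fin K → ℕ → ℝ) (pick : ℕ → Finset (Fin K) → Fin K) : ℕ → State K
  | 0 => ⟨fun _ => 0, none⟩
  | 1 => ⟨fun _ => 0, none⟩
  | 2 => ⟨fun _ => 1, none⟩
  | r + 3 =>
    let s := state c y pick (r + 2)
    ⟨fun k => s.count k + if k ∈ sampledAt c y (pick (r + 2)) s then 1 else 0,
      some (leader y (pick (r + 2)) s.count s.prev)⟩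

/-- `n_k^r`: the number of observations from arm `k` at the beginning of round `r`. -/
def count (c : ℕ → ℝ) (y : Fin K → ℕ → ℝ) (pick : ℕ → Finset (Fin K) → Fin K) (r : ℕ)
    (k : Fin K) : ℕ :=
  (state c y pick r).count k

/-- `n^r`: the total number of observations at the beginning of round `r`. -/
def total (c : ℕ → ℝ) (y : Fin K → ℕ → ℝ) (pick : ℕ → Finset (Fin K) → Fin K) (r : ℕ) : ℕ :=
  ∑ k, count c y pick r k

/-- The arms recommended in round `r ≥ 1`. -/
def recommended (c : ℕ → ℝ) (y : Fin K → ℕ → ℝ) (pick : ℕ → Finset (Fin K) → Fin K) (r : ℕ) :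
    Finset (Fin K) :=
  if r ≤ 1 then Finset.univ else sampledAt c y (pick r) (state c y pick r)

/-- The last round `r` with `n^r ≤ N` (as `n^r ≥ r - 1`, it is at most `N + 1`). -/
def lastRound (c : ℕ → ℝ) (y : Fin K → ℕ → ℝ) (pick : ℕ → Finset (Fin K) → Fin K) (N : ℕ) : ℕ :=
  Nat.findGreatest (fun r => total c y pick r ≤ N) (N + 1)

/-- `N_k`: the number of observations from arm `k` when there are `N` observations in total. If
`n^r < N < n^(r+1)`, then `N - n^r` of the arms recommended in round `r` are chosen at random;
`sub r S m` is the set of `m` arms drawn at random from `S` in round `r`. -/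
def allocation (c : ℕ → ℝ) (y : Fin K → ℕ → ℝ) (pick : ℕ → Finset (Fin K) → Fin K)
    (sub : ℕ → Finset (Fin K) → ℕ → Finset (Fin K)) (N : ℕ) (k : Fin K) : ℕ :=
  let r := lastRound c y pick N
  count c y pick r k +
    if total c y pick r < N ∧ k ∈ sub r (recommended c y pick r) (N - total c y pick r)
    then 1 else 0

end Path

section Random

variable {Ω : Type*} [MeasurableSpace Ω] {K : ℕ}

/-- The `σ`-algebra generated by all rewards. -/
@[reducible] def rewardSigma (Y : Fin K → ℕ → Ω → ℝ) : MeasurableSpace Ω :=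
  ⨆ k, ⨆ t, MeasurableSpace.comap (Y k t) inferInstance

/-- The `σ`-algebra generated by the randomizations of round `r`. -/
@[reducible] def randomizationSigma (pick : ℕ → Finset (Fin K) → Ω → Fin K)
    (sub : ℕ → Finset (Fin K) → ℕ → Ω → Finset (Fin K)) (r : ℕ) : MeasurableSpace Ω :=
  (⨆ S, MeasurableSpace.comap (pick r S) ⊤) ⊔ ⨆ S, ⨆ m, MeasurableSpace.comap (sub r S m) ⊤

/-- The randomizations of the procedure: `pick r S` is uniform on the non-empty set of arms `S`,
`sub r S m` is uniform on the `m`-element subsets of `S`, and the rewards and the randomizations of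
the different rounds are independent. -/
structure IsUniformRandomization (P : Measure Ω) (Y : Fin K → ℕ → Ω → ℝ)
    (pick : ℕ → Finset (Fin K) → Ω → Fin K)
    (sub : ℕ → Finset (Fin K) → ℕ → Ω → Finset (Fin K)) : Prop where
  measurableSet_pick : ∀ r S k, MeasurableSet {ω | pick r S ω = k}
  measurableSet_sub : ∀ r S m T, MeasurableSet {ω | sub r S m ω = T}
  pick_uniform : ∀ r (S : Finset (Fin K)), ∀ k ∈ S,
    P {ω | pick r S ω = k} = (S.card : ℝ≥0∞)⁻¹
  sub_uniform : ∀ r (S : Finset (Fin K)) m, ∀ T ∈ S.powersetCard m,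
    P {ω | sub r S m ω = T} = (S.card.choose m : ℝ≥0∞)⁻¹
  indep : iIndep (fun i : Option ℕ => i.elim (rewardSigma Y) (randomizationSigma pick sub)) P

/-- `E n_k^r`. -/
def expectedCount (P : Measure Ω) (c : ℕ → ℝ) (Y : Fin K → ℕ → Ω → ℝ)
    (pick : ℕ → Finset (Fin K) → Ω → Fin K) (r : ℕ) (k : Fin K) : ℝ :=
  ∫ ω, (count c (fun j t => Y j t ω) (fun q S => pick q S ω) r k : ℝ) ∂P

/-- `E N_k`. -/
def expectedAllocation (P : Measure Ω) (c : ℕ → ℝ) (Y : Fin K → ℕ → Ω → ℝ)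
    (pick : ℕ → Finset (Fin K) → Ω → Fin K)
    (sub : ℕ → Finset (Fin K) → ℕ → Ω → Finset (Fin K)) (N : ℕ) (k : Fin K) : ℝ :=
  ∫ ω, (allocation c (fun j t => Y j t ω) (fun q S => pick q S ω)
    (fun q S m => sub q S m ω) N k : ℝ) ∂P

/-- The largest of the mean rewards. -/
def bestMean (μ : Fin K → ℝ) : ℝ := ⨆ k, μ k

/-- The regret `R_N`, for mean rewards `μ`. -/
def regret (P : Measure Ω) (c : ℕ → ℝ) (μ : Fin K → ℝ) (Y : Fin K → ℕ → Ω → ℝ)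
    (pick : ℕ → Finset (Fin K) → Ω → Fin K)
    (sub : ℕ → Finset (Fin K) → ℕ → Ω → Finset (Fin K)) (N : ℕ) : ℝ :=
  ∑ k, (bestMean μ - μ k) * expectedAllocation P c Y pick sub N k

/-- The information number `M(g) = ½ log (1 + g²)`. -/
def infoM (g : ℝ) : ℝ := 1 / 2 * Real.log (1 + g ^ 2)

/-- The Burnetas–Katehakis lower bound on the asymptotic value of `R_N / log N` for normal arms with
means `μ` and standard deviations `σ`. -/
def regretLowerBound (μ : Fin K → ℝ) (σ : Fin K → ℝ≥0) : ℝ :=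
  ∑ k with μ k < bestMean μ, (bestMean μ - μ k) / infoM ((bestMean μ - μ k) / σ k)

end Random

end

end SSTC

/-!
Rewards enter only through `t`-statistics and sample means of blocks of consecutive rewards, and
two facts about the `t`-statistic of `j` normal rewards carry the proof. First, if its centre
exceeds the mean of the rewards by `g` standard deviations, it concentrates at `-g`. Second, a
block of rewards centred at its own mean reaches a value `-x` with probability
`exp (-(infoM x + o(1)) * j)`: the upper bound (`exists_measureReal_vecT_le`) is Chernoff's
inequality for the exponential moment `lintegral_exp_vecMean_vecDev`, the lower bound
(`exists_le_measureReal_vecT`) is a change of measure to the normal law that minimizes the relative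
entropy.

*Upper bound for an inferior arm `k`.* While the leader is optimal, `k` can win with `j ≥ c_n`
observations only if one of at most `R` blocks of the leader has a `t`-statistic near
`-(μ_* - μ_k) / σ_k`. For `j` above `log R / infoM h`, where `h < (μ_* - μ_k) / σ_k`, the
probabilities of this are summable with a bounded sum (`exists_sum_measureReal_upset_le`). As every
win raises `j`, the count is at most about `log R / infoM h` plus the number of rounds with an
inferior leader (`count_le_add`).

*Inferior leaders are rare.* The leader of round `R` is inferior with probability `o(1 / R)`
(`tendsto_mul_measureReal_inferiorLead`), so that such rounds contribute `o(log R)`. On a sample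
path, an optimal arm that wins all challenges against inferior leaders in the rounds between
`R / 3` and `R` overtakes them, and afterwards an inferior arm does not regain the lead
(`leader_optimal`). To lose such a challenge with `j` observations, where `j` is at most of order
`log R` because beyond its sample mean is accurate, the `t`-statistic of the optimal arm has to
stay below those of all the blocks of an inferior leader, of which there are at least of order
`R / log R` disjoint ones. No explicit density is needed to bound this: take a `p`-quantile of the
`t`-statistic of a block, where `p` is of order `(log R)² / R`. Some block falls below it except
with probability `O(R ^ (-2))`, whereas the optimal arm, whose mean is larger, falls below it with
probability at most `p * exp (-κ * j)`, by a likelihood ratio bound that is uniform over negative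
levels (`measureReal_blocked_at_le`). Since `j ≥ c_n` and `c_n / log log n → ∞`, the factor
`exp (-κ * j)` beats all powers of `log R`.

*Lower bound for an inferior arm `k`.* If `ρ < 1 / infoM ((μ_* - μ_k) / σ_k)`, then for `j` up to
`ρ * log r` one of the order of `r / log r` disjoint blocks of any leader has a `t`-statistic below
that of `k` with probability tending to `1`, so that `k` keeps winning until it has `ρ * log r`
observations (`exists_tendsto_measureReal_hindered`, `le_count_of_blocks`).

Hence `E n_k^r / log r` converges (`tendsto_expectedCount_div_log`). The last round that begins
with at most `N` observations is between `N / K` and `N + 1`, which carries the limit over to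
`E N_k`, and, by summation over the arms, to the regret. For these limits, the counts have to be
integrable; their measurability follows by recursion over the countably many states of the
procedure.
-/

namespace SSTC

noncomputable section

/-! ### Gaussian vectors -/

/-- The integral of a product of functions of the separate coordinates. -/
lemma lintegral_pi_prod {ι : Type*} [Fintype ι] {μ : Measure ℝ} [IsProbabilityMeasure μ]
    {f : ℝ → ℝ≥0∞} (hf : Measurable f) :
    ∫⁻ x, ∏ i, f (x i) ∂(Measure.pi fun _ : ι => μ) = (∫⁻ x, f x ∂μ) ^ Fintype.card ι := by
  have h : iIndepFun (fun (i : ι) (x : ι → ℝ) => f (x i)) (Measure.pi fun _ : ι => μ) :=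
    iIndepFun_pi (X := fun _ => f) fun _ => hf.aemeasurable
  rw [lintegral_prod_eq_prod_lintegral_of_indepFun Finset.univ _ h
    (fun i => hf.comp (measurable_pi_apply i))]
  have : ∀ i : ι, ∫⁻ x, f (x i) ∂(Measure.pi fun _ : ι => μ) = ∫⁻ x, f x ∂μ := fun i =>
    (measurePreserving_eval (fun _ : ι => μ) i).lintegral_comp hf
  simp [this]

/-- A power of a measure given by a density `L` has density `∏ i, L (x i)`. -/
lemma pi_withDensity {ι : Type*} [Fintype ι] {μ : Measure ℝ} [IsProbabilityMeasure μ]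
    {L : ℝ → ℝ≥0∞} (hL : Measurable L) [IsProbabilityMeasure (μ.withDensity L)] :
    (Measure.pi fun _ : ι => μ.withDensity L) =
      (Measure.pi fun _ : ι => μ).withDensity fun x => ∏ i, L (x i) := by
  refine (Measure.pi_eq (μ := fun _ : ι => μ.withDensity L) fun s hs => ?_)
  rw [withDensity_apply _ (MeasurableSet.univ_pi hs),
    ← lintegral_indicator (MeasurableSet.univ_pi hs)]
  have h1 : ∀ x : ι → ℝ, (Set.univ.pi s).indicator (fun x => ∏ i, L (x i)) x =
      ∏ i, (s i).indicator L (x i) := by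
    intro x
    by_cases hx : x ∈ Set.univ.pi s
    · rw [Set.indicator_of_mem hx]
      exact Finset.prod_congr rfl fun i _ => (Set.indicator_of_mem (hx i trivial) _).symm
    · rw [Set.indicator_of_notMem hx]
      simp only [Set.mem_pi, Set.mem_univ, true_implies, not_forall] at hx
      obtain ⟨i, hi⟩ := hx
      exact (Finset.prod_eq_zero (Finset.mem_univ i) (Set.indicator_of_notMem hi _)).symm
  simp only [h1]
  have h : iIndepFun (fun (i : ι) (x : ι → ℝ) => (s i).indicator L (x i))
      (Measure.pi fun _ : ι => μ) :=
    iIndepFun_pi (X := fun i => (s i).indicator L) fun i => (hL.indicator (hs i)).aemeasurable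
  rw [lintegral_prod_eq_prod_lintegral_of_indepFun Finset.univ _ h
    (fun i => (hL.indicator (hs i)).comp (measurable_pi_apply i))]
  refine Finset.prod_congr rfl fun i _ => ?_
  rw [(measurePreserving_eval (fun _ : ι => μ) i).lintegral_comp (hL.indicator (hs i)),
    lintegral_indicator (hs i), withDensity_apply _ (hs i)]

/-- The density of `N(m, v)` with respect to the standard normal law. -/
def gaussianRatio (m v : ℝ) (x : ℝ) : ℝ :=
  (Real.sqrt v)⁻¹ * Real.exp (x ^ 2 / 2 - (x - m) ^ 2 / (2 * v))

lemma measurable_gaussianRatio (m v : ℝ) : Measurable (gaussianRatio m v) := by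
  unfold gaussianRatio; fun_prop

lemma gaussianReal_eq_withDensity (m : ℝ) {v : ℝ≥0} (hv : 0 < v) :
    gaussianReal m v =
      (gaussianReal 0 1).withDensity fun x => ENNReal.ofReal (gaussianRatio m v x) := by
  rw [gaussianReal_of_var_ne_zero _ hv.ne', gaussianReal_of_var_ne_zero _ one_ne_zero,
    ← withDensity_mul _ (measurable_gaussianPDF 0 1)
      (measurable_gaussianRatio m v).ennreal_ofReal]
  congr 1
  ext x
  simp only [Pi.mul_apply, gaussianPDF]
  rw [← ENNReal.ofReal_mul (gaussianPDFReal_nonneg _ _ _)]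
  congr 1
  simp only [gaussianPDFReal, gaussianRatio]
  have hv' : (0 : ℝ) < v := by exact_mod_cast hv
  rw [Real.sqrt_mul (by positivity), NNReal.coe_one, mul_one]
  rw [mul_mul_mul_comm, ← Real.exp_add, mul_inv]
  congr 2
  ring

lemma lintegral_exp_linear_sub_sq {b : ℝ} (hb : 0 < 1 + 2 * b) (t : ℝ) :
    ∫⁻ x, ENNReal.ofReal (Real.exp (t * x - b * x ^ 2)) ∂(gaussianReal 0 1) =
      ENNReal.ofReal ((Real.sqrt (1 + 2 * b))⁻¹ * Real.exp (t ^ 2 / (2 * (1 + 2 * b)))) := by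
  set v : ℝ≥0 := ⟨(1 + 2 * b)⁻¹, by positivity⟩ with hvdef
  have hvc : (v : ℝ) = (1 + 2 * b)⁻¹ := rfl
  have hv : 0 < v := by rw [← NNReal.coe_pos, hvc]; positivity
  have h1 : ∫⁻ x, ENNReal.ofReal (gaussianRatio (t * v) v x) ∂(gaussianReal 0 1) = 1 := by
    have := measure_univ (μ := gaussianReal (t * v) v)
    rwa [gaussianReal_eq_withDensity _ hv, withDensity_apply _ .univ, Measure.restrict_univ] at this
  have h2 : ∀ x, ENNReal.ofReal (Real.exp (t * x - b * x ^ 2)) =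
      ENNReal.ofReal ((Real.sqrt (1 + 2 * b))⁻¹ * Real.exp (t ^ 2 / (2 * (1 + 2 * b)))) *
        ENNReal.ofReal (gaussianRatio (t * v) v x) := by
    intro x
    rw [← ENNReal.ofReal_mul (by positivity)]
    congr 1
    rw [gaussianRatio, hvc, Real.sqrt_inv, inv_inv]
    have : Real.sqrt (1 + 2 * b) ≠ 0 := by positivity
    rw [show (Real.sqrt (1 + 2 * b))⁻¹ * Real.exp (t ^ 2 / (2 * (1 + 2 * b))) *
      (Real.sqrt (1 + 2 * b) * Real.exp (x ^ 2 / 2 - (x - t * (1 + 2 * b)⁻¹) ^ 2 /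
        (2 * (1 + 2 * b)⁻¹))) = ((Real.sqrt (1 + 2 * b))⁻¹ * Real.sqrt (1 + 2 * b)) *
        (Real.exp (t ^ 2 / (2 * (1 + 2 * b))) * Real.exp (x ^ 2 / 2 -
        (x - t * (1 + 2 * b)⁻¹) ^ 2 / (2 * (1 + 2 * b)⁻¹))) by ring, inv_mul_cancel₀ this,
      one_mul, ← Real.exp_add]
    congr 1
    generalize hw : 1 + 2 * b = w at hb
    obtain rfl : b = (w - 1) / 2 := by linarith
    field_simp
    ring
  simp only [h2]
  rw [lintegral_const_mul _ (measurable_gaussianRatio _ _).ennreal_ofReal, h1, mul_one]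

/-- The law of `j` independent standard normal variables. -/
abbrev stdGauss (j : ℕ) : Measure (Fin j → ℝ) := Measure.pi fun _ => gaussianReal 0 1

/-- Mean of the entries of a vector. -/
def vecMean {j : ℕ} (x : Fin j → ℝ) : ℝ := (∑ i, x i) / j

/-- Sum of the squared deviations of the entries of a vector from their mean. -/
def vecDev {j : ℕ} (x : Fin j → ℝ) : ℝ := ∑ i, (x i - vecMean x) ^ 2

/-- Standard error estimate (divisor `j - 1`) of the entries of a vector. -/
def vecSd {j : ℕ} (x : Fin j → ℝ) : ℝ := Real.sqrt (vecDev x / ((j : ℝ) - 1))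

/-- `t`-statistic, centred at `a`, of the entries of a vector. -/
def vecT {j : ℕ} (x : Fin j → ℝ) (a : ℝ) : ℝ := (vecMean x - a) / vecSd x

variable {j : ℕ}

@[fun_prop] lemma measurable_vecMean : Measurable (vecMean (j := j)) := by
  unfold vecMean; fun_prop

@[fun_prop] lemma measurable_vecDev : Measurable (vecDev (j := j)) := by
  unfold vecDev; fun_prop

@[fun_prop] lemma measurable_vecSd : Measurable (vecSd (j := j)) := by
  unfold vecSd; fun_prop

@[fun_prop] lemma measurable_vecT (a : ℝ) : Measurable (fun x : Fin j → ℝ => vecT x a) := by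
  unfold vecT; fun_prop

lemma vecSd_nonneg (x : Fin j → ℝ) : 0 ≤ vecSd x := Real.sqrt_nonneg _

lemma vecT_anti (x : Fin j → ℝ) {a b : ℝ} (h : a ≤ b) : vecT x b ≤ vecT x a := by
  unfold vecT
  exact div_le_div_of_nonneg_right (by linarith) (vecSd_nonneg x)

lemma sum_eq_mul_vecMean (x : Fin j → ℝ) : ∑ i, x i = j * vecMean x := by
  unfold vecMean
  rcases Nat.eq_zero_or_pos j with rfl | h
  · simp
  · field_simp

lemma vecDev_eq (x : Fin j → ℝ) : vecDev x = ∑ i, x i ^ 2 - j * vecMean x ^ 2 := by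
  unfold vecDev
  simp only [sub_sq, Finset.sum_add_distrib, Finset.sum_sub_distrib, Finset.sum_const,
    Finset.card_univ, Fintype.card_fin, nsmul_eq_mul]
  rw [← Finset.sum_mul, ← Finset.mul_sum, sum_eq_mul_vecMean x]
  ring

lemma vecMean_affine (hj : j ≠ 0) (m s : ℝ) (x : Fin j → ℝ) :
    vecMean (fun i => m + s * x i) = m + s * vecMean x := by
  unfold vecMean
  simp only [Finset.sum_add_distrib, Finset.sum_const, Finset.card_univ, Fintype.card_fin,
    nsmul_eq_mul, ← Finset.mul_sum]
  have : (j : ℝ) ≠ 0 := by exact_mod_cast hj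
  field_simp

lemma vecDev_affine (m s : ℝ) (x : Fin j → ℝ) :
    vecDev (fun i => m + s * x i) = s ^ 2 * vecDev x := by
  rcases Nat.eq_zero_or_pos j with rfl | h
  · simp [vecDev]
  unfold vecDev
  rw [vecMean_affine h.ne', Finset.mul_sum]
  exact Finset.sum_congr rfl fun i _ => by ring

lemma vecSd_affine (m : ℝ) {s : ℝ} (hs : 0 ≤ s) (x : Fin j → ℝ) :
    vecSd (fun i => m + s * x i) = s * vecSd x := by
  unfold vecSd
  rw [vecDev_affine, mul_div_assoc, Real.sqrt_mul (sq_nonneg s), Real.sqrt_sq hs]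

lemma vecT_affine (m : ℝ) {s : ℝ} (hs : 0 < s) (x : Fin j → ℝ) (a : ℝ) :
    vecT (fun i => m + s * x i) a = vecT x ((a - m) / s) := by
  unfold vecT
  rw [vecSd_affine m hs.le]
  rcases Nat.eq_zero_or_pos j with rfl | h
  · simp [vecSd, vecDev]
  rw [vecMean_affine h.ne', ← div_div]
  congr 1
  field_simp
  ring

/-- Chernoff's bound in terms of an exponent that is non-negative on the event. -/
lemma measureReal_le_of_lintegral_exp {α : Type*} [MeasurableSpace α] {ν : Measure α} {A : Set α}
    {f : α → ℝ} (hfm : Measurable f) (hf : ∀ x ∈ A, 0 ≤ f x) {C : ℝ} (hC : 0 ≤ C)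
    (h : ∫⁻ x, ENNReal.ofReal (Real.exp (f x)) ∂ν ≤ ENNReal.ofReal C) : ν.real A ≤ C := by
  refine ENNReal.toReal_le_of_le_ofReal hC (le_trans ?_ h)
  exact meas_le_lintegral₀ (by fun_prop) fun x hx => by simpa using hf x hx

lemma lintegral_exp_sum {b : ℝ} (hb : 0 < 1 + 2 * b) (t : ℝ) (j : ℕ) :
    ∫⁻ x, ENNReal.ofReal (Real.exp (t * ∑ i, x i - b * ∑ i, x i ^ 2)) ∂(stdGauss j) =
      ENNReal.ofReal (((Real.sqrt (1 + 2 * b))⁻¹ * Real.exp (t ^ 2 / (2 * (1 + 2 * b)))) ^ j) := by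
  have h : ∀ x : Fin j → ℝ, ENNReal.ofReal (Real.exp (t * ∑ i, x i - b * ∑ i, x i ^ 2)) =
      ∏ i, ENNReal.ofReal (Real.exp (t * x i - b * x i ^ 2)) := by
    intro x
    rw [← ENNReal.ofReal_prod_of_nonneg (fun i _ => (Real.exp_pos _).le), ← Real.exp_sum,
      Finset.mul_sum, Finset.mul_sum, Finset.sum_sub_distrib]
  simp only [h]
  rw [lintegral_pi_prod (f := fun y => ENNReal.ofReal (Real.exp (t * y - b * y ^ 2)))
    (by fun_prop), lintegral_exp_linear_sub_sq hb, Fintype.card_fin,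
    ENNReal.ofReal_pow (by positivity)]

end

noncomputable section

/-! ### Chernoff bounds for the sample mean and the sample variance -/

variable {j : ℕ}

/-- The joint exponential moment of the squared mean and of the sum of squared deviations. The
square of the mean is linearized by means of an additional standard normal variable. -/
lemma lintegral_exp_vecMean_vecDev (hj : j ≠ 0) {a b : ℝ} (hb : 0 ≤ b) (ha : 0 ≤ a)
    (ha' : a < 1 / 2) :
    ∫⁻ x, ENNReal.ofReal (Real.exp (a * (j * vecMean x ^ 2) - b * vecDev x)) ∂(stdGauss j) =
      ENNReal.ofReal ((Real.sqrt (1 + 2 * b))⁻¹ ^ j *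
        (Real.sqrt ((1 - 2 * a) / (1 + 2 * b)))⁻¹) := by
  have hj' : (0 : ℝ) < j := by positivity
  set q : ℝ := Real.sqrt (2 * (a + b) / j) with hq
  have hq2 : q ^ 2 = 2 * (a + b) / j := Real.sq_sqrt (by positivity)
  have hb1 : 0 < 1 + 2 * b := by positivity
  have key : ∀ x : Fin j → ℝ,
      ENNReal.ofReal (Real.exp (a * (j * vecMean x ^ 2) - b * vecDev x)) =
      ∫⁻ g, ENNReal.ofReal (Real.exp ((q * g) * ∑ i, x i - b * ∑ i, x i ^ 2))
        ∂(gaussianReal 0 1) := by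
    intro x
    have h := lintegral_exp_linear_sub_sq (b := 0) (by norm_num) (q * ∑ i, x i)
    simp only [mul_zero, add_zero, Real.sqrt_one, inv_one, one_mul, zero_mul, sub_zero,
      mul_one] at h
    have h' : ∀ g : ℝ, ENNReal.ofReal (Real.exp ((q * g) * ∑ i, x i - b * ∑ i, x i ^ 2)) =
        ENNReal.ofReal (Real.exp (- (b * ∑ i, x i ^ 2))) *
        ENNReal.ofReal (Real.exp ((q * ∑ i, x i) * g)) := by
      intro g
      rw [← ENNReal.ofReal_mul (Real.exp_pos _).le, ← Real.exp_add]
      congr 2; ring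
    simp only [h']
    rw [lintegral_const_mul _ (by fun_prop), h, ← ENNReal.ofReal_mul (Real.exp_pos _).le,
      ← Real.exp_add, vecDev_eq, sum_eq_mul_vecMean x, mul_pow, hq2]
    congr 2
    field_simp
    ring
  simp only [key]
  rw [lintegral_lintegral_swap (by fun_prop)]
  simp only [lintegral_exp_sum hb1]
  have h2 : ∀ g : ℝ, ENNReal.ofReal (((Real.sqrt (1 + 2 * b))⁻¹ *
      Real.exp ((q * g) ^ 2 / (2 * (1 + 2 * b)))) ^ j) =
      ENNReal.ofReal ((Real.sqrt (1 + 2 * b))⁻¹ ^ j) *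
      ENNReal.ofReal (Real.exp (0 * g - (-((a + b) / (1 + 2 * b))) * g ^ 2)) := by
    intro g
    rw [← ENNReal.ofReal_mul (by positivity), mul_pow, ← Real.exp_nat_mul]
    congr 3
    rw [mul_pow, hq2]
    field_simp
    ring
  have h3 : 1 + 2 * (-((a + b) / (1 + 2 * b))) = (1 - 2 * a) / (1 + 2 * b) := by
    field_simp; ring
  simp only [h2]
  rw [lintegral_const_mul _ (by fun_prop), lintegral_exp_linear_sub_sq, h3,
    ← ENNReal.ofReal_mul (by positivity)]
  · simp
  · rw [h3]; have : 0 < 1 - 2 * a := by linarith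
    positivity

lemma measureReal_le_abs_vecMean {δ : ℝ} (hδ : 0 ≤ δ) :
    (stdGauss j).real {x | δ ≤ |vecMean x|} ≤ 2 * Real.exp (-(δ ^ 2 / 2) * j) := by
  have one : ∀ s : ℝ, s ^ 2 = 1 →
      (stdGauss j).real {x | δ ≤ s * vecMean x} ≤ Real.exp (-(δ ^ 2 / 2) * j) := by
    intro s hs
    refine measureReal_le_of_lintegral_exp
      (f := fun x => ((s * δ) * ∑ i, x i - 0 * ∑ i, x i ^ 2) + (- δ ^ 2 * j)) (by fun_prop) ?_
      (Real.exp_pos _).le ?_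
    · intro x hx
      rw [sum_eq_mul_vecMean x]
      have : δ * δ * j ≤ δ * (s * vecMean x) * j := by
        gcongr; exact hx
      nlinarith
    · simp only [Real.exp_add, ENNReal.ofReal_mul (Real.exp_pos _).le]
      rw [lintegral_mul_const _ (by fun_prop), lintegral_exp_sum (by norm_num),
        ← ENNReal.ofReal_mul (by positivity)]
      refine ENNReal.ofReal_le_ofReal (le_of_eq ?_)
      simp only [mul_zero, add_zero, Real.sqrt_one, inv_one, one_mul, mul_one]
      rw [← Real.exp_nat_mul, ← Real.exp_add, mul_pow, hs]
      congr 1; ring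
  calc (stdGauss j).real {x | δ ≤ |vecMean x|}
      ≤ (stdGauss j).real ({x | δ ≤ 1 * vecMean x} ∪ {x | δ ≤ (-1) * vecMean x}) := by
        refine measureReal_mono fun x hx => ?_
        simpa [le_abs] using hx
    _ ≤ _ := (measureReal_union_le _ _).trans (by
        linarith [one 1 (by norm_num), one (-1) (by norm_num)])

/-- `log θ < θ - 1`, in the form in which it enters Chernoff bounds for sums of squares. -/
lemma sqrt_inv_mul_exp_lt_one {q : ℝ} (hq : 0 < q) (hq1 : q ≠ 1) :
    (Real.sqrt (1 / q))⁻¹ * Real.exp (-((q - 1) / 2)) < 1 := by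
  have h := Real.log_lt_sub_one_of_pos hq hq1
  rw [one_div, Real.sqrt_inv, inv_inv, Real.sqrt_eq_rpow, Real.rpow_def_of_pos hq,
    ← Real.exp_add, Real.exp_lt_one_iff]
  linarith

/-- Chernoff's bound for sums of squares, on either side of the mean: the exponent is the one that
is optimal for the level `q`, and `d` is an additive slack. -/
lemma measureReal_sum_sq_le_of_exponent {q d : ℝ} (hq : 0 < q) (A : Set (Fin j → ℝ))
    (hA : ∀ x ∈ A, 0 ≤ (1 - 1 / q) * (∑ i, x i ^ 2 - q * j) + 2 * d) :
    (stdGauss j).real A ≤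
      Real.exp d * ((Real.sqrt (1 / q))⁻¹ * Real.exp (-((q - 1) / 2))) ^ j := by
  have e : (1 : ℝ) + 2 * (-((1 - 1 / q) / 2)) = 1 / q := by ring
  refine measureReal_le_of_lintegral_exp
    (f := fun x => (0 * ∑ i, x i - (-((1 - 1 / q) / 2)) * ∑ i, x i ^ 2) +
      (d - ((q - 1) / 2) * j))
    (by fun_prop) ?_ (by positivity) ?_
  · intro x hx
    have h := hA x hx
    have : (1 - 1 / q) * (∑ i, x i ^ 2 - q * j) =
      (1 - 1 / q) * ∑ i, x i ^ 2 - (q - 1) * j := by field_simp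
    rw [this] at h
    linarith
  · simp only [Real.exp_add, ENNReal.ofReal_mul (Real.exp_pos _).le]
    rw [lintegral_mul_const _ (by fun_prop), lintegral_exp_sum (by rw [e]; positivity), e,
      ← ENNReal.ofReal_mul (by positivity), ← ENNReal.ofReal_mul (by positivity)]
    refine ENNReal.ofReal_le_ofReal (le_of_eq ?_)
    rw [mul_pow, mul_pow, ← Real.exp_nat_mul, ← Real.exp_nat_mul]
    have e1 : (j : ℝ) * (0 ^ 2 / (2 * (1 / q))) = 0 := by simp
    rw [e1, Real.exp_zero, mul_one, sub_eq_add_neg, Real.exp_add, mul_left_comm]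
    congr 3; ring

lemma vecDev_eq_mul_vecSd_sq (x : Fin j → ℝ) : vecDev x = ((j : ℝ) - 1) * vecSd x ^ 2 := by
  rcases lt_trichotomy j 1 with h | rfl | h
  · obtain rfl : j = 0 := by omega
    simp [vecDev, vecSd]
  · simp [vecDev, vecMean]
  · have hj : (0 : ℝ) < (j : ℝ) - 1 := by
      have : (1 : ℝ) < j := by exact_mod_cast h
      linarith
    unfold vecSd
    have h0 : 0 ≤ vecDev x := Finset.sum_nonneg fun i _ => sq_nonneg _
    rw [Real.sq_sqrt (div_nonneg h0 hj.le)]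
    field_simp

/-- A bound by a geometric sequence of ratio below `1`, in exponential form. -/
lemma exists_exp_bound_of_lt_one {ρ : ℝ} (h0 : 0 ≤ ρ) (h1 : ρ < 1) :
    ∃ κ > 0, ∀ j : ℕ, ρ ^ j ≤ Real.exp (-κ * j) := by
  refine ⟨-Real.log (max ρ (1 / 2)), ?_, fun j => ?_⟩
  · have := Real.log_neg (x := max ρ (1 / 2)) (by positivity) (max_lt h1 (by norm_num))
    linarith
  · rw [neg_neg, mul_comm, Real.exp_nat_mul, Real.exp_log (by positivity)]
    gcongr
    exact le_max_left _ _

lemma exists_measureReal_le_vecSd {θ : ℝ} (hθ : 1 < θ) :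
    ∃ κ > 0, ∃ C > 0, ∀ j : ℕ, (stdGauss j).real {x | θ ≤ vecSd x} ≤ C * Real.exp (-κ * j) := by
  set q := θ ^ 2 with hq
  have hq1 : 1 < q := by nlinarith
  obtain ⟨κ, hκ, hb⟩ := exists_exp_bound_of_lt_one (by positivity)
    (sqrt_inv_mul_exp_lt_one (q := q) (by linarith) (by linarith))
  set D := (q - 1) / 2 with hD
  -- The divisor `j - 1` costs a constant factor `exp D`.
  refine ⟨κ, hκ, Real.exp D, Real.exp_pos _, fun j => ?_⟩
  refine (measureReal_sum_sq_le_of_exponent (q := q) (d := D) (by positivity) _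
    fun x hx => ?_).trans (by gcongr; exact hb j)
  have h := vecDev_eq_mul_vecSd_sq x
  rw [vecDev_eq] at h
  have hx' : q ≤ vecSd x ^ 2 := by rw [hq]; gcongr; exact hx
  have hj : (1 : ℝ) ≤ j := by
    have : j ≠ 0 := by
      rintro rfl
      have : vecSd x = 0 := by simp [vecSd, vecDev]
      rw [Set.mem_ofPred_eq, this] at hx
      linarith
    exact_mod_cast Nat.one_le_iff_ne_zero.2 this
  have h1 : q * ((j : ℝ) - 1) ≤ ∑ i, x i ^ 2 := by
    have : q * ((j : ℝ) - 1) ≤ vecSd x ^ 2 * ((j : ℝ) - 1) := by gcongr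
    nlinarith [mul_nonneg (show (0 : ℝ) ≤ j by linarith) (sq_nonneg (vecMean x))]
  have h2 : 0 ≤ 1 - 1 / q := by
    have : 1 / q ≤ 1 := (div_le_one (by linarith)).2 hq1.le
    linarith
  have h3 := mul_le_mul_of_nonneg_left h1 h2
  have h4 : (1 - 1 / q) * (q * ((j : ℝ) - 1)) = (q - 1) * (j - 1) := by
    field_simp
  have h5 : (1 - 1 / q) * (q * j) = (q - 1) * j := by field_simp
  rw [h4] at h3
  rw [mul_sub, h5, hD]; linarith

lemma exists_measureReal_sum_sq_le {q : ℝ} (hq0 : 0 < q) (hq1 : q < 1) :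
    ∃ κ > 0, ∀ j : ℕ,
      (stdGauss j).real {x | ∑ i, x i ^ 2 ≤ q * j} ≤ Real.exp (-κ * j) := by
  obtain ⟨κ, hκ, hb⟩ := exists_exp_bound_of_lt_one (by positivity)
    (sqrt_inv_mul_exp_lt_one (q := q) hq0 hq1.ne)
  refine ⟨κ, hκ, fun j => (measureReal_sum_sq_le_of_exponent (d := 0) hq0 _
    fun x hx => ?_).trans (by simpa using hb j)⟩
  have : 1 ≤ 1 / q := (one_le_div hq0).2 hq1.le
  have hx' : ∑ i, x i ^ 2 - q * j ≤ 0 := sub_nonpos.2 hx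
  nlinarith

lemma exists_measureReal_vecSd_le {θ : ℝ} (h0 : 0 ≤ θ) (hθ : θ < 1) :
    ∃ κ > 0, ∃ C > 0, ∀ j : ℕ, (stdGauss j).real {x | vecSd x ≤ θ} ≤ C * Real.exp (-κ * j) := by
  have hθ2 : θ ^ 2 < 1 := by nlinarith
  set q := (1 + θ ^ 2) / 2 with hq
  obtain ⟨κ, hκ, hb⟩ := exists_measureReal_sum_sq_le (q := q) (by positivity) (by linarith)
  set η := Real.sqrt ((1 - θ ^ 2) / 2) with hη
  have hη0 : 0 < η := Real.sqrt_pos.2 (by linarith)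
  have hη2 : η ^ 2 = (1 - θ ^ 2) / 2 := Real.sq_sqrt (by linarith)
  refine ⟨min κ (η ^ 2 / 2), by positivity, 3, by norm_num, fun j => ?_⟩
  calc (stdGauss j).real {x | vecSd x ≤ θ}
      ≤ (stdGauss j).real ({x | ∑ i, x i ^ 2 ≤ q * j} ∪ {x | η ≤ |vecMean x|}) := by
        refine measureReal_mono fun x hx => ?_
        by_contra hcon
        simp only [Set.mem_union, Set.mem_ofPred_eq, not_or, not_le] at hcon hx
        obtain ⟨h1, h2⟩ := hcon
        have h3 := vecDev_eq_mul_vecSd_sq x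
        rw [vecDev_eq] at h3
        have h4 : vecMean x ^ 2 ≤ η ^ 2 := by
          rw [← sq_abs]; gcongr
        have h5 : vecSd x ^ 2 ≤ θ ^ 2 := by gcongr; exact vecSd_nonneg x
        have h6 : ((j : ℝ) - 1) * vecSd x ^ 2 ≤ j * θ ^ 2 := by
          nlinarith [sq_nonneg (vecSd x), Nat.cast_nonneg (α := ℝ) j]
        have h7 : (j : ℝ) * vecMean x ^ 2 ≤ j * η ^ 2 := by gcongr
        rw [hη2] at h7
        rw [hq] at h1
        nlinarith
    _ ≤ Real.exp (-κ * j) + 2 * Real.exp (-(η ^ 2 / 2) * j) :=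
        (measureReal_union_le _ _).trans (add_le_add (hb j) (measureReal_le_abs_vecMean hη0.le))
    _ ≤ Real.exp (-(min κ (η ^ 2 / 2)) * j) + 2 * Real.exp (-(min κ (η ^ 2 / 2)) * j) := by
        gcongr
        · exact min_le_left _ _
        · exact min_le_right _ _
    _ = _ := by ring

end

noncomputable section

/-! ### Large deviations of the `t`-statistic -/

variable {j : ℕ}

lemma infoM_pos {g : ℝ} (hg : g ≠ 0) : 0 < infoM g := by
  unfold infoM
  have : 0 < Real.log (1 + g ^ 2) := Real.log_pos (by have := sq_pos_of_ne_zero hg; linarith)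
  positivity

/-- Upper bound for the tail of the `t`-statistic, with the exact exponential rate `infoM`. -/
lemma exists_measureReal_vecT_le {h x : ℝ} (hh : 0 < h) (hx : h < x) :
    ∃ δ > 0, ∃ C > 0, ∀ j : ℕ,
      (stdGauss j).real {y | vecT y δ ≤ -x} ≤ C * Real.exp (-infoM h * j) := by
  have hx0 : 0 < x := hh.trans hx
  have hxx : h ^ 2 < x ^ 2 := by nlinarith
  set ρ : ℝ := (1 + h ^ 2 / x ^ 2) / 2 with hρ
  have hρ0 : 0 < ρ := by positivity
  have hhx1 : h ^ 2 / x ^ 2 < 1 := (div_lt_one (by positivity)).2 hxx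
  have hρ1 : ρ < 1 := by rw [hρ]; linarith
  have hρx : h ^ 2 < ρ * x ^ 2 := by
    have : h ^ 2 = h ^ 2 / x ^ 2 * x ^ 2 := by field_simp
    rw [this, hρ]
    have : 0 < x ^ 2 := by positivity
    nlinarith
  -- `a` is close to `1 / 2`, and `2 * b = ρ * x ^ 2` is between `h ^ 2` and `x ^ 2`.
  set t : ℝ := (1 - ρ) / (1 + ρ) with ht
  have ht0 : 0 < t := div_pos (by linarith) (by linarith)
  have ht1 : t < 1 := (div_lt_one (by linarith)).2 (by linarith)
  have htρ : (1 - t) / (1 + t) = ρ := by rw [ht]; field_simp; ring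
  set a : ℝ := (1 - t) / 2 with ha
  have ha0 : 0 < a := by rw [ha]; linarith
  set b : ℝ := ρ * x ^ 2 / 2 with hb
  have hb0 : 0 < b := by positivity
  set gap : ℝ := 1 / 2 * Real.log (1 + 2 * b) - infoM h with hgap
  have hgap0 : 0 < gap := by
    have : Real.log (1 + h ^ 2) < Real.log (1 + 2 * b) :=
      Real.log_lt_log (by positivity) (by rw [hb]; linarith)
    rw [hgap, infoM]; linarith
  set δ : ℝ := Real.sqrt (gap * t / a) with hδ
  have hδ2 : δ ^ 2 = gap * t / a := Real.sq_sqrt (by positivity)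
  set c : ℝ := (Real.sqrt ((1 - 2 * a) / (1 + 2 * b)))⁻¹ with hc
  have h2a : 0 < 1 - 2 * a := by rw [ha]; linarith
  have hc0 : 0 < c := inv_pos.2 (Real.sqrt_pos.2 (by positivity))
  refine ⟨δ, Real.sqrt_pos.2 (by positivity), c, hc0, fun j => ?_⟩
  rcases Nat.eq_zero_or_pos j with rfl | hj
  · have : {y : Fin 0 → ℝ | vecT y δ ≤ -x} = ∅ := by
      ext y; simp [vecT, vecSd, vecDev, hx0]
    rw [this]; simp [hc0.le]
  -- On the event, `a * (mean)²` exceeds `b * (standard error)²` up to the additive error `gap`.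
  refine measureReal_le_of_lintegral_exp
    (f := fun y => (a * (j * vecMean y ^ 2) - b * vecDev y) + gap * j) (by fun_prop) ?_
    (by positivity) ?_
  · intro y hy
    have hy' : (vecMean y - δ) / vecSd y ≤ -x := hy
    have hsd : 0 < vecSd y := by
      refine lt_of_le_of_ne (vecSd_nonneg y) fun h0 => ?_
      rw [← h0, div_zero] at hy'; linarith
    rw [div_le_iff₀ hsd] at hy'
    have h1 : (x * vecSd y) ^ 2 ≤ (δ - vecMean y) ^ 2 := by
      gcongr; linarith
    have h2 : (δ - vecMean y) ^ 2 ≤ (1 + t) * vecMean y ^ 2 + (1 + 1 / t) * δ ^ 2 := by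
      have h3 : 0 ≤ (t * vecMean y + δ) ^ 2 / t := by positivity
      have h4 : (t * vecMean y + δ) ^ 2 / t =
        t * vecMean y ^ 2 + 2 * vecMean y * δ + 1 / t * δ ^ 2 := by field_simp; ring
      nlinarith
    have hab : a * x ^ 2 = b * (1 + t) := by
      rw [hb, ← htρ, ha]; field_simp
    have hδt : a * δ ^ 2 = gap * t := by rw [hδ2]; field_simp
    have h5 : b * (1 + t) * vecSd y ^ 2 ≤ (1 + t) * (a * vecMean y ^ 2 + gap) := by
      calc b * (1 + t) * vecSd y ^ 2 = a * (x * vecSd y) ^ 2 := by rw [← hab]; ring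
        _ ≤ a * ((1 + t) * vecMean y ^ 2 + (1 + 1 / t) * δ ^ 2) := by
          gcongr; exact h1.trans h2
        _ = (1 + t) * (a * vecMean y ^ 2) + (1 + 1 / t) * (a * δ ^ 2) := by ring
        _ = (1 + t) * (a * vecMean y ^ 2 + gap) := by rw [hδt]; field_simp; ring
    have h6 : b * vecSd y ^ 2 ≤ a * vecMean y ^ 2 + gap := by
      by_contra! hcon
      nlinarith [mul_lt_mul_of_pos_left hcon (show 0 < 1 + t by linarith)]
    have h7 : (j : ℝ) * (b * vecSd y ^ 2) ≤ j * (a * vecMean y ^ 2 + gap) := by gcongr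
    have h8 : 0 ≤ b * vecSd y ^ 2 := by positivity
    have h9 : a * (j * vecMean y ^ 2) - b * vecDev y + gap * j =
        (j * (a * vecMean y ^ 2 + gap) - j * (b * vecSd y ^ 2)) + b * vecSd y ^ 2 := by
      rw [vecDev_eq_mul_vecSd_sq]; ring
    rw [h9]
    linarith
  · simp only [Real.exp_add, ENNReal.ofReal_mul (Real.exp_pos _).le]
    rw [lintegral_mul_const _ (by fun_prop),
      lintegral_exp_vecMean_vecDev hj.ne' hb0.le ha0.le (by linarith),
      ← ENNReal.ofReal_mul (by positivity)]
    refine ENNReal.ofReal_le_ofReal (le_of_eq ?_)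
    have hp : 0 < 1 + 2 * b := by positivity
    rw [← hc, Real.sqrt_eq_rpow, ← Real.rpow_neg hp.le, Real.rpow_def_of_pos hp,
      ← Real.exp_nat_mul, mul_right_comm, ← Real.exp_add, mul_comm c]
    congr 2
    rw [hgap]; ring

/-- The joint law of `j` independent `N(m, τ²)` variables, as an image and by its density. -/
lemma map_affine_stdGauss (m : ℝ) {τ : ℝ} (hτ : 0 < τ) (j : ℕ) :
    (stdGauss j).map (fun x i => m + τ * x i) =
      (stdGauss j).withDensity fun x => ENNReal.ofReal (∏ i, gaussianRatio m (τ ^ 2) (x i)) := by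
  set v : ℝ≥0 := ⟨τ ^ 2, sq_nonneg τ⟩ with hv
  have hv0 : 0 < v := by rw [← NNReal.coe_pos]; exact pow_pos hτ 2
  have h1 : (gaussianReal 0 1).map (fun x => m + τ * x) = gaussianReal m v := by
    have e : (fun x => m + τ * x) = (m + ·) ∘ (τ * ·) := rfl
    rw [e, ← Measure.map_map (by fun_prop) (by fun_prop), gaussianReal_map_const_mul,
      gaussianReal_map_const_add]
    rw [mul_zero, zero_add, mul_one]
    rfl
  have h2 := gaussianReal_eq_withDensity m hv0
  have : IsProbabilityMeasure ((gaussianReal 0 1).withDensity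
      fun x => ENNReal.ofReal (gaussianRatio m v x)) := by rw [← h2]; infer_instance
  have h3 := pi_withDensity (ι := Fin j) (μ := gaussianReal 0 1)
    (L := fun x => ENNReal.ofReal (gaussianRatio m v x))
    (measurable_gaussianRatio m v).ennreal_ofReal
  rw [← h2] at h3
  have h4 := Measure.pi_map_pi (μ := fun _ : Fin j => gaussianReal 0 1)
    (f := fun _ x => m + τ * x) (fun i => by fun_prop)
  have hpos : ∀ x, 0 ≤ gaussianRatio m (τ ^ 2) x := fun x => by unfold gaussianRatio; positivity
  rw [h4]
  simp only [h1]
  rw [h3]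
  congr 1
  ext x
  rw [ENNReal.ofReal_prod_of_nonneg fun i _ => hpos _]
  rfl

lemma gaussianRatio_prod_eq (m : ℝ) {τ : ℝ} (hτ : 0 < τ) (x : Fin j → ℝ) :
    ∏ i, gaussianRatio m (τ ^ 2) (x i) =
      Real.exp (∑ i, (-Real.log τ + x i ^ 2 / 2 - (x i - m) ^ 2 / (2 * τ ^ 2))) := by
  rw [Real.exp_sum]
  refine Finset.prod_congr rfl fun i _ => ?_
  rw [gaussianRatio, Real.sqrt_sq hτ.le, add_sub_assoc, Real.exp_add, Real.exp_neg,
    Real.exp_log hτ]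

/-- Comparison of two shifts of a standard normal vector: where the mean is not positive, the
likelihood ratio of the larger to the smaller shift is at most `exp (-j (d'² - d²) / 2)`. -/
lemma measureReal_shift_le {d d' : ℝ} (hd : d ≤ d') {A : Set (Fin j → ℝ)} (hAm : MeasurableSet A)
    (hA : ∀ x ∈ A, vecMean x ≤ 0) :
    (stdGauss j).real {x | (fun i => d' + 1 * x i) ∈ A} ≤
      Real.exp (-((d' ^ 2 - d ^ 2) / 2) * j) *
        (stdGauss j).real {x | (fun i => d + 1 * x i) ∈ A} := by
  have hAs : ∀ x ∈ A, ∑ i, x i ≤ 0 := fun x hx => by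
    rw [sum_eq_mul_vecMean]
    exact mul_nonpos_of_nonneg_of_nonpos (Nat.cast_nonneg j) (hA x hx)
  have law : ∀ d : ℝ, (stdGauss j) {x | (fun i => d + 1 * x i) ∈ A} =
      ∫⁻ x in A, ENNReal.ofReal (Real.exp (d * ∑ i, x i - d ^ 2 / 2 * j)) ∂(stdGauss j) := by
    intro d
    have h1 := Measure.map_apply (μ := stdGauss j) (f := fun x i => d + 1 * x i)
      (by fun_prop) hAm
    rw [map_affine_stdGauss d one_pos, withDensity_apply _ hAm] at h1
    refine h1.symm.trans (lintegral_congr fun x => ?_)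
    rw [gaussianRatio_prod_eq d one_pos]
    congr 2
    simp only [Real.log_one, neg_zero, zero_add, one_pow, mul_one]
    rw [Finset.mul_sum]
    have : ∀ i, x i ^ 2 / 2 - (x i - d) ^ 2 / 2 = d * x i - d ^ 2 / 2 := fun i => by ring
    simp only [this, Finset.sum_sub_distrib, Finset.sum_const, Finset.card_univ, Fintype.card_fin,
      nsmul_eq_mul]
    ring
  have main : (stdGauss j) {x | (fun i => d' + 1 * x i) ∈ A} ≤
      ENNReal.ofReal (Real.exp (-((d' ^ 2 - d ^ 2) / 2) * j)) *
        (stdGauss j) {x | (fun i => d + 1 * x i) ∈ A} := by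
    rw [law, law, ← lintegral_const_mul _ (by fun_prop)]
    refine setLIntegral_mono (by fun_prop) fun x hx => ?_
    rw [← ENNReal.ofReal_mul (Real.exp_pos _).le, ← Real.exp_add]
    refine ENNReal.ofReal_le_ofReal (Real.exp_le_exp.2 ?_)
    nlinarith [mul_nonneg (sub_nonneg.2 hd) (neg_nonneg.2 (hAs x hx))]
  have := ENNReal.toReal_mono (by finiteness) main
  rwa [ENNReal.toReal_mul, ENNReal.toReal_ofReal (Real.exp_pos _).le] at this

/-- Moving the centre from `-d` down to `-d'` makes values of the `t`-statistic below a level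
`t ≤ 0` exponentially less likely, uniformly in `t`. -/
lemma measureReal_vecT_lt_le {d d' t : ℝ} (hd : d ≤ d') (ht : t ≤ 0) (j : ℕ) :
    (stdGauss j).real {x | vecT x (-d') < t} ≤
      Real.exp (-((d' ^ 2 - d ^ 2) / 2) * j) * (stdGauss j).real {x | vecT x (-d) < t} := by
  have h := measureReal_shift_le hd (A := {x : Fin j → ℝ | vecT x 0 < t})
    (measurableSet_lt (by fun_prop) (by fun_prop)) fun x hx => by
      have hx' : (vecMean x - 0) / vecSd x < t := hx
      by_contra! hcon
      have : 0 ≤ (vecMean x - 0) / vecSd x := div_nonneg (by linarith) (vecSd_nonneg x)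
      linarith
  simpa only [Set.mem_ofPred_eq, vecT_affine _ one_pos, zero_sub, div_one] using h

/-- A quantile of a probability measure. -/
lemma exists_quantile (ν : Measure ℝ) [IsProbabilityMeasure ν] {p : ℝ} (hp : 0 < p)
    (h0 : p ≤ ν.real (Set.Iic 0)) :
    ∃ t ≤ 0, p ≤ ν.real (Set.Iic t) ∧ ν.real (Set.Iio t) ≤ p := by
  have hcdf : ∀ t, cdf ν t = ν.real (Set.Iic t) := cdf_eq_real ν
  set S : Set ℝ := {t | p ≤ cdf ν t} with hS
  have h0S : (0 : ℝ) ∈ S := by rw [hS, Set.mem_ofPred_eq, hcdf]; exact h0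
  have hbdd : BddBelow S := by
    obtain ⟨b, hb⟩ := ((tendsto_cdf_atBot ν).eventually_lt_const hp).exists
    refine ⟨b, fun t ht => ?_⟩
    by_contra! hlt
    exact absurd ((ht : p ≤ _).trans (monotone_cdf ν hlt.le)) (not_le.2 hb)
  refine ⟨sInf S, csInf_le hbdd h0S, ?_, ?_⟩
  · rw [← hcdf]
    have hc : Tendsto (cdf ν) (𝓝[>] (sInf S)) (𝓝 (cdf ν (sInf S))) :=
      ((cdf ν).right_continuous (sInf S)).mono_left (nhdsWithin_mono _ Set.Ioi_subset_Ici_self)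
    refine ge_of_tendsto hc ?_
    filter_upwards [self_mem_nhdsWithin] with s hs
    obtain ⟨s', hs', hlt⟩ := exists_lt_of_csInf_lt ⟨0, h0S⟩ hs
    exact (hs' : p ≤ _).trans (monotone_cdf ν hlt.le)
  · have hU : Set.Iio (sInf S) = ⋃ n : ℕ, Set.Iic (sInf S - 1 / ((n : ℝ) + 1)) := by
      ext s
      simp only [Set.mem_Iio, Set.mem_iUnion, Set.mem_Iic]
      constructor
      · intro hs
        obtain ⟨n, hn⟩ := exists_nat_one_div_lt (sub_pos.2 hs)
        exact ⟨n, by linarith⟩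
      · rintro ⟨n, hn⟩
        have : (0 : ℝ) < 1 / ((n : ℝ) + 1) := by positivity
        linarith
    have hmono : Monotone fun n : ℕ => Set.Iic (sInf S - 1 / ((n : ℝ) + 1)) := by
      intro a b hab
      refine Set.Iic_subset_Iic.2 (sub_le_sub_left ?_ _)
      gcongr
    rw [measureReal_def, hU, hmono.measure_iUnion]
    refine ENNReal.toReal_le_of_le_ofReal hp.le (iSup_le fun n => ?_)
    have hn : sInf S - 1 / ((n : ℝ) + 1) ∉ S := by
      intro hmem
      have h1 := csInf_le hbdd hmem
      have : (0 : ℝ) < 1 / ((n : ℝ) + 1) := by positivity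
      linarith
    rw [hS, Set.mem_ofPred_eq, not_le, hcdf] at hn
    rw [← ofReal_measureReal]
    exact ENNReal.ofReal_le_ofReal hn.le

lemma tendsto_const_mul_exp_neg {κ : ℝ} (hκ : 0 < κ) (C : ℝ) :
    Tendsto (fun j : ℕ => C * Real.exp (-κ * j)) atTop (𝓝 0) := by
  have h : Tendsto (fun j : ℕ => κ * (j : ℝ)) atTop atTop :=
    tendsto_natCast_atTop_atTop.const_mul_atTop hκ
  simpa [neg_mul] using (Real.tendsto_exp_neg_atTop_nhds_zero.comp h).const_mul C

/-- Lower bound for the tail of the `t`-statistic, with the same exponential rate, by a change of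
measure to the normal law that minimizes the relative entropy. -/
lemma exists_le_measureReal_vecT {h x ε : ℝ} (hx : 0 ≤ x) (hxh : x < h) (hε : 0 < ε) :
    ∃ δ > 0, ∀ᶠ j : ℕ in atTop,
      1 / 2 * Real.exp (-(infoM h + ε) * j) ≤ (stdGauss j).real {y | vecT y (-δ) ≤ -x} := by
  have hh : 0 < h := hx.trans_lt hxh
  -- Among the `N(m, τ²)` with `m = -h * τ`, the relative entropy with respect to `N(0, 1)` is least
  -- for this `τ`, and equals `infoM h`.
  set τ : ℝ := (Real.sqrt (1 + h ^ 2))⁻¹ with hτ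
  have hτ0 : 0 < τ := by positivity
  have hτ2 : τ ^ 2 * (1 + h ^ 2) = 1 := by
    rw [hτ, inv_pow, Real.sq_sqrt (by positivity)]; field_simp
  have hτ1 : τ ^ 2 ≤ 1 := by nlinarith [mul_nonneg (sq_nonneg τ) (sq_nonneg h)]
  have hlog : -Real.log τ = infoM h := by
    rw [hτ, Real.log_inv, Real.log_sqrt (by positivity), infoM]; ring
  set η : ℝ := min (min (ε / (1 + h)) ((h - x) / (2 * (1 + x)))) (1 / 2) with hη
  have hη0 : 0 < η := by
    have h1 : 0 < ε / (1 + h) := by positivity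
    have h2 : 0 < (h - x) / (2 * (1 + x)) := div_pos (by linarith) (by linarith)
    rw [hη]; positivity
  have hη1 : η * (1 + h) ≤ ε := by
    rw [← le_div_iff₀ (by linarith)]; exact (min_le_left _ _).trans (min_le_left _ _)
  have hη2 : η * (2 * (1 + x)) ≤ h - x := by
    rw [← le_div_iff₀ (by linarith)]; exact (min_le_left _ _).trans (min_le_right _ _)
  have hη3 : η ≤ 1 / 2 := min_le_right _ _
  obtain ⟨κ₁, hκ₁, C₁, -, b₁⟩ := exists_measureReal_le_vecSd (θ := 1 + η) (by linarith)
  obtain ⟨κ₂, hκ₂, C₂, -, b₂⟩ :=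
    exists_measureReal_vecSd_le (θ := 1 / 2) (by norm_num) (by norm_num)
  obtain ⟨κ₃, hκ₃, b₃⟩ := exists_measureReal_sum_sq_le (q := 1 - η) (by linarith) (by linarith)
  refine ⟨τ * (h - x) / 2, div_pos (mul_pos hτ0 (by linarith)) two_pos, ?_⟩
  have hsmall : ∀ᶠ j : ℕ in atTop, 2 * Real.exp (-(η ^ 2 / 2) * j) + (C₁ * Real.exp (-κ₁ * j) +
      (C₂ * Real.exp (-κ₂ * j) + 1 * Real.exp (-κ₃ * j))) ≤ 1 / 2 := by
    have := (tendsto_const_mul_exp_neg (κ := η ^ 2 / 2) (by positivity) 2).add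
      ((tendsto_const_mul_exp_neg hκ₁ C₁).add
      ((tendsto_const_mul_exp_neg hκ₂ C₂).add (tendsto_const_mul_exp_neg hκ₃ 1)))
    simp only [add_zero] at this
    exact this.eventually_le_const (by norm_num)
  filter_upwards [hsmall, eventually_ge_atTop 1] with j hj hj1
  set A : Set (Fin j → ℝ) := {y | vecT y (-(τ * (h - x) / 2)) ≤ -x} with hA
  set f : (Fin j → ℝ) → ℝ := fun y => ∏ i, gaussianRatio (-(h * τ)) (τ ^ 2) (y i) with hf
  set B : Set (Fin j → ℝ) := {y | f y ≤ Real.exp ((infoM h + ε) * j)} with hB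
  have hAm : MeasurableSet A := measurableSet_le (by fun_prop) (by fun_prop)
  have hfm : Measurable f := by
    refine Finset.measurable_prod _ fun i _ => ?_
    exact (measurable_gaussianRatio _ _).comp (measurable_pi_apply i)
  have hBm : MeasurableSet B := measurableSet_le hfm (by fun_prop)
  set T : (Fin j → ℝ) → (Fin j → ℝ) := fun z i => -(h * τ) + τ * z i with hT
  have hTm : Measurable T := by fun_prop
  -- Outside `G`, the transformed sample is in `A ∩ B`; `B` bounds the density.
  set G : Set (Fin j → ℝ) := {z | η ≤ |vecMean z|} ∪ ({z | 1 + η ≤ vecSd z} ∪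
    ({z | vecSd z ≤ 1 / 2} ∪ {z | ∑ i, z i ^ 2 ≤ (1 - η) * j})) with hG
  have hGle : (stdGauss j).real G ≤ 1 / 2 := by
    refine le_trans ?_ hj
    refine (measureReal_union_le _ _).trans (add_le_add (measureReal_le_abs_vecMean hη0.le) ?_)
    refine (measureReal_union_le _ _).trans (add_le_add (b₁ j) ?_)
    refine (measureReal_union_le _ _).trans (add_le_add (b₂ j) ?_)
    rw [one_mul]; exact b₃ j
  have hsub : Gᶜ ⊆ T ⁻¹' (A ∩ B) := by
    intro z hz
    simp only [hG, Set.mem_compl_iff, Set.mem_union, Set.mem_ofPred_eq, not_or, not_le] at hz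
    obtain ⟨z1, z2, z3, z4⟩ := hz
    obtain ⟨z1l, z1r⟩ := abs_lt.1 z1
    have hj0 : (0 : ℝ) < j := by exact_mod_cast hj1
    refine ⟨?_, ?_⟩
    · change vecT (fun i => -(h * τ) + τ * z i) _ ≤ -x
      rw [vecT_affine _ hτ0]
      unfold vecT
      rw [div_le_iff₀ (by linarith)]
      have e : (-(τ * (h - x) / 2) - -(h * τ)) / τ = (h + x) / 2 := by field_simp; ring
      rw [e]
      nlinarith
    · change f _ ≤ _
      rw [hf]
      simp only []
      rw [gaussianRatio_prod_eq _ hτ0]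
      refine Real.exp_le_exp.2 ?_
      have e : ∀ i, -Real.log τ + T z i ^ 2 / 2 - (T z i - -(h * τ)) ^ 2 / (2 * τ ^ 2) =
          infoM h + (h * τ) ^ 2 / 2 - h * τ ^ 2 * z i - (1 - τ ^ 2) / 2 * z i ^ 2 := by
        intro i
        rw [hlog, hT]
        field_simp
        ring
      simp only [e, Finset.sum_sub_distrib, Finset.sum_const, Finset.card_univ, Fintype.card_fin,
        nsmul_eq_mul, ← Finset.mul_sum]
      rw [sum_eq_mul_vecMean z]
      have h1 : (h * τ) ^ 2 = 1 - τ ^ 2 := by linarith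
      rw [h1]
      have h2 : (1 - τ ^ 2) / 2 * ((1 - η) * j) ≤ (1 - τ ^ 2) / 2 * ∑ i, z i ^ 2 := by
        gcongr
      have h3 : -(h * τ ^ 2 * (j * vecMean z)) ≤ h * j * η := by
        have : τ ^ 2 * -(vecMean z) ≤ 1 * η := by
          by_cases hm : 0 ≤ -vecMean z
          · gcongr; linarith
          · nlinarith [sq_nonneg τ]
        nlinarith [mul_le_mul_of_nonneg_left this (show 0 ≤ h * j by positivity)]
      have h4 : (1 - τ ^ 2) / 2 * (η * j) ≤ η * j := by
        have : 0 ≤ η * j := by positivity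
        nlinarith [sq_nonneg τ]
      have h5 : η * (1 + h) * j ≤ ε * j := by gcongr
      have h6 : (1 - τ ^ 2) / 2 * ((1 - η) * j) =
        j * ((1 - τ ^ 2) / 2) - (1 - τ ^ 2) / 2 * (η * j) := by ring
      have h7 : η * (1 + h) * j = η * j + h * j * η := by ring
      rw [add_mul, mul_add]
      linarith
  have hQ : ((stdGauss j).map T) (A ∩ B) ≤
      ENNReal.ofReal (Real.exp ((infoM h + ε) * j)) * (stdGauss j) A := by
    rw [hT, map_affine_stdGauss _ hτ0, withDensity_apply _ (hAm.inter hBm)]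
    calc _ ≤ ∫⁻ _ in A ∩ B, ENNReal.ofReal (Real.exp ((infoM h + ε) * j)) ∂(stdGauss j) :=
          setLIntegral_mono (by fun_prop) fun y hy => ENNReal.ofReal_le_ofReal hy.2
      _ ≤ _ := by
          rw [setLIntegral_const]
          gcongr
          exact Set.inter_subset_left
  have hQ' : (1 : ℝ) / 2 ≤ (stdGauss j).real (T ⁻¹' (A ∩ B)) := by
    have h1 := measureReal_union_le (μ := stdGauss j) G Gᶜ
    rw [Set.union_compl_self, probReal_univ] at h1
    have h2 : (stdGauss j).real Gᶜ ≤ _ := measureReal_mono hsub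
    linarith
  rw [Measure.map_apply hTm (hAm.inter hBm)] at hQ
  have h6 := ENNReal.toReal_mono (by finiteness) hQ
  rw [ENNReal.toReal_mul, ENNReal.toReal_ofReal (Real.exp_pos _).le] at h6
  have h7 : (1 : ℝ) / 2 ≤ Real.exp ((infoM h + ε) * j) * (stdGauss j).real A := hQ'.trans h6
  calc 1 / 2 * Real.exp (-(infoM h + ε) * j)
      ≤ (Real.exp ((infoM h + ε) * j) * (stdGauss j).real A) *
        Real.exp (-(infoM h + ε) * j) := by gcongr
    _ = (stdGauss j).real A * (Real.exp ((infoM h + ε) * j) *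
        Real.exp (-(infoM h + ε) * j)) := by ring
    _ = (stdGauss j).real A := by
      rw [← Real.exp_add, neg_mul, add_neg_cancel, Real.exp_zero, mul_one]

end

noncomputable section

section PathLemmas

open scoped Classical

/-! ### Sample paths of the procedure -/

lemma blockSd_nonneg (x : ℕ → ℝ) (s m : ℕ) : 0 ≤ blockSd x s m := Real.sqrt_nonneg _

lemma tStat_anti (x : ℕ → ℝ) (s m : ℕ) {a b : ℝ} (h : a ≤ b) : tStat x s m b ≤ tStat x s m a :=
  div_le_div_of_nonneg_right (by linarith) (blockSd_nonneg x s m)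

variable {K : ℕ}

/-- The leader of round `r ≥ 2`. -/
def leaderAt (c : ℕ → ℝ) (y : Fin K → ℕ → ℝ) (pick : ℕ → Finset (Fin K) → Fin K) (r : ℕ) :
    Fin K :=
  leader y (pick r) (state c y pick r).count (state c y pick r).prev

lemma mostSampled_nonempty [Nonempty (Fin K)] (n : Fin K → ℕ) : (mostSampled n).Nonempty := by
  obtain ⟨k, -, hk⟩ := Finset.exists_max_image Finset.univ n Finset.univ_nonempty
  exact ⟨k, by simpa [mostSampled] using hk⟩

lemma candidates_nonempty [Nonempty (Fin K)] (y : Fin K → ℕ → ℝ) (n : Fin K → ℕ) :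
    (candidates y n).Nonempty := by
  obtain ⟨k, hk, hk'⟩ := Finset.exists_max_image (mostSampled n)
    (fun k => blockMean (y k) 0 (n k)) (mostSampled_nonempty n)
  exact ⟨k, Finset.mem_filter.2 ⟨hk, hk'⟩⟩

lemma leader_mem_candidates [Nonempty (Fin K)] (y : Fin K → ℕ → ℝ)
    {p : Finset (Fin K) → Fin K} (hp : ∀ S : Finset (Fin K), S.Nonempty → p S ∈ S)
    (n : Fin K → ℕ) (prev : Option (Fin K)) : leader y p n prev ∈ candidates y n := by
  unfold leader
  split
  · exact hp _ (candidates_nonempty y n)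
  · split_ifs with h
    · exact h
    · exact hp _ (candidates_nonempty y n)

lemma mem_winners {c : ℕ → ℝ} {y : Fin K → ℕ → ℝ} {n : Fin K → ℕ} {z k : Fin K} :
    k ∈ winners c y n z ↔ WinsChallenge c y n z k := by
  simp only [winners, Finset.mem_filter, Finset.mem_univ, true_and, and_iff_right_iff_imp]
  rintro ⟨h, -⟩ rfl
  exact lt_irrefl _ h

lemma sampled_nonempty (c : ℕ → ℝ) (y : Fin K → ℕ → ℝ) (n : Fin K → ℕ) (z : Fin K) :
    (sampled c y n z).Nonempty := by
  unfold sampled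
  split_ifs with h
  · exact Finset.singleton_nonempty z
  · exact Finset.nonempty_iff_ne_empty.2 h

variable {c : ℕ → ℝ} {y : Fin K → ℕ → ℝ} {pick : ℕ → Finset (Fin K) → Fin K}

lemma recommended_eq {r : ℕ} (hr : 2 ≤ r) :
    recommended c y pick r = sampled c y (count c y pick r) (leaderAt c y pick r) := by
  rw [recommended, if_neg (by omega)]; rfl

lemma count_succ {r : ℕ} (hr : 1 ≤ r) (k : Fin K) :
    count c y pick (r + 1) k =
      count c y pick r k + if k ∈ recommended c y pick r then 1 else 0 := by
  rcases Nat.lt_or_ge r 2 with h | h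
  · obtain rfl : r = 1 := by omega
    simp [count, state, recommended]
  · obtain ⟨q, rfl⟩ : ∃ q, r = q + 2 := ⟨r - 2, by omega⟩
    have h1 : recommended c y pick (q + 2) =
        sampledAt c y (pick (q + 2)) (state c y pick (q + 2)) := if_neg (by omega)
    rw [h1]
    rfl

lemma state_prev_succ {r : ℕ} (hr : 2 ≤ r) :
    (state c y pick (r + 1)).prev = some (leaderAt c y pick r) := by
  obtain ⟨q, rfl⟩ : ∃ q, r = q + 2 := ⟨r - 2, by omega⟩
  rfl

lemma count_le_succ (r : ℕ) (k : Fin K) : count c y pick r k ≤ count c y pick (r + 1) k := by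
  rcases Nat.eq_zero_or_pos r with rfl | h
  · rfl
  · rw [count_succ h]; omega

lemma count_mono (k : Fin K) : Monotone fun r => count c y pick r k :=
  monotone_nat_of_le_succ fun r => count_le_succ r k

lemma count_le (r : ℕ) (k : Fin K) : count c y pick r k ≤ r - 1 := by
  induction r with
  | zero => rfl
  | succ r ih =>
    rcases Nat.eq_zero_or_pos r with rfl | h
    · rfl
    · rw [count_succ h]; split_ifs <;> omega

lemma recommended_nonempty [Nonempty (Fin K)] (r : ℕ) : (recommended c y pick r).Nonempty := by
  rcases Nat.lt_or_ge r 2 with h | h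
  · rw [recommended, if_pos (by omega)]; exact Finset.univ_nonempty
  · rw [recommended_eq h]; exact sampled_nonempty _ _ _ _

lemma le_total [Nonempty (Fin K)] (r : ℕ) : r - 1 ≤ total c y pick r := by
  induction r with
  | zero => simp
  | succ r ih =>
    rcases Nat.eq_zero_or_pos r with rfl | h
    · simp
    · have h1 : total c y pick (r + 1) = total c y pick r + (recommended c y pick r).card := by
        unfold total
        simp only [count_succ h, Finset.sum_add_distrib]
        simp
      have h2 := (recommended_nonempty (c := c) (y := y) (pick := pick) r).card_pos
      omega

lemma total_le (r : ℕ) : total c y pick r ≤ K * (r - 1) := by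
  unfold total
  calc ∑ k, count c y pick r k ≤ ∑ _k : Fin K, (r - 1) := Finset.sum_le_sum fun k _ => count_le r k
    _ = K * (r - 1) := by simp

lemma mem_recommended_of_wins {r : ℕ} (hr : 2 ≤ r) {k : Fin K}
    (h : WinsChallenge c y (count c y pick r) (leaderAt c y pick r) k) :
    k ∈ recommended c y pick r := by
  rw [recommended_eq hr, sampled, if_neg]
  · exact mem_winners.2 h
  · exact Finset.nonempty_iff_ne_empty.1 ⟨k, mem_winners.2 h⟩

/-- A sampled arm is the leader, or has won its challenge. -/
lemma eq_leader_or_wins {r : ℕ} (hr : 2 ≤ r) {k : Fin K} (hk : k ∈ recommended c y pick r) :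
    k = leaderAt c y pick r ∨
      WinsChallenge c y (count c y pick r) (leaderAt c y pick r) k := by
  rw [recommended_eq hr, sampled] at hk
  split_ifs at hk with h
  · exact Or.inl (Finset.mem_singleton.1 hk)
  · exact Or.inr (mem_winners.1 hk)

/-- Each win of an inferior arm `k` against an optimal leader happens at a different number of
observations from `k`. Hence `n_k^r` is at most `m` plus the number of rounds with an inferior
leader plus the number of `j ≥ m` at which `k` may win against an optimal leader. -/
lemma count_le_add {μ : Fin K → ℝ} {k l : Fin K} (hk : μ k < μ l) {m R : ℕ} (hm : 1 ≤ m)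
    (W : ℕ → Prop) (hcm : Monotone c) (hcR : c (K * R) ≤ m)
    (hW : ∀ z, μ z = μ l → ∀ j n, m ≤ j → j < n → n ≤ R →
      (blockMean (y z) 0 n ≤ blockMean (y k) 0 j ∨ ∃ s, s + j ≤ n ∧
        tStat (y z) s j (blockMean (y z) 0 n) ≤ tStat (y k) 0 j (blockMean (y z) 0 n)) → W j) :
    ∀ r, r ≤ R → count c y pick r k ≤ m +
      (Finset.range r).sum (fun s => if μ (leaderAt c y pick s) = μ l then 0 else 1) +
      (Finset.range (count c y pick r k)).sum (fun j => if m ≤ j ∧ W j then 1 else 0) := by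
  intro r
  induction r with
  | zero => intro _; simp [count, state]
  | succ r ih =>
    intro hr
    have ih := ih (by omega)
    rcases Nat.lt_or_ge r 2 with h2 | h2
    · have h3 := count_le (c := c) (y := y) (pick := pick) (r + 1) k
      have : count c y pick (r + 1) k ≤ m := by omega
      omega
    rw [count_succ (by omega)]
    split_ifs with hrec
    swap
    · rw [add_zero, Finset.sum_range_succ _ r]; omega
    rw [Finset.sum_range_succ _ r, Finset.sum_range_succ _ (count c y pick r k)]
    by_cases hlead : μ (leaderAt c y pick r) = μ l
    swap
    · rw [if_neg hlead]; omega
    rcases Nat.lt_or_ge (count c y pick r k) m with hkm | hkm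
    · omega
    · have hwin : W (count c y pick r k) := by
        rcases eq_leader_or_wins h2 hrec with h | ⟨hlt, h⟩
        · rw [← h] at hlead; exact absurd hlead hk.ne
        refine hW _ hlead _ _ hkm hlt ((count_le r _).trans (by omega)) ?_
        refine h.resolve_left (not_lt.2 ?_)
        calc c (∑ j, count c y pick r j) ≤ c (K * R) := by
              refine hcm ((total_le r).trans (Nat.mul_le_mul_left K (by omega)))
          _ ≤ m := hcR
          _ ≤ _ := by exact_mod_cast hkm
      rw [if_pos (show m ≤ count c y pick r k ∧ W _ from ⟨hkm, hwin⟩)]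
      omega

variable [Nonempty (Fin K)]

lemma leaderAt_mem (hp : ∀ r (S : Finset (Fin K)), S.Nonempty → pick r S ∈ S) (r : ℕ) :
    leaderAt c y pick r ∈ candidates y (count c y pick r) :=
  leader_mem_candidates y (hp r) _ _

lemma count_le_leader (hp : ∀ r (S : Finset (Fin K)), S.Nonempty → pick r S ∈ S) (r : ℕ)
    (k : Fin K) : count c y pick r k ≤ count c y pick r (leaderAt c y pick r) := by
  have h := Finset.mem_filter.1 (Finset.mem_filter.1 (leaderAt_mem (c := c) (y := y) hp r)).1
  exact h.2 k

/-- An arm with as many observations as the leader has no larger sample mean. -/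
lemma blockMean_le_leader (hp : ∀ r (S : Finset (Fin K)), S.Nonempty → pick r S ∈ S) {r : ℕ}
    {k : Fin K} (hk : count c y pick r k = count c y pick r (leaderAt c y pick r)) :
    blockMean (y k) 0 (count c y pick r k) ≤
      blockMean (y (leaderAt c y pick r)) 0 (count c y pick r (leaderAt c y pick r)) := by
  refine (Finset.mem_filter.1 (leaderAt_mem (c := c) (y := y) hp r)).2 k ?_
  refine Finset.mem_filter.2 ⟨Finset.mem_univ _, fun j => ?_⟩
  rw [hk]; exact count_le_leader hp r j

lemma le_count_leader (hp : ∀ r (S : Finset (Fin K)), S.Nonempty → pick r S ∈ S) {r u : ℕ}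
    (hu : K * u + 1 ≤ r) : u ≤ count c y pick r (leaderAt c y pick r) := by
  have h1 : total c y pick r ≤ K * count c y pick r (leaderAt c y pick r) := by
    calc total c y pick r ≤ ∑ _k : Fin K, count c y pick r (leaderAt c y pick r) :=
          Finset.sum_le_sum fun k _ => count_le_leader hp r k
      _ = _ := by simp
  have h2 := le_total (c := c) (y := y) (pick := pick) r
  have hK : 0 < K := Fin.pos_iff_nonempty.2 ‹_›
  exact Nat.le_of_mul_le_mul_left (by omega) hK

/-- If some challenger wins, then the number of observations of the leader does not change, and
no other arm gets ahead of it. -/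
lemma count_succ_le_of_wins (hp : ∀ r (S : Finset (Fin K)), S.Nonempty → pick r S ∈ S) {r : ℕ}
    (hr : 2 ≤ r) {k : Fin K}
    (h : WinsChallenge c y (count c y pick r) (leaderAt c y pick r) k) (j : Fin K) :
    count c y pick (r + 1) j ≤ count c y pick r (leaderAt c y pick r) := by
  have h1 : j ∈ recommended c y pick r →
      WinsChallenge c y (count c y pick r) (leaderAt c y pick r) j := by
    intro hj
    rw [recommended_eq hr, sampled, if_neg] at hj
    · exact mem_winners.1 hj
    · exact Finset.nonempty_iff_ne_empty.1 ⟨k, mem_winners.2 h⟩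
  rw [count_succ (by omega)]
  split_ifs with hj
  · exact (h1 hj).1
  · exact count_le_leader hp r j

/-- The leader changes only at a tie, and then to an arm with a strictly larger sample mean. -/
lemma leader_change (hp : ∀ r (S : Finset (Fin K)), S.Nonempty → pick r S ∈ S) {r : ℕ}
    (hr : 2 ≤ r) (hne : leaderAt c y pick (r + 1) ≠ leaderAt c y pick r) :
    count c y pick (r + 1) (leaderAt c y pick (r + 1)) =
        count c y pick (r + 1) (leaderAt c y pick r) ∧
      blockMean (y (leaderAt c y pick r)) 0 (count c y pick (r + 1) (leaderAt c y pick r)) <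
        blockMean (y (leaderAt c y pick (r + 1))) 0
          (count c y pick (r + 1) (leaderAt c y pick (r + 1))) := by
  set z := leaderAt c y pick r with hz
  set z' := leaderAt c y pick (r + 1) with hz'
  have hmax := count_le_leader (c := c) (y := y) hp (r + 1)
  rw [← hz'] at hmax
  have hwin : ∃ k, WinsChallenge c y (count c y pick r) z k := by
    by_contra! hno
    have hw : winners c y (count c y pick r) z = ∅ := by
      ext k; simpa [mem_winners] using hno k
    have hrec : recommended c y pick r = {z} := by
      rw [recommended_eq hr, sampled, ← hz, if_pos hw]
    have h1 := hmax z
    rw [count_succ (by omega), count_succ (by omega), hrec, if_pos (Finset.mem_singleton_self z),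
      if_neg (by simpa using hne)] at h1
    have h2 : count c y pick r z' ≤ count c y pick r z := count_le_leader hp r z'
    omega
  obtain ⟨k, hk⟩ := hwin
  have htop := count_succ_le_of_wins hp hr hk
  have hle : ∀ j, count c y pick (r + 1) j ≤ count c y pick (r + 1) z := fun j =>
    (htop j).trans (count_le_succ r z)
  have htie : count c y pick (r + 1) z' = count c y pick (r + 1) z := (hle z').antisymm (hmax z)
  refine ⟨htie, ?_⟩
  have hzm : z ∈ mostSampled (count c y pick (r + 1)) :=
    Finset.mem_filter.2 ⟨Finset.mem_univ _, hle⟩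
  have hz'c : z' ∈ candidates y (count c y pick (r + 1)) := leaderAt_mem hp (r + 1)
  refine lt_of_le_of_ne ((Finset.mem_filter.1 hz'c).2 z hzm) fun heq => hne ?_
  have hzc : z ∈ candidates y (count c y pick (r + 1)) := by
    refine Finset.mem_filter.2 ⟨hzm, fun j hj => ?_⟩
    rw [heq]
    exact (Finset.mem_filter.1 hz'c).2 j hj
  change leader y _ _ _ = z
  rw [state_prev_succ hr]
  exact if_pos hzc

variable {μ : Fin K → ℝ} {δ : ℝ} {u₀ r₀ R : ℕ}

/-- While the leaders have at least `u₀` observations and all sample means of at least `u₀`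
observations are accurate, an optimal leader is succeeded by an optimal leader. -/
lemma leader_optimal_succ (hp : ∀ r (S : Finset (Fin K)), S.Nonempty → pick r S ∈ S)
    (hsep : ∀ i j, μ i < μ j → μ i + 2 * δ < μ j)
    (hmean : ∀ k u, u₀ ≤ u → u ≤ R → |blockMean (y k) 0 u - μ k| ≤ δ)
    {r : ℕ} (hr : 2 ≤ r) (hrR : r < R) (hu : u₀ ≤ count c y pick r (leaderAt c y pick r))
    (hopt : ∀ k, μ k ≤ μ (leaderAt c y pick r)) (k : Fin K) :
    μ k ≤ μ (leaderAt c y pick (r + 1)) := by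
  by_cases hne : leaderAt c y pick (r + 1) = leaderAt c y pick r
  · rw [hne]; exact hopt k
  obtain ⟨htie, hlt⟩ := leader_change hp hr hne
  by_contra! hcon
  have h1 := hsep _ _ (hcon.trans_le (hopt k))
  have hb : ∀ j, count c y pick (r + 1) j ≤ R := fun j =>
    (count_le (r + 1) j).trans (by omega)
  have hu' := hu.trans (count_le_succ r (leaderAt c y pick r))
  have h2 := abs_le.1 (hmean (leaderAt c y pick r) _ hu' (hb _))
  have h3 := abs_le.1 (hmean (leaderAt c y pick (r + 1)) _ (htie ▸ hu') (hb _))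
  linarith [h2.1, h3.2]

/-- An optimal arm wins its challenges against inferior leaders. -/
lemma optimal_wins (hp : ∀ r (S : Finset (Fin K)), S.Nonempty → pick r S ∈ S)
    (hcm : Monotone c) (hsep : ∀ i j, μ i < μ j → μ i + 2 * δ < μ j)
    (hmean : ∀ k u, u₀ ≤ u → u ≤ R → |blockMean (y k) 0 u - μ k| ≤ δ) {l : Fin K}
    (hblock : ∀ z, μ z < μ l → ∀ j < u₀, c (r₀ - 1) ≤ j → μ z + δ ≤ blockMean (y l) 0 j ∨
      ∃ s, s + j ≤ u₀ ∧ tStat (y z) s j (μ z - δ) ≤ tStat (y l) 0 j (μ z + δ))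
    {r : ℕ} (hr₀ : r₀ ≤ r) (hrR : r ≤ R) (hu : u₀ ≤ count c y pick r (leaderAt c y pick r))
    (hz : μ (leaderAt c y pick r) < μ l) :
    WinsChallenge c y (count c y pick r) (leaderAt c y pick r) l := by
  set z := leaderAt c y pick r with hzdef
  have hle := count_le_leader (c := c) (y := y) hp r l
  have hsep' := hsep _ _ hz
  have hb : ∀ j, count c y pick r j ≤ R := fun j => (count_le r j).trans (by omega)
  have hmz := abs_le.1 (hmean z _ hu (hb z))
  have hlt : count c y pick r l < count c y pick r z := by
    refine lt_of_le_of_ne hle fun heq => ?_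
    have h1 := blockMean_le_leader (c := c) (y := y) hp heq
    have h2 := abs_le.1 (hmean l _ (heq ▸ hu) (hb l))
    linarith [h2.1, hmz.2]
  refine ⟨hlt, ?_⟩
  by_cases hc1 : ((count c y pick r l : ℕ) : ℝ) < c (∑ j, count c y pick r j)
  · exact Or.inl hc1
  refine Or.inr ?_
  have hc2 : c (r₀ - 1) ≤ (count c y pick r l : ℕ) := by
    refine le_trans (hcm ?_) (not_lt.1 hc1)
    have := le_total (c := c) (y := y) (pick := pick) r
    unfold total at this
    omega
  by_cases hlu : u₀ ≤ count c y pick r l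
  · have h2 := abs_le.1 (hmean l _ hlu (hb l))
    left; linarith [h2.1, hmz.2]
  rcases hblock z hz _ (not_le.1 hlu) hc2 with h | ⟨s, hs, h⟩
  · left; linarith [hmz.2]
  · right
    refine ⟨s, hs.trans hu, ?_⟩
    calc _ ≤ _ := tStat_anti (y z) s _ (by linarith [hmz.1] : μ z - δ ≤ _)
      _ ≤ _ := h
      _ ≤ _ := tStat_anti (y l) 0 _ (by linarith [hmz.2])

/-- If all long sample means are accurate, and if an optimal arm `l` wins its challenges against
inferior leaders in the rounds from `r₀` to `R`, then the leader of round `R > 2 * r₀` is optimal: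
otherwise all leaders from round `r₀` on would be inferior, and `l` would have overtaken them. -/
lemma leader_optimal (hp : ∀ r (S : Finset (Fin K)), S.Nonempty → pick r S ∈ S)
    (hcm : Monotone c) (hsep : ∀ i j, μ i < μ j → μ i + 2 * δ < μ j) (hr₀ : 2 ≤ r₀)
    (hu₀ : K * u₀ + 1 ≤ r₀) (hR : 2 * r₀ < R)
    (hmean : ∀ k u, u₀ ≤ u → u ≤ R → |blockMean (y k) 0 u - μ k| ≤ δ) {l : Fin K}
    (hl : ∀ k, μ k ≤ μ l)
    (hblock : ∀ z, μ z < μ l → ∀ j < u₀, c (r₀ - 1) ≤ j → μ z + δ ≤ blockMean (y l) 0 j ∨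
      ∃ s, s + j ≤ u₀ ∧ tStat (y z) s j (μ z - δ) ≤ tStat (y l) 0 j (μ z + δ)) :
    μ (leaderAt c y pick R) = μ l := by
  by_contra hcon
  have hu : ∀ r, r₀ ≤ r → u₀ ≤ count c y pick r (leaderAt c y pick r) := fun r hr =>
    le_count_leader hp (hu₀.trans hr)
  have hbad : ∀ i, i ≤ R - r₀ → μ (leaderAt c y pick (R - i)) < μ l := by
    intro i
    induction i with
    | zero => intro _; exact lt_of_le_of_ne (hl _) hcon
    | succ i ih =>
      intro hi
      by_contra! h
      have h1 := leader_optimal_succ (c := c) (y := y) (r := R - (i + 1)) hp hsep hmean (by omega)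
        (by omega) (hu _ (by omega)) (fun k => (hl k).trans h) l
      rw [show R - (i + 1) + 1 = R - i by omega] at h1
      exact absurd (ih (by omega)) (not_lt.2 h1)
  have hw : ∀ r, r₀ ≤ r → r ≤ R →
      WinsChallenge c y (count c y pick r) (leaderAt c y pick r) l := by
    intro r h1 h2
    refine optimal_wins hp hcm hsep hmean hblock h1 h2 (hu r h1) ?_
    have := hbad (R - r) (by omega)
    rwa [show R - (R - r) = r by omega] at this
  have hind : ∀ i, r₀ + i ≤ R → i ≤ count c y pick (r₀ + i) l ∧
      ∀ j, count c y pick (r₀ + i) j ≤ r₀ := by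
    intro i
    induction i with
    | zero => intro _; exact ⟨Nat.zero_le _, fun j => (count_le r₀ j).trans (by omega)⟩
    | succ i ih =>
      intro hi
      obtain ⟨h1, h2⟩ := ih (by omega)
      have hwi := hw (r₀ + i) (by omega) (by omega)
      refine ⟨?_, fun j => ?_⟩
      · rw [← add_assoc, count_succ (by omega),
          if_pos (mem_recommended_of_wins (by omega) hwi)]
        omega
      · exact (count_succ_le_of_wins hp (by omega) hwi j).trans (h2 _)
  obtain ⟨h1, h2⟩ := hind (R - r₀) (by omega)
  have h3 := h2 l
  omega

/-- If arm `k` wins all challenges with fewer than `m` observations from round `r₀` on, then it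
has at least `m` observations after `m` further rounds. -/
lemma le_count_of_blocks (hp : ∀ r (S : Finset (Fin K)), S.Nonempty → pick r S ∈ S)
    (hcm : Monotone c) (hr₀ : 2 ≤ r₀) (hu₀ : K * u₀ + 1 ≤ r₀) {m : ℕ} (hm : m ≤ u₀)
    (hmean : ∀ k u, u₀ ≤ u → u ≤ r₀ + m → |blockMean (y k) 0 u - μ k| ≤ δ) {k : Fin K}
    (hblock : ∀ z, z ≠ k → ∀ j < m, c (r₀ - 1) ≤ j →
      ∃ s, s + j ≤ u₀ ∧ tStat (y z) s j (μ z - δ) ≤ tStat (y k) 0 j (μ z + δ)) :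
    m ≤ count c y pick (r₀ + m) k := by
  have hind : ∀ i, i ≤ m → i ≤ count c y pick (r₀ + i) k := by
    intro i
    induction i with
    | zero => intro _; exact Nat.zero_le _
    | succ i ih =>
      intro hi
      have h1 := ih (by omega)
      by_cases hkm : m ≤ count c y pick (r₀ + i) k
      · exact (hi.trans hkm).trans (count_le_succ _ k)
      rw [← add_assoc, count_succ (by omega), if_pos]
      · omega
      refine mem_recommended_of_wins (by omega) ?_
      set r := r₀ + i with hr
      set z := leaderAt c y pick r with hz
      have hu : u₀ ≤ count c y pick r z := le_count_leader hp (by omega)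
      have hmz := abs_le.1 (hmean z _ hu ((count_le r z).trans (by omega)))
      have hzk : z ≠ k := by
        intro h
        rw [h] at hu
        omega
      refine ⟨by omega, ?_⟩
      by_cases hc1 : ((count c y pick r k : ℕ) : ℝ) < c (∑ j, count c y pick r j)
      · exact Or.inl hc1
      right; right
      have hc2 : c (r₀ - 1) ≤ (count c y pick r k : ℕ) := by
        refine le_trans (hcm ?_) (not_lt.1 hc1)
        have := le_total (c := c) (y := y) (pick := pick) r
        unfold total at this
        omega
      obtain ⟨s, hs, h⟩ := hblock z hzk _ (not_le.1 hkm) hc2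
      refine ⟨s, hs.trans hu, ?_⟩
      calc _ ≤ _ := tStat_anti (y z) s _ (by linarith [hmz.1] : μ z - δ ≤ _)
        _ ≤ _ := h
        _ ≤ _ := tStat_anti (y k) 0 _ (by linarith [hmz.2])
  exact hind m le_rfl

end PathLemmas

end

noncomputable section

/-! ### Blocks of rewards -/

lemma blockMean_eq_vecMean (x : ℕ → ℝ) (s m : ℕ) :
    blockMean x s m = vecMean fun i : Fin m => x (s + i) := by
  unfold blockMean vecMean
  rw [Finset.sum_range]

lemma blockSd_eq_vecSd (x : ℕ → ℝ) (s m : ℕ) :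
    blockSd x s m = vecSd fun i : Fin m => x (s + i) := by
  unfold blockSd vecSd vecDev
  rw [Finset.sum_range, blockMean_eq_vecMean]

lemma tStat_eq_vecT (x : ℕ → ℝ) (s m : ℕ) (a : ℝ) :
    tStat x s m a = vecT (fun i : Fin m => x (s + i)) a := by
  unfold tStat vecT
  rw [blockMean_eq_vecMean, blockSd_eq_vecSd]

variable {Ω : Type*} [MeasurableSpace Ω] {P : Measure Ω}

/-- Consecutive blocks of independent variables are independent. -/
lemma measureReal_forall_blocks_le [IsProbabilityMeasure P] {X : ℕ → Ω → ℝ}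
    (hX : ∀ t, Measurable (X t)) (hind : iIndepFun X P) {j : ℕ} {A : Set (Fin j → ℝ)}
    (hA : MeasurableSet A) {q : ℝ}
    (hq : ∀ s, P.real {ω | (fun i : Fin j => X (s + i) ω) ∈ A} ≤ q) (B : ℕ) :
    P.real {ω | ∀ i < B, (fun r : Fin j => X (i * j + r) ω) ∈ A} ≤ q ^ B := by
  have hq0 : 0 ≤ q := measureReal_nonneg.trans (hq 0)
  induction B with
  | zero => simp
  | succ B ih =>
    set S := Finset.range (B * j) with hS
    set T := Finset.Ico (B * j) ((B + 1) * j) with hT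
    have hdisj : Disjoint S T := by
      rw [Finset.disjoint_left]
      intro a ha hb
      rw [hS, Finset.mem_range] at ha
      rw [hT, Finset.mem_Ico] at hb
      omega
    have hmS : ∀ (i : Fin B) (r : Fin j), (i : ℕ) * j + r ∈ S := by
      intro i r
      rw [hS, Finset.mem_range]
      calc (i : ℕ) * j + r < i * j + j := by omega
        _ = (i + 1) * j := by ring
        _ ≤ B * j := Nat.mul_le_mul_right j (by omega)
    have hmT : ∀ r : Fin j, B * j + r ∈ T := by
      intro r
      rw [hT, Finset.mem_Ico, add_mul, one_mul]
      omega
    have hindep := hind.indepFun_finset S T hdisj hX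
    set A₁ : Set (S → ℝ) :=
      {x | ∀ i : Fin B, (fun r : Fin j => x ⟨(i : ℕ) * j + r, hmS i r⟩) ∈ A} with hA₁
    set A₂ : Set (T → ℝ) := {x | (fun r : Fin j => x ⟨B * j + r, hmT r⟩) ∈ A} with hA₂
    have hA₁m : MeasurableSet A₁ := by
      have : A₁ = ⋂ i : Fin B,
          (fun (x : S → ℝ) (r : Fin j) => x ⟨(i : ℕ) * j + r, hmS i r⟩) ⁻¹' A := by
        ext x; simp [hA₁]
      rw [this]
      exact MeasurableSet.iInter fun i => (by fun_prop : Measurable _) hA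
    have hA₂m : MeasurableSet A₂ := (by fun_prop : Measurable
      fun (x : T → ℝ) (r : Fin j) => x ⟨B * j + r, hmT r⟩) hA
    have h1 := hindep.measure_inter_preimage_eq_mul A₁ A₂ hA₁m hA₂m
    have h2 : {ω | ∀ i < B + 1, (fun r : Fin j => X (i * j + r) ω) ∈ A} =
        ((fun a (i : S) => X i a) ⁻¹' A₁) ∩ ((fun a (i : T) => X i a) ⁻¹' A₂) := by
      ext ω
      constructor
      · intro h
        exact ⟨fun i => h i (by omega), h B (by omega)⟩
      · rintro ⟨h, h'⟩ i hi
        rcases Nat.lt_or_ge i B with hlt | hge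
        · exact h ⟨i, hlt⟩
        · obtain rfl : i = B := by omega
          exact h'
    have h3 : (fun a (i : S) => X i a) ⁻¹' A₁ =
        {ω | ∀ i < B, (fun r : Fin j => X (i * j + r) ω) ∈ A} := by
      ext ω
      exact ⟨fun h i hi => h ⟨i, hi⟩, fun h i => h i i.2⟩
    rw [h2, measureReal_def, h1, ENNReal.toReal_mul, pow_succ, h3]
    exact mul_le_mul ih (hq (B * j)) ENNReal.toReal_nonneg (by positivity)

variable {K : ℕ} {μ : Fin K → ℝ} {σ : Fin K → ℝ≥0} {Y : Fin K → ℕ → Ω → ℝ}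

/-- The rewards of the arms are independent, and those of arm `k` have the law `N(μ k, σ k ^ 2)`
with `σ k > 0`. -/
structure IsNormalRewards (P : Measure Ω) (μ : Fin K → ℝ) (σ : Fin K → ℝ≥0)
    (Y : Fin K → ℕ → Ω → ℝ) : Prop where
  pos : ∀ k, 0 < σ k
  meas : ∀ k t, Measurable (Y k t)
  law : ∀ k t, P.map (Y k t) = gaussianReal (μ k) (σ k ^ 2)
  indep : iIndepFun (fun p : Fin K × ℕ => Y p.1 p.2) P

namespace IsNormalRewards

lemma measurable_block (hY : IsNormalRewards P μ σ Y) (k : Fin K)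
    (s j : ℕ) : Measurable fun ω (i : Fin j) => Y k (s + i) ω :=
  measurable_pi_lambda _ fun _ => hY.meas _ _

lemma indep_arm (hY : IsNormalRewards P μ σ Y) (k : Fin K) : iIndepFun (Y k) P :=
  hY.indep.precomp (g := fun t : ℕ => (k, t)) fun _ _ h => (Prod.ext_iff.1 h).2

lemma map_block (hY : IsNormalRewards P μ σ Y) (k : Fin K) (s j : ℕ) :
    P.map (fun ω (i : Fin j) => Y k (s + i) ω) =
      (stdGauss j).map fun x i => μ k + σ k * x i := by
  have h1 : iIndepFun (fun (i : Fin j) ω => Y k (s + i) ω) P :=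
    hY.indep.precomp (g := fun i : Fin j => (k, s + i)) fun _ _ h => by
      have := (Prod.ext_iff.1 h).2
      simp only at this
      exact Fin.ext (by omega)
  rw [h1.map_fun_eq_pi_map fun i => (hY.meas _ _).aemeasurable,
    Measure.pi_map_pi (f := fun _ x => μ k + σ k * x) (fun i => by fun_prop)]
  congr 1
  ext1 i
  have e : (fun x : ℝ => μ k + σ k * x) = (μ k + ·) ∘ ((σ k : ℝ) * ·) := rfl
  rw [hY.law, e, ← Measure.map_map (by fun_prop) (by fun_prop), gaussianReal_map_const_mul,
    gaussianReal_map_const_add, mul_zero, zero_add, mul_one]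
  rfl

lemma measureReal_block (hY : IsNormalRewards P μ σ Y) (k : Fin K) (s : ℕ) {j : ℕ}
    {p : (Fin j → ℝ) → Prop} (hA : MeasurableSet {x | p x}) :
    P.real {ω | p fun i : Fin j => Y k (s + i) ω} =
      (stdGauss j).real {x | p fun i => μ k + σ k * x i} := by
  have h1 := Measure.map_apply (μ := P) (hY.measurable_block k s j) hA
  rw [hY.map_block, Measure.map_apply (by fun_prop) hA] at h1
  exact (congrArg ENNReal.toReal h1).symm

lemma measureReal_tStat_le (hY : IsNormalRewards P μ σ Y) (k : Fin K) (s j : ℕ) (a t : ℝ) :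
    P.real {ω | tStat (fun i => Y k i ω) s j a ≤ t} =
      (stdGauss j).real {x | vecT x ((a - μ k) / σ k) ≤ t} := by
  simp only [tStat_eq_vecT]
  refine (hY.measureReal_block k s (p := fun x => vecT x a ≤ t)
    (measurableSet_le (by fun_prop) (by fun_prop))).trans ?_
  simp only [vecT_affine (μ k) (NNReal.coe_pos.2 (hY.pos k))]

lemma measureReal_tStat_lt (hY : IsNormalRewards P μ σ Y) (k : Fin K) (s j : ℕ) (a t : ℝ) :
    P.real {ω | tStat (fun i => Y k i ω) s j a < t} =
      (stdGauss j).real {x | vecT x ((a - μ k) / σ k) < t} := by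
  simp only [tStat_eq_vecT]
  refine (hY.measureReal_block k s (p := fun x => vecT x a < t)
    (measurableSet_lt (by fun_prop) (by fun_prop))).trans ?_
  simp only [vecT_affine (μ k) (NNReal.coe_pos.2 (hY.pos k))]

lemma measureReal_blockMean (hY : IsNormalRewards P μ σ Y) (k : Fin K) {δ : ℝ} (hδ : 0 < δ)
    (s : ℕ) {j : ℕ} (hj : j ≠ 0) :
    P.real {ω | δ < |blockMean (fun i => Y k i ω) s j - μ k|} ≤
      2 * Real.exp (-((δ / σ k) ^ 2 / 2) * j) := by
  have hσ : (0 : ℝ) < σ k := NNReal.coe_pos.2 (hY.pos k)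
  simp only [blockMean_eq_vecMean]
  refine (hY.measureReal_block k s (p := fun x => δ < |vecMean x - μ k|)
    (measurableSet_lt (by fun_prop) (by fun_prop))).trans_le ?_
  refine le_trans (measureReal_mono fun x hx => ?_)
    (measureReal_le_abs_vecMean (j := j) (δ := δ / σ k) (by positivity))
  simp only [Set.mem_ofPred_eq, vecMean_affine hj, add_sub_cancel_left, abs_mul,
    abs_of_pos hσ] at hx ⊢
  rw [div_le_iff₀ hσ]
  linarith

lemma exists_measureReal_le_blockSd (hY : IsNormalRewards P μ σ Y) (k : Fin K) {θ : ℝ}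
    (hθ : σ k < θ) : ∃ κ > 0, ∃ C > 0, ∀ s j : ℕ,
      P.real {ω | θ ≤ blockSd (fun i => Y k i ω) s j} ≤ C * Real.exp (-κ * j) := by
  have hσ : (0 : ℝ) < σ k := NNReal.coe_pos.2 (hY.pos k)
  obtain ⟨κ, hκ, C, hC, h⟩ := exists_measureReal_le_vecSd (θ := θ / σ k) ((one_lt_div hσ).2 hθ)
  refine ⟨κ, hκ, C, hC, fun s j => ?_⟩
  simp only [blockSd_eq_vecSd]
  refine (hY.measureReal_block k s (p := fun x => θ ≤ vecSd x)
    (measurableSet_le (by fun_prop) (by fun_prop))).trans_le ?_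
  refine le_trans (measureReal_mono fun x hx => ?_) (h j)
  simp only [Set.mem_ofPred_eq, vecSd_affine (μ k) hσ.le] at hx ⊢
  rw [div_le_iff₀ hσ]
  linarith

lemma exists_measureReal_blockSd_le (hY : IsNormalRewards P μ σ Y) (k : Fin K) {θ : ℝ}
    (h0 : 0 ≤ θ) (hθ : θ < σ k) : ∃ κ > 0, ∃ C > 0, ∀ s j : ℕ,
      P.real {ω | blockSd (fun i => Y k i ω) s j ≤ θ} ≤ C * Real.exp (-κ * j) := by
  have hσ : (0 : ℝ) < σ k := NNReal.coe_pos.2 (hY.pos k)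
  obtain ⟨κ, hκ, C, hC, h⟩ := exists_measureReal_vecSd_le (θ := θ / σ k) (by positivity)
    ((div_lt_one hσ).2 hθ)
  refine ⟨κ, hκ, C, hC, fun s j => ?_⟩
  simp only [blockSd_eq_vecSd]
  refine (hY.measureReal_block k s (p := fun x => vecSd x ≤ θ)
    (measurableSet_le (by fun_prop) (by fun_prop))).trans_le ?_
  refine le_trans (measureReal_mono fun x hx => ?_) (h j)
  simp only [Set.mem_ofPred_eq, vecSd_affine (μ k) hσ.le] at hx ⊢
  rw [le_div_iff₀ hσ]
  linarith

/-- If every block has a `t`-statistic of at most `t` with probability at least `p`, then it is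
unlikely that none of `B` disjoint blocks does. -/
lemma measureReal_no_block_le [IsProbabilityMeasure P] (hY : IsNormalRewards P μ σ Y) (k : Fin K)
    {j u B : ℕ} (hB : B * j ≤ u) {a t p : ℝ}
    (hp : p ≤ (stdGauss j).real {x | vecT x ((a - μ k) / σ k) ≤ t}) :
    P.real {ω | ∀ s, s + j ≤ u → t < tStat (fun i => Y k i ω) s j a} ≤ Real.exp (-p * B) := by
  have hm : MeasurableSet {x : Fin j → ℝ | t < vecT x a} :=
    measurableSet_lt (by fun_prop) (by fun_prop)
  have hq : ∀ s, P.real {ω | (fun i : Fin j => Y k (s + i) ω) ∈ {x : Fin j → ℝ | t < vecT x a}} ≤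
      1 - p := by
    intro s
    have h1 := hY.measureReal_tStat_le k s j a t
    have h2 : MeasurableSet {ω | tStat (fun i => Y k i ω) s j a ≤ t} := by
      simp only [tStat_eq_vecT]
      exact measurableSet_le ((measurable_vecT a).comp (hY.measurable_block k s j)) (by fun_prop)
    have h3 := probReal_compl_eq_one_sub (μ := P) h2
    have h4 : {ω | tStat (fun i => Y k i ω) s j a ≤ t}ᶜ =
        {ω | (fun i : Fin j => Y k (s + i) ω) ∈ {x : Fin j → ℝ | t < vecT x a}} := by
      ext ω
      simp [tStat_eq_vecT]
    rw [← h4, h3, h1]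
    linarith
  have h5 := measureReal_forall_blocks_le (hY.meas k) (hY.indep_arm k) hm hq B
  refine le_trans (measureReal_mono ?_) (h5.trans ?_)
  · intro ω hω i hi
    have h6 : i * j + j ≤ u := by
      calc i * j + j = (i + 1) * j := by ring
        _ ≤ B * j := Nat.mul_le_mul_right j hi
        _ ≤ u := hB
    have := hω (i * j) h6
    rwa [tStat_eq_vecT] at this
  · have h0 : 0 ≤ 1 - p := measureReal_nonneg.trans (hq 0)
    calc (1 - p) ^ B ≤ Real.exp (-p) ^ B := by
          gcongr
          linarith [Real.add_one_le_exp (-p)]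
      _ = Real.exp (-p * B) := by rw [← Real.exp_nat_mul]; ring_nf

end IsNormalRewards

end

noncomputable section

/-! ### Probabilities of exceptional reward sequences -/

variable {Ω : Type*} [MeasurableSpace Ω] {P : Measure Ω}

lemma div_two_mul_le_natDiv {u j : ℕ} (hj : j ≠ 0) (h : 2 * j ≤ u) :
    (u : ℝ) / (2 * j) ≤ (u / j : ℕ) := by
  have hj0 : (0 : ℝ) < j := by positivity
  have h1 : (u : ℝ) < ((u / j * j + j : ℕ) : ℝ) := by
    exact_mod_cast Nat.lt_div_mul_add (a := u) (Nat.pos_of_ne_zero hj)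
  have h2 : (2 : ℝ) * j ≤ u := by exact_mod_cast h
  push_cast at h1
  rw [div_le_iff₀ (by positivity)]
  linarith

lemma sum_exp_neg_le {κ : ℝ} (hκ : 0 < κ) (m N : ℕ) :
    ∑ n ∈ Finset.Ico m N, Real.exp (-κ * n) ≤ Real.exp (-κ * m) / (1 - Real.exp (-κ)) := by
  have h : ∀ n : ℕ, Real.exp (-κ * n) = Real.exp (-κ) ^ n := fun n => by
    rw [← Real.exp_nat_mul, mul_comm]
  simp only [h]
  exact geom_sum_Ico_le_of_lt_one (Real.exp_pos _).le (Real.exp_lt_one_iff.2 (by linarith))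

lemma measureReal_exists_le {ι : Type*} (s : Finset ι) (Q : ι → Ω → Prop) :
    P.real {ω | ∃ i ∈ s, Q i ω} ≤ ∑ i ∈ s, P.real {ω | Q i ω} := by
  have : {ω | ∃ i ∈ s, Q i ω} = ⋃ i ∈ s, {ω | Q i ω} := by ext ω; simp
  rw [this]
  exact measureReal_biUnion_finset_le s _

variable {K : ℕ} {μ : Fin K → ℝ} {σ : Fin K → ℝ≥0} {Y : Fin K → ℕ → Ω → ℝ}

/-- The event that some sample mean of `n ∈ [u, R]` observations is off by more than `δ`. -/
def inaccurate (μ : Fin K → ℝ) (Y : Fin K → ℕ → Ω → ℝ) (δ : ℝ) (u R : ℕ) : Set Ω :=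
  {ω | ∃ k, ∃ n, u ≤ n ∧ n ≤ R ∧ δ < |blockMean (fun t => Y k t ω) 0 n - μ k|}

/-- The event that arm `l`, with some number `j ∈ [a, u)` of observations, may lose its challenge
against an inferior leader with at least `u` observations and an accurate sample mean. -/
def blocked (μ : Fin K → ℝ) (Y : Fin K → ℕ → Ω → ℝ) (δ a : ℝ) (u : ℕ) (l : Fin K) : Set Ω :=
  {ω | ∃ z, μ z < μ l ∧ ∃ j < u, a ≤ (j : ℝ) ∧ blockMean (fun t => Y l t ω) 0 j < μ z + δ ∧
    ∀ s, s + j ≤ u →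
      tStat (fun t => Y l t ω) 0 j (μ z + δ) < tStat (fun t => Y z t ω) s j (μ z - δ)}

namespace IsNormalRewards

lemma exists_mean_rate (hY : IsNormalRewards P μ σ Y) {δ : ℝ} (hδ : 0 < δ) :
    ∃ κ > 0, ∀ k s j, j ≠ 0 → P.real {ω | δ < |blockMean (fun t => Y k t ω) s j - μ k|} ≤
      2 * Real.exp (-κ * j) := by
  set S : ℝ := 1 + ∑ k, (σ k : ℝ) with hS
  have hS0 : 0 < S := by positivity
  refine ⟨(δ / S) ^ 2 / 2, by positivity, fun k s j hj =>
    (hY.measureReal_blockMean k hδ s hj).trans ?_⟩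
  have hσ : (0 : ℝ) < σ k := NNReal.coe_pos.2 (hY.pos k)
  have : (σ k : ℝ) ≤ S := by
    have := Finset.single_le_sum (f := fun k => (σ k : ℝ)) (fun i _ => NNReal.coe_nonneg _)
      (Finset.mem_univ k)
    linarith
  gcongr

lemma measureReal_inaccurate_le [IsProbabilityMeasure P] {δ κ : ℝ} (hκ : 0 < κ)
    (h : ∀ k s j, j ≠ 0 → P.real {ω | δ < |blockMean (fun t => Y k t ω) s j - μ k|} ≤
      2 * Real.exp (-κ * j)) {u : ℕ} (hu : u ≠ 0) (R : ℕ) :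
    P.real (inaccurate μ Y δ u R) ≤
      2 * K / (1 - Real.exp (-κ)) * Real.exp (-κ * u) := by
  calc P.real (inaccurate μ Y δ u R)
      ≤ P.real {ω | ∃ k ∈ Finset.univ, ∃ n ∈ Finset.Ico u (R + 1),
          δ < |blockMean (fun t => Y k t ω) 0 n - μ k|} := by
        refine measureReal_mono fun ω hω => ?_
        obtain ⟨k, n, h1, h2, h3⟩ := hω
        exact ⟨k, Finset.mem_univ k, n, Finset.mem_Ico.2 ⟨h1, by omega⟩, h3⟩
    _ ≤ ∑ k : Fin K, ∑ n ∈ Finset.Ico u (R + 1), 2 * Real.exp (-κ * n) := by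
        refine (measureReal_exists_le _ _).trans (Finset.sum_le_sum fun k _ => ?_)
        refine (measureReal_exists_le _ _).trans (Finset.sum_le_sum fun n hn => ?_)
        exact h k 0 n (by have := (Finset.mem_Ico.1 hn).1; omega)
    _ ≤ ∑ k : Fin K, 2 * (Real.exp (-κ * u) / (1 - Real.exp (-κ))) := by
        refine Finset.sum_le_sum fun k _ => ?_
        rw [← Finset.mul_sum]
        gcongr
        exact sum_exp_neg_le hκ u (R + 1)
    _ = _ := by
        rw [Finset.sum_const, Finset.card_univ, Fintype.card_fin, nsmul_eq_mul]; ring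

/-- Comparison of the `t`-statistic of arm `l` with those of `B` disjoint blocks of an inferior arm
`z`. A block falls below the `p`-quantile of its `t`-statistic with probability at least `p`; the
`t`-statistic of `l`, whose mean is larger, does so with probability less than `p` times a factor
that is exponentially small in `j`. -/
lemma measureReal_blocked_at_le [IsProbabilityMeasure P] (hY : IsNormalRewards P μ σ Y)
    {z l : Fin K} {δ p : ℝ} (hp : 0 < p) (hd : δ / σ z ≤ (μ l - μ z - δ) / σ l)
    {j u B : ℕ} (hj : j ≠ 0) (hB : B * j ≤ u) :
    P.real {ω | blockMean (fun t => Y l t ω) 0 j < μ z + δ ∧ ∀ s, s + j ≤ u →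
        tStat (fun t => Y l t ω) 0 j (μ z + δ) < tStat (fun t => Y z t ω) s j (μ z - δ)} ≤
      Real.exp (-((((μ l - μ z - δ) / σ l) ^ 2 - (δ / σ z) ^ 2) / 2) * j) * p +
        Real.exp (-p * B) := by
  have hσl : (0 : ℝ) < σ l := NNReal.coe_pos.2 (hY.pos l)
  have hσz : (0 : ℝ) < σ z := NNReal.coe_pos.2 (hY.pos z)
  set d := δ / σ z with hdd
  set d' := (μ l - μ z - δ) / σ l with hdd'
  have e1 : (μ z + δ - μ l) / σ l = -d' := by rw [hdd']; ring
  have e2 : (μ z - δ - μ z) / σ z = -d := by rw [hdd]; ring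
  have hvm : Measurable fun x : Fin j → ℝ => vecT x (-d) := by fun_prop
  set ν := (stdGauss j).map fun x => vecT x (-d) with hν
  have : IsProbabilityMeasure ν := Measure.isProbabilityMeasure_map hvm.aemeasurable
  have hIic : ∀ t, ν.real (Set.Iic t) = (stdGauss j).real {x | vecT x (-d) ≤ t} := fun t => by
    rw [measureReal_def, hν, Measure.map_apply hvm measurableSet_Iic]; rfl
  have hIio : ∀ t, ν.real (Set.Iio t) = (stdGauss j).real {x | vecT x (-d) < t} := fun t => by
    rw [measureReal_def, hν, Measure.map_apply hvm measurableSet_Iio]; rfl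
  -- The shift comparison needs a quantile below `0`; failing that, a negative mean is unlikely.
  by_cases h0 : p ≤ ν.real (Set.Iic 0)
  · obtain ⟨t, ht0, ht1, ht2⟩ := exists_quantile ν hp h0
    calc _ ≤ P.real ({ω | tStat (fun i => Y l i ω) 0 j (μ z + δ) < t} ∪
          {ω | ∀ s, s + j ≤ u → t < tStat (fun i => Y z i ω) s j (μ z - δ)}) := by
          refine measureReal_mono ?_
          rintro ω ⟨-, hω⟩
          by_cases hlt : tStat (fun i => Y l i ω) 0 j (μ z + δ) < t
          · exact Or.inl hlt
          · exact Or.inr fun s hs => (not_lt.1 hlt).trans_lt (hω s hs)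
      _ ≤ _ := measureReal_union_le _ _
      _ ≤ _ := by
          refine add_le_add ?_ ?_
          · rw [hY.measureReal_tStat_lt, e1]
            refine (measureReal_vecT_lt_le hd ht0 j).trans ?_
            gcongr
            rw [← hIio]; exact ht2
          · refine hY.measureReal_no_block_le z hB ?_
            rw [e2, ← hIic]; exact ht1
  · have hneg : MeasurableSet {x : Fin j → ℝ | vecMean x < 0} :=
      measurableSet_lt (by fun_prop) (by fun_prop)
    have h1 := measureReal_shift_le hd hneg fun x hx => le_of_lt hx
    have h2 : P.real {ω | blockMean (fun t => Y l t ω) 0 j < μ z + δ} =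
        (stdGauss j).real {x | (fun i => d' + 1 * x i) ∈ {x : Fin j → ℝ | vecMean x < 0}} := by
      simp only [blockMean_eq_vecMean]
      refine (hY.measureReal_block l 0 (p := fun x => vecMean x < μ z + δ)
        (measurableSet_lt (by fun_prop) (by fun_prop))).trans ?_
      congr 1
      ext x
      simp only [Set.mem_ofPred_eq, vecMean_affine hj]
      rw [← sub_neg, show μ l + σ l * vecMean x - (μ z + δ) = σ l * (d' + 1 * vecMean x) by
        rw [hdd']; field_simp; ring]
      constructor
      · intro h; exact (pos_iff_neg_of_mul_neg h).1 hσl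
      · intro h; exact mul_neg_of_pos_of_neg hσl h
    have h3 : (stdGauss j).real {x | (fun i => d + 1 * x i) ∈ {x : Fin j → ℝ | vecMean x < 0}} ≤
        p := by
      refine le_trans ?_ (not_le.1 h0).le
      rw [hIic]
      refine measureReal_mono fun x hx => ?_
      simp only [Set.mem_ofPred_eq, vecMean_affine hj] at hx ⊢
      exact div_nonpos_of_nonpos_of_nonneg (by linarith) (vecSd_nonneg x)
    calc _ ≤ P.real {ω | blockMean (fun t => Y l t ω) 0 j < μ z + δ} :=
          measureReal_mono fun ω hω => hω.1
      _ ≤ _ := h2.trans_le h1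
      _ ≤ Real.exp (-((d' ^ 2 - d ^ 2) / 2) * j) * p := by gcongr
      _ ≤ _ := le_add_of_nonneg_right (Real.exp_pos _).le

/-- Sum of the bounds for single arms and single numbers `j` of observations. Beyond `j = T` it is
used that the sample mean of arm `l` is accurate; below, that there are at least `u / (2 * T)`
disjoint blocks of length `j`. -/
lemma measureReal_blocked_le [IsProbabilityMeasure P] (hY : IsNormalRewards P μ σ Y)
    {l : Fin K} {δ κ κ' : ℝ} (hκ : 0 < κ) (hκ' : 0 < κ')
    (hsep : ∀ z, μ z < μ l → μ z + 2 * δ < μ l)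
    (h : ∀ k s j, j ≠ 0 → P.real {ω | δ < |blockMean (fun t => Y k t ω) s j - μ k|} ≤
      2 * Real.exp (-κ * j))
    (hd : ∀ z, μ z < μ l → δ / σ z ≤ (μ l - μ z - δ) / σ l ∧
      κ' ≤ (((μ l - μ z - δ) / σ l) ^ 2 - (δ / σ z) ^ 2) / 2)
    {a T p : ℝ} {u : ℕ} (ha : 0 < a) (hT : 0 < T) (hp : 0 < p) (hTu : 2 * T ≤ u) :
    P.real (blocked μ Y δ a u l) ≤ K * (u * (2 * Real.exp (-κ * T)) +
      (T + 1) * (Real.exp (-κ' * a) * p + Real.exp (-p * (u / (2 * T))))) := by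
  set b : ℝ := Real.exp (-κ' * a) * p + Real.exp (-p * (u / (2 * T))) with hb
  have hb0 : 0 ≤ b := by positivity
  have key : ∀ z, μ z < μ l → ∀ j : ℕ, a ≤ (j : ℝ) →
      P.real {ω | blockMean (fun t => Y l t ω) 0 j < μ z + δ ∧ ∀ s, s + j ≤ u →
        tStat (fun t => Y l t ω) 0 j (μ z + δ) < tStat (fun t => Y z t ω) s j (μ z - δ)} ≤
      2 * Real.exp (-κ * T) + if (j : ℝ) < T then b else 0 := by
    intro z hz j haj
    have hj0 : (0 : ℝ) < j := ha.trans_le haj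
    have hj : j ≠ 0 := by rintro rfl; simp at hj0
    by_cases hjT : (j : ℝ) < T
    · rw [if_pos hjT]
      refine (hY.measureReal_blocked_at_le hp (hd z hz).1 hj (Nat.div_mul_le_self u j)).trans ?_
      have h1 : (u : ℝ) / (2 * T) ≤ (u / j : ℕ) := by
        have h2 : 2 * j ≤ u := by
          have : (2 : ℝ) * j ≤ u := by linarith
          exact_mod_cast this
        refine le_trans ?_ (div_two_mul_le_natDiv hj h2)
        gcongr
      have h4 : Real.exp (-((((μ l - μ z - δ) / σ l) ^ 2 - (δ / σ z) ^ 2) / 2) * j) ≤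
          Real.exp (-κ' * a) := by
        refine Real.exp_le_exp.2 ?_
        have := mul_le_mul (hd z hz).2 haj ha.le (hκ'.le.trans (hd z hz).2)
        linarith
      have h5 : Real.exp (-p * (u / j : ℕ)) ≤ Real.exp (-p * (u / (2 * T))) := by
        refine Real.exp_le_exp.2 ?_
        have := mul_le_mul_of_nonneg_left h1 hp.le
        linarith
      have h6 := mul_le_mul_of_nonneg_right h4 hp.le
      have h7 : 0 ≤ 2 * Real.exp (-κ * T) := by positivity
      rw [hb]
      linarith
    · rw [if_neg hjT, add_zero]
      refine le_trans (measureReal_mono fun ω hω => ?_) ((h l 0 j hj).trans ?_)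
      · have h1 := hω.1
        have h2 := hsep z hz
        change δ < |_ - _|
        rw [lt_abs]
        right
        linarith
      · have : κ * T ≤ κ * j := mul_le_mul_of_nonneg_left (not_lt.1 hjT) hκ.le
        gcongr 2 * Real.exp ?_
        linarith
  have hsum : ∑ j ∈ Finset.range u, (2 * Real.exp (-κ * T) + if (j : ℝ) < T then b else 0) ≤
      u * (2 * Real.exp (-κ * T)) + (T + 1) * b := by
    rw [Finset.sum_add_distrib, Finset.sum_const, Finset.card_range, nsmul_eq_mul,
      ← Finset.sum_filter, Finset.sum_const, nsmul_eq_mul]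
    gcongr
    have h1 : (Finset.range u).filter (fun j : ℕ => (j : ℝ) < T) ⊆ Finset.range ⌈T⌉₊ := by
      intro j hj
      rw [Finset.mem_range, Nat.lt_ceil]
      exact (Finset.mem_filter.1 hj).2
    have h2 := Finset.card_le_card h1
    rw [Finset.card_range] at h2
    have h3 : (((Finset.range u).filter (fun j : ℕ => (j : ℝ) < T)).card : ℝ) ≤ ⌈T⌉₊ := by
      exact_mod_cast h2
    exact h3.trans (Nat.ceil_lt_add_one hT.le).le
  calc P.real (blocked μ Y δ a u l)
      ≤ P.real {ω | ∃ z ∈ Finset.univ, ∃ j ∈ Finset.range u, (μ z < μ l ∧ a ≤ (j : ℝ)) ∧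
          (blockMean (fun t => Y l t ω) 0 j < μ z + δ ∧ ∀ s, s + j ≤ u →
          tStat (fun t => Y l t ω) 0 j (μ z + δ) < tStat (fun t => Y z t ω) s j (μ z - δ))} := by
        refine measureReal_mono fun ω hω => ?_
        obtain ⟨z, hz, j, hj, haj, h1, h2⟩ := hω
        exact ⟨z, Finset.mem_univ z, j, Finset.mem_range.2 hj, ⟨hz, haj⟩, h1, h2⟩
    _ ≤ ∑ z : Fin K, ∑ j ∈ Finset.range u,
          (2 * Real.exp (-κ * T) + if (j : ℝ) < T then b else 0) := by
        refine (measureReal_exists_le _ _).trans (Finset.sum_le_sum fun z _ => ?_)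
        refine (measureReal_exists_le _ _).trans (Finset.sum_le_sum fun j _ => ?_)
        by_cases hzj : μ z < μ l ∧ a ≤ (j : ℝ)
        · simp only [hzj, true_and, and_self]
          exact key z hzj.1 j hzj.2
        · simp only [hzj, false_and, Set.ofPred_false, measureReal_empty]
          positivity
    _ ≤ ∑ z : Fin K, (u * (2 * Real.exp (-κ * T)) + (T + 1) * b) :=
        Finset.sum_le_sum fun z _ => hsum
    _ = _ := by rw [Finset.sum_const, Finset.card_univ, Fintype.card_fin, nsmul_eq_mul]

end IsNormalRewards

end

noncomputable section

/-! ### Exceptional events that allow for an inferior leader -/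

lemma exists_pos_forall_le {ι : Type*} [Finite ι] (p : ι → Prop) {f : ι → ℝ}
    (hf : ∀ z, p z → 0 < f z) : ∃ κ > 0, ∀ z, p z → κ ≤ f z := by
  have h : ∀ᶠ κ : ℝ in 𝓝[>] 0, ∀ z, p z → κ ≤ f z := by
    refine eventually_all.2 fun z => ?_
    by_cases hz : p z
    · filter_upwards [Ioo_mem_nhdsGT (hf z hz)] with κ hκ _ using hκ.2.le
    · exact Eventually.of_forall fun κ h => absurd h hz
  obtain ⟨κ, hκ, h0⟩ := (h.and self_mem_nhdsWithin).exists
  exact ⟨κ, h0, hκ⟩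

/-- A common number of observations that every leader from round `r₀` on has. -/
def leastLead (K r₀ : ℕ) : ℕ := (r₀ - 1) / K

lemma mul_leastLead_add_one_le (K : ℕ) {r₀ : ℕ} (h : 1 ≤ r₀) : K * leastLead K r₀ + 1 ≤ r₀ := by
  have := Nat.mul_div_le (r₀ - 1) K
  unfold leastLead
  omega

lemma leastLead_le (K r₀ : ℕ) : leastLead K r₀ ≤ r₀ := (Nat.div_le_self _ _).trans (by omega)

lemma eventually_le_leastLead {K : ℕ} (hK : 0 < K) {d : ℕ} (hd : 0 < d) :
    ∀ᶠ R : ℕ in atTop, 1 / (2 * d * K : ℝ) * R ≤ leastLead K (R / d) := by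
  filter_upwards [eventually_ge_atTop (2 * d * (K + 2))] with R hR
  have h1 : R < R / d * d + d := Nat.lt_div_mul_add hd
  have h2 : R / d - 1 < leastLead K (R / d) * K + K := Nat.lt_div_mul_add hK
  have h3 : R / d ≤ leastLead K (R / d) * K + K := by omega
  have h4 : R / d * d ≤ (leastLead K (R / d) * K + K) * d := Nat.mul_le_mul_right d h3
  have h5 : R ≤ 2 * d * K * leastLead K (R / d) := by nlinarith
  have h6 : (R : ℝ) ≤ 2 * d * K * leastLead K (R / d) := by exact_mod_cast h5
  have hK' : (0 : ℝ) < K := by exact_mod_cast hK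
  have hd' : (0 : ℝ) < d := by exact_mod_cast hd
  rw [one_div, inv_mul_le_iff₀ (by positivity)]
  exact h6

lemma tendsto_log_natCast : Tendsto (fun R : ℕ => Real.log R) atTop atTop :=
  Real.tendsto_log_atTop.comp tendsto_natCast_atTop_atTop

lemma tendsto_log_div_natCast : Tendsto (fun R : ℕ => Real.log R / R) atTop (𝓝 0) := by
  have h := (Real.isLittleO_log_id_atTop.tendsto_div_nhds_zero).comp
    (tendsto_natCast_atTop_atTop (R := ℝ))
  exact h

lemma _root_.IsSamplingThreshold.tendsto {c : ℕ → ℝ} (hc : IsSamplingThreshold c) :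
    Tendsto c atTop atTop := by
  have h2 : Tendsto (fun n : ℕ => Real.log (Real.log n)) atTop atTop :=
    Real.tendsto_log_atTop.comp tendsto_log_natCast
  refine tendsto_atTop_mono' _ ?_ h2
  filter_upwards [hc.tendsto_div_log_log.eventually_ge_atTop 1, h2.eventually_gt_atTop 0]
    with n hn hn2
  rwa [le_div_iff₀ hn2, one_mul] at hn

lemma tendsto_const_mul_mul_exp_neg {α : Type*} {F : Filter α} {f : α → ℝ}
    (hf : Tendsto f F atTop) {τ : ℝ} (hτ : 0 < τ) (C : ℝ) :
    Tendsto (fun r => C * (f r * Real.exp (-(τ * f r)))) F (𝓝 0) := by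
  have h2 := ((Real.tendsto_pow_mul_exp_neg_atTop_nhds_zero 1).comp
    (hf.const_mul_atTop hτ)).const_mul (C * τ⁻¹)
  rw [mul_zero] at h2
  refine h2.congr fun R => ?_
  simp only [Function.comp_apply, pow_one]
  field_simp

/-- The thresholds grow faster than any multiple of `log log`, so that `exp (-κ c_n)` beats any
power of `log n`. -/
lemma eventually_exp_neg_threshold_le {c : ℕ → ℝ} (hc : IsSamplingThreshold c) {κ : ℝ}
    (hκ : 0 < κ) : ∀ᶠ R : ℕ in atTop, 0 < c (R / 3 - 1) ∧
      Real.exp (-κ * c (R / 3 - 1)) ≤ 16 / Real.log R ^ 4 := by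
  have hn : Tendsto (fun R : ℕ => R / 3 - 1) atTop atTop := by
    refine tendsto_atTop.2 fun b => ?_
    filter_upwards [eventually_ge_atTop (3 * b + 3)] with R hR
    omega
  have h1 := hc.tendsto_div_log_log.eventually_ge_atTop (4 / κ)
  have h2 : ∀ᶠ n : ℕ in atTop, 0 < Real.log (Real.log n) :=
    (Real.tendsto_log_atTop.comp tendsto_log_natCast).eventually_gt_atTop 0
  have h3 : ∀ᶠ n : ℕ in atTop, 0 < Real.log n := tendsto_log_natCast.eventually_gt_atTop 0
  filter_upwards [hn.eventually h1, hn.eventually h2, hn.eventually h3, eventually_ge_atTop 30]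
    with R hc1 hc2 hc3 hR
  set n := R / 3 - 1 with hndef
  rw [le_div_iff₀ hc2] at hc1
  have hpos : 0 < 4 / κ * Real.log (Real.log n) := by positivity
  refine ⟨hpos.trans_le hc1, ?_⟩
  have h4 : R ≤ n ^ 2 := by
    have : R ≤ 3 * n + 5 := by omega
    have h5 : 9 ≤ n := by omega
    nlinarith
  have h6 : Real.log R ≤ 2 * Real.log n := by
    rw [show (2 : ℝ) * Real.log n = Real.log ((n : ℝ) ^ 2) by rw [Real.log_pow]; norm_num]
    exact Real.log_le_log (by exact_mod_cast (by omega : 0 < R)) (by exact_mod_cast h4)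
  have h7 : 0 < Real.log R := Real.log_pos (by exact_mod_cast (by omega : 1 < R))
  calc Real.exp (-κ * c n) ≤ Real.exp (-(4 * Real.log (Real.log n))) := by
        refine Real.exp_le_exp.2 ?_
        have := mul_le_mul_of_nonneg_left hc1 hκ.le
        have e : κ * (4 / κ * Real.log (Real.log n)) = 4 * Real.log (Real.log n) := by
          field_simp
        linarith
    _ = (Real.log n ^ 4)⁻¹ := by
        rw [Real.exp_neg, show (4 : ℝ) * Real.log (Real.log n) =
          ((4 : ℕ) : ℝ) * Real.log (Real.log n) by norm_num, Real.exp_nat_mul, Real.exp_log hc3]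
    _ ≤ ((Real.log R / 2) ^ 4)⁻¹ := by
        gcongr
        linarith
    _ = 16 / Real.log R ^ 4 := by field_simp; norm_num

variable {Ω : Type*} [MeasurableSpace Ω] {P : Measure Ω} [IsProbabilityMeasure P]
variable {K : ℕ} {μ : Fin K → ℝ} {σ : Fin K → ℝ≥0} {Y : Fin K → ℕ → Ω → ℝ}

/-- The exceptional reward sequences that allow for an inferior leader in round `R` have
probability `o(1 / R)`. -/
lemma IsNormalRewards.tendsto_mul_measureReal_blocked (hY : IsNormalRewards P μ σ Y) {c : ℕ → ℝ}
    (hc : IsSamplingThreshold c) (l : Fin K) :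
    ∃ δ > 0, (∀ i j, μ i < μ j → μ i + 2 * δ < μ j) ∧
      Tendsto (fun R : ℕ => R * (P.real (inaccurate μ Y δ (leastLead K (R / 3)) R) +
        P.real (blocked μ Y δ (c (R / 3 - 1)) (leastLead K (R / 3)) l))) atTop (𝓝 0) := by
  have hK : 0 < K := Fin.pos_iff_nonempty.2 ⟨l⟩
  have hσ : ∀ k, (0 : ℝ) < σ k := fun k => NNReal.coe_pos.2 (hY.pos k)
  obtain ⟨δ₁, hδ₁, hsep₁⟩ := exists_pos_forall_le
    (fun p : Fin K × Fin K => μ p.1 < μ p.2) (f := fun p => (μ p.2 - μ p.1) / 4)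
    fun p hp => by linarith
  obtain ⟨δ₂, hδ₂, hsep₂⟩ := exists_pos_forall_le (fun z : Fin K => μ z < μ l)
    (f := fun z => (μ l - μ z) / σ l / (2 * (1 / σ z + 1 / σ l))) fun z hz => by
      have := hσ z; have := hσ l
      have : 0 < μ l - μ z := by linarith
      positivity
  set δ := min δ₁ δ₂ with hδdef
  have hδ : 0 < δ := lt_min hδ₁ hδ₂
  have hsep : ∀ i j, μ i < μ j → μ i + 2 * δ < μ j := by
    intro i j hij
    have := hsep₁ (i, j) hij
    have h' : δ ≤ δ₁ := min_le_left _ _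
    simp only at this
    linarith
  have hd : ∀ z, μ z < μ l → δ / σ z < (μ l - μ z - δ) / σ l := by
    intro z hz
    have h1 := hsep₂ z hz
    have h2 : δ ≤ δ₂ := min_le_right _ _
    have hz' := hσ z
    have hl' := hσ l
    have h3 : 0 < 1 / (σ z : ℝ) + 1 / σ l := by positivity
    rw [le_div_iff₀ (by positivity)] at h1
    have h4 : 0 < (μ l - μ z) / σ l := div_pos (by linarith) hl'
    have h5 : δ * (1 / (σ z : ℝ) + 1 / σ l) ≤ δ₂ * (1 / (σ z : ℝ) + 1 / σ l) := by gcongr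
    rw [sub_div]
    have e : δ * (1 / (σ z : ℝ) + 1 / σ l) = δ / σ z + δ / σ l := by ring
    linarith
  obtain ⟨κ', hκ', hκ'le⟩ := exists_pos_forall_le (fun z : Fin K => μ z < μ l)
    (f := fun z => (((μ l - μ z - δ) / σ l) ^ 2 - (δ / σ z) ^ 2) / 2) fun z hz => by
      have h1 := hd z hz
      have h2 : 0 ≤ δ / σ z := by positivity
      nlinarith
  obtain ⟨κ, hκ, hmean⟩ := hY.exists_mean_rate hδ
  refine ⟨δ, hδ, hsep, ?_⟩
  set A : ℝ := 3 / κ with hA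
  have hA0 : 0 < A := by positivity
  set α : ℝ := 1 / (2 * (3 : ℕ) * K : ℝ) with hα
  have hK' : (0 : ℝ) < K := by exact_mod_cast hK
  have hα0 : 0 < α := by positivity
  set D : ℝ := 2 * K / (1 - Real.exp (-κ)) with hD
  have hD0 : 0 ≤ D := by
    have : Real.exp (-κ) ≤ 1 := Real.exp_le_one_iff.2 (by linarith)
    exact div_nonneg (by positivity) (by linarith)
  have hlim : Tendsto (fun R : ℕ => D * (R * Real.exp (-(κ * α * R))) + (2 * K * (1 / (R : ℝ)) +
      (K * (A * (Real.log R / R) + 1 / R) +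
        K * (64 * A / α) * (A * (Real.log R)⁻¹ + (Real.log R)⁻¹ ^ 2)))) atTop (𝓝 0) := by
    have hinv : Tendsto (fun R : ℕ => (Real.log R)⁻¹) atTop (𝓝 0) :=
      tendsto_inv_atTop_zero.comp tendsto_log_natCast
    have hexp := tendsto_const_mul_mul_exp_neg (tendsto_natCast_atTop_atTop (R := ℝ))
      (show 0 < κ * α by positivity) D
    have := hexp.add ((tendsto_one_div_atTop_nhds_zero_nat.const_mul (2 * (K : ℝ))).add
      ((((tendsto_log_div_natCast.const_mul A).add tendsto_one_div_atTop_nhds_zero_nat).const_mul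
        (K : ℝ)).add (((hinv.const_mul A).add (hinv.pow 2)).const_mul (K * (64 * A / α)))))
    simpa using this
  refine squeeze_zero' (Eventually.of_forall fun R => by positivity) ?_ hlim
  have hlogsmall : ∀ᶠ R : ℕ in atTop, 2 * (A * Real.log R) ≤ α * R := by
    have := (tendsto_log_div_natCast).eventually_le_const (u := α / (2 * A)) (by positivity)
    filter_upwards [this, eventually_gt_atTop 0] with R hR hR0
    have hR0' : (0 : ℝ) < R := by exact_mod_cast hR0
    rw [div_le_div_iff₀ hR0' (by positivity)] at hR
    linarith
  filter_upwards [eventually_exp_neg_threshold_le hc hκ', eventually_le_leastLead hK three_pos,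
    hlogsmall, tendsto_log_natCast.eventually_gt_atTop 0, eventually_ge_atTop 1]
    with R hcR huR hlR hlog hR1
  rw [← hα] at huR
  set a := c (R / 3 - 1) with ha
  set u := leastLead K (R / 3) with hu
  set x := Real.log R with hx
  have hR0 : (0 : ℝ) < R := by exact_mod_cast hR1
  have hu0 : (0 : ℝ) < u := lt_of_lt_of_le (by positivity) huR
  have huR' : (u : ℝ) ≤ R := by
    exact_mod_cast (leastLead_le K _).trans (Nat.div_le_self _ _)
  have hune : u ≠ 0 := by rintro h; rw [h] at hu0; simp at hu0
  -- With these choices `exp (-κ * T) = R ^ (-3)` and `exp (-p * (u / (2 * T))) = R ^ (-2)`.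
  set T := A * x with hT
  set p := 4 * T * x / u with hp
  have hT0 : 0 < T := by positivity
  have hp0 : 0 < p := by positivity
  have b1 := measureReal_inaccurate_le (P := P) hκ hmean hune R
  have b2 := hY.measureReal_blocked_le (l := l) hκ hκ' (fun z hz => hsep z l hz) hmean
    (fun z hz => ⟨(hd z hz).le, hκ'le z hz⟩) hcR.1 hT0 hp0 (hlR.trans huR)
  have ex : Real.exp x = R := by rw [hx, Real.exp_log hR0]
  have e1 : Real.exp (-κ * T) = 1 / (R : ℝ) ^ 3 := by
    rw [show -κ * T = -(((3 : ℕ) : ℝ) * x) by rw [hT, hA]; field_simp; norm_num, Real.exp_neg,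
      Real.exp_nat_mul, ex, one_div]
  have e2 : Real.exp (-p * (u / (2 * T))) = 1 / (R : ℝ) ^ 2 := by
    rw [show -p * (u / (2 * T)) = -(((2 : ℕ) : ℝ) * x) by rw [hp]; field_simp; norm_num,
      Real.exp_neg, Real.exp_nat_mul, ex, one_div]
  have e3 : Real.exp (-κ * u) ≤ Real.exp (-(κ * α * R)) := by
    refine Real.exp_le_exp.2 ?_
    have := mul_le_mul_of_nonneg_left huR hκ.le
    linarith
  rw [e1, e2] at b2
  have e4 : p ≤ 4 * A * x ^ 2 / (α * R) := by
    rw [hp, hT, show 4 * (A * x) * x = 4 * A * x ^ 2 by ring]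
    gcongr
  have t1 : (R : ℝ) * P.real (inaccurate μ Y δ u R) ≤ D * (R * Real.exp (-(κ * α * R))) := by
    calc (R : ℝ) * P.real (inaccurate μ Y δ u R) ≤ R * (D * Real.exp (-(κ * α * R))) := by
          gcongr
          exact b1.trans (by gcongr)
      _ = _ := by ring
  have t2 : (R : ℝ) * P.real (blocked μ Y δ a u l) ≤ 2 * K * (1 / (R : ℝ)) +
      (K * (A * (x / R) + 1 / R) + K * (64 * A / α) * (A * x⁻¹ + x⁻¹ ^ 2)) := by
    calc (R : ℝ) * P.real (blocked μ Y δ a u l)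
        ≤ R * (K * (R * (2 * (1 / (R : ℝ) ^ 3)) + (T + 1) *
            (16 / x ^ 4 * (4 * A * x ^ 2 / (α * R)) + 1 / (R : ℝ) ^ 2))) := by
          gcongr
          refine b2.trans ?_
          gcongr
          exact hcR.2
      _ = _ := by rw [hT]; field_simp; ring
  rw [mul_add]
  exact add_le_add t1 t2

end

noncomputable section

variable {Ω : Type*} [MeasurableSpace Ω] {P : Measure Ω} [IsProbabilityMeasure P]
variable {K : ℕ} {μ : Fin K → ℝ} {σ : Fin K → ℝ≥0} {Y : Fin K → ℕ → Ω → ℝ}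

/-! ### Wins of inferior arms against optimal leaders -/

/-- The event that arm `k`, with `j` observations, may win a comparison with an arm as good as `l`
that has at most `R` observations. -/
def upset (μ : Fin K → ℝ) (Y : Fin K → ℕ → Ω → ℝ) (k l : Fin K) (R j : ℕ) : Set Ω :=
  {ω | ∃ z, μ z = μ l ∧ ∃ n, j < n ∧ n ≤ R ∧
    (blockMean (fun t => Y z t ω) 0 n ≤ blockMean (fun t => Y k t ω) 0 j ∨ ∃ s, s + j ≤ n ∧
      tStat (fun t => Y z t ω) s j (blockMean (fun t => Y z t ω) 0 n) ≤
        tStat (fun t => Y k t ω) 0 j (blockMean (fun t => Y z t ω) 0 n))}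

namespace IsNormalRewards

/-- The factor `R + 1` counts the blocks of an optimal arm; each has a `t`-statistic as small as
that of the inferior arm with probability of the exponential rate `infoM h`. -/
lemma exists_measureReal_upset_le (hY : IsNormalRewards P μ σ Y) {k l : Fin K} (hkl : μ k < μ l)
    {h : ℝ} (h0 : 0 < h) (hh : h < (μ l - μ k) / σ k) :
    ∃ κ > 0, ∃ C > 0, ∀ R j : ℕ, j ≠ 0 → P.real (upset μ Y k l R j) ≤
      C * Real.exp (-κ * j) + C * (R + 1) * Real.exp (-infoM h * j) := by
  have hσ : ∀ k, (0 : ℝ) < σ k := fun k => NNReal.coe_pos.2 (hY.pos k)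
  set x := (h + (μ l - μ k) / σ k) / 2 with hx
  have hx1 : h < x := by rw [hx]; linarith
  have hx2 : x < (μ l - μ k) / σ k := by rw [hx]; linarith
  have hx0 : 0 < x := h0.trans hx1
  obtain ⟨δ₁, hδ₁, C₁, hC₁, hT⟩ := exists_measureReal_vecT_le h0 hx1
  obtain ⟨δ₂, hδ₂, hδ₂le⟩ := exists_pos_forall_le (fun _ : Fin K => True)
    (f := fun z => δ₁ * σ z) fun z _ => mul_pos hδ₁ (hσ z)
  have hgap : 0 < μ l - μ k - x * σ k := by
    rw [lt_div_iff₀ (hσ k)] at hx2; linarith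
  set δ := min δ₂ ((μ l - μ k - x * σ k) / 4) with hδdef
  have hδ : 0 < δ := lt_min hδ₂ (by positivity)
  have hδz : ∀ z, δ / σ z ≤ δ₁ := fun z => by
    rw [div_le_iff₀ (hσ z)]
    exact (min_le_left _ _).trans (hδ₂le z trivial)
  have hδg : 4 * δ ≤ μ l - μ k - x * σ k := by
    have : δ ≤ (μ l - μ k - x * σ k) / 4 := min_le_right _ _
    linarith
  set θ := (μ l - μ k - 2 * δ) / x with hθ
  have hθσ : σ k < θ := by
    rw [hθ, lt_div_iff₀ hx0]; linarith
  have hθx : θ * x = μ l - μ k - 2 * δ := by rw [hθ]; field_simp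
  obtain ⟨κ₁, hκ₁, D₁, hD₁, b₁⟩ := hY.exists_measureReal_le_blockSd k hθσ
  obtain ⟨κ₂, hκ₂, D₂, hD₂, b₂⟩ := hY.exists_measureReal_blockSd_le k le_rfl (hσ k)
  obtain ⟨κ₃, hκ₃, hmean⟩ := hY.exists_mean_rate hδ
  set D₃ : ℝ := 2 * K / (1 - Real.exp (-κ₃)) with hD₃
  have hD₃0 : 0 ≤ D₃ := by
    have : Real.exp (-κ₃) ≤ 1 := Real.exp_le_one_iff.2 (by linarith)
    exact div_nonneg (by positivity) (by linarith)
  set κ := min κ₁ (min κ₂ κ₃) with hκdef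
  have hκ : 0 < κ := lt_min hκ₁ (lt_min hκ₂ hκ₃)
  have hκle : ∀ {κ' : ℝ} (j : ℕ), κ ≤ κ' → Real.exp (-κ' * j) ≤ Real.exp (-κ * j) := by
    intro κ' j hle
    refine Real.exp_le_exp.2 ?_
    have := mul_le_mul_of_nonneg_right hle (Nat.cast_nonneg (α := ℝ) j)
    linarith
  have l1 : κ ≤ κ₁ := min_le_left _ _
  have l2 : κ ≤ κ₂ := (min_le_right _ _).trans (min_le_left _ _)
  have l3 : κ ≤ κ₃ := (min_le_right _ _).trans (min_le_right _ _)
  refine ⟨κ, hκ, D₁ + D₂ + D₃ + K * C₁, by positivity, fun R j hj => ?_⟩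
  set E : Set Ω := {ω | ∃ z ∈ (Finset.univ : Finset (Fin K)), ∃ s ∈ Finset.range (R + 1),
    tStat (fun t => Y z t ω) s j (μ z + δ) ≤ -x} with hE
  have hEle : P.real E ≤ K * ((R + 1) * (C₁ * Real.exp (-infoM h * j))) := by
    calc P.real E ≤ ∑ z : Fin K, ∑ s ∈ Finset.range (R + 1), C₁ * Real.exp (-infoM h * j) := by
          refine (measureReal_exists_le _ _).trans (Finset.sum_le_sum fun z _ => ?_)
          refine (measureReal_exists_le _ _).trans (Finset.sum_le_sum fun s _ => ?_)
          rw [hY.measureReal_tStat_le, add_sub_cancel_left]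
          refine (measureReal_mono fun y hy => ?_).trans (hT j)
          exact (vecT_anti y (hδz z)).trans hy
      _ = _ := by
          simp only [Finset.sum_const, Finset.card_univ, Fintype.card_fin, Finset.card_range,
            nsmul_eq_mul]
          push_cast
          ring
  have hsub : upset μ Y k l R j ⊆ inaccurate μ Y δ j R ∪
      ({ω | θ ≤ blockSd (fun t => Y k t ω) 0 j} ∪
        ({ω | blockSd (fun t => Y k t ω) 0 j ≤ 0} ∪ E)) := by
    rintro ω ⟨z, hz, n, hjn, hnR, hwin⟩
    by_contra hcon
    simp only [Set.mem_union, not_or] at hcon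
    obtain ⟨c1, c2, c3, c4⟩ := hcon
    have hacc : ∀ k n, j ≤ n → n ≤ R → |blockMean (fun t => Y k t ω) 0 n - μ k| ≤ δ := by
      intro k n h1 h2
      by_contra! h3
      exact c1 ⟨k, n, h1, h2, h3⟩
    have hzn := abs_le.1 (hacc z n hjn.le hnR)
    have hkj := abs_le.1 (hacc k j le_rfl (hjn.le.trans hnR))
    have hsd0 : 0 < blockSd (fun t => Y k t ω) 0 j := not_le.1 c3
    have hsd1 : blockSd (fun t => Y k t ω) 0 j < θ := not_le.1 c2
    have hxσ : 0 < x * σ k := mul_pos hx0 (hσ k)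
    rcases hwin with hwin | ⟨s, hs, hwin⟩
    · linarith [hzn.1, hkj.2]
    · refine c4 ⟨z, Finset.mem_univ z, s, Finset.mem_range.2 (by omega), ?_⟩
      calc _ ≤ _ := tStat_anti _ s j (by linarith [hzn.2] :
            blockMean (fun t => Y z t ω) 0 n ≤ μ z + δ)
        _ ≤ _ := hwin
        _ ≤ -x := by
          unfold tStat
          rw [div_le_iff₀ hsd0]
          have : x * blockSd (fun t => Y k t ω) 0 j ≤ θ * x := by
            rw [mul_comm θ]; gcongr
          linarith [hzn.1, hkj.2]
  have b3 := measureReal_inaccurate_le (P := P) hκ₃ hmean hj R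
  calc P.real (upset μ Y k l R j) ≤ _ := measureReal_mono hsub
    _ ≤ D₃ * Real.exp (-κ * j) + (D₁ * Real.exp (-κ * j) + (D₂ * Real.exp (-κ * j) +
          K * ((R + 1) * (C₁ * Real.exp (-infoM h * j))))) := by
        refine (measureReal_union_le _ _).trans (add_le_add (b3.trans ?_) ?_)
        · exact mul_le_mul_of_nonneg_left (hκle j l3) hD₃0
        refine (measureReal_union_le _ _).trans (add_le_add ((b₁ 0 j).trans ?_) ?_)
        · exact mul_le_mul_of_nonneg_left (hκle j l1) hD₁.le
        refine (measureReal_union_le _ _).trans (add_le_add ((b₂ 0 j).trans ?_) hEle)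
        exact mul_le_mul_of_nonneg_left (hκle j l2) hD₂.le
    _ ≤ _ := by
        have q1 : 0 ≤ K * C₁ * Real.exp (-κ * j) := by positivity
        have q2 : 0 ≤ (D₁ + D₂ + D₃) * ((R + 1) * Real.exp (-infoM h * j)) := by positivity
        linarith

/-- Beyond `log R / infoM h` observations, upsets are so unlikely that their expected number
remains bounded. -/
lemma exists_sum_measureReal_upset_le (hY : IsNormalRewards P μ σ Y) {k l : Fin K}
    (hkl : μ k < μ l) {h : ℝ} (h0 : 0 < h) (hh : h < (μ l - μ k) / σ k) :
    ∃ C, ∀ R m : ℕ, 1 ≤ R → 1 ≤ m → Real.log R / infoM h ≤ m →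
      ∑ j ∈ Finset.Ico m R, P.real (upset μ Y k l R j) ≤ C := by
  obtain ⟨κ, hκ, C, hC, hb⟩ := hY.exists_measureReal_upset_le hkl h0 hh
  have hM : 0 < infoM h := infoM_pos h0.ne'
  have pos : ∀ {a : ℝ}, 0 < a → 0 < 1 - Real.exp (-a) := fun ha => by
    have := Real.exp_lt_one_iff.2 (neg_lt_zero.2 ha); linarith
  refine ⟨C * (1 / (1 - Real.exp (-κ))) + C * (2 / (1 - Real.exp (-infoM h))),
    fun R m hR hm hle => ?_⟩
  have hR0 : (0 : ℝ) < R := by exact_mod_cast hR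
  calc ∑ j ∈ Finset.Ico m R, P.real (upset μ Y k l R j)
      ≤ ∑ j ∈ Finset.Ico m R,
          (C * Real.exp (-κ * j) + C * (R + 1) * Real.exp (-infoM h * j)) :=
        Finset.sum_le_sum fun j hj => hb R j (by have := (Finset.mem_Ico.1 hj).1; omega)
    _ ≤ C * (Real.exp (-κ * m) / (1 - Real.exp (-κ))) +
          C * (R + 1) * (Real.exp (-infoM h * m) / (1 - Real.exp (-infoM h))) := by
        rw [Finset.sum_add_distrib, ← Finset.mul_sum, ← Finset.mul_sum]
        gcongr
        · exact sum_exp_neg_le hκ m R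
        · exact sum_exp_neg_le hM m R
    _ ≤ _ := by
        have e1 : Real.exp (-κ * m) ≤ 1 := Real.exp_le_one_iff.2 (by
          have : 0 ≤ κ * (m : ℝ) := by positivity
          linarith)
        have e2 : Real.exp (-infoM h * m) ≤ 1 / R := by
          rw [one_div, ← Real.exp_log hR0, ← Real.exp_neg]
          refine Real.exp_le_exp.2 ?_
          rw [div_le_iff₀ hM] at hle
          linarith
        have e3 : ((R : ℝ) + 1) * (Real.exp (-infoM h * m) / (1 - Real.exp (-infoM h))) ≤
            2 / (1 - Real.exp (-infoM h)) := by
          rw [← mul_div_assoc]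
          refine div_le_div_of_nonneg_right ?_ (pos hM).le
          calc ((R : ℝ) + 1) * Real.exp (-infoM h * m) ≤ (R + R) * (1 / R) := by
                gcongr; exact_mod_cast hR
            _ = 2 := by field_simp; norm_num
        rw [mul_assoc C]
        have := pos hκ
        gcongr

end IsNormalRewards

end

noncomputable section

variable {Ω : Type*} [MeasurableSpace Ω] {P : Measure Ω} [IsProbabilityMeasure P]
variable {K : ℕ} {μ : Fin K → ℝ} {σ : Fin K → ℝ≥0} {Y : Fin K → ℕ → Ω → ℝ}

/-! ### Losses of inferior arms with few observations -/

/-- The event that arm `k`, with some number `j ∈ [a, m)` of observations, may lose its challenge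
against some arm with at least `u` observations and an accurate sample mean. -/
def hindered (μ : Fin K → ℝ) (Y : Fin K → ℕ → Ω → ℝ) (δ a : ℝ) (u m : ℕ) (k : Fin K) : Set Ω :=
  {ω | ∃ z, z ≠ k ∧ ∃ j < m, a ≤ (j : ℝ) ∧ ∀ s, s + j ≤ u →
    tStat (fun t => Y k t ω) 0 j (μ z + δ) < tStat (fun t => Y z t ω) s j (μ z - δ)}

namespace IsNormalRewards

/-- The `t`-statistics of an inferior arm, centred near the mean of a better arm, are eventually
close to their limit. -/
lemma exists_measureReal_tStat_lt_le (hY : IsNormalRewards P μ σ Y) {k l : Fin K} {x δ : ℝ}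
    (hx : 0 < x) (hδ : 0 < δ) (hkl : μ k < μ l) (hgap : μ l - μ k + 2 * δ < x * σ k) :
    ∃ κ > 0, ∃ C > 0, ∀ j : ℕ, j ≠ 0 →
      P.real {ω | tStat (fun t => Y k t ω) 0 j (μ l + δ) < -x} ≤ C * Real.exp (-κ * j) := by
  set θ := (μ l - μ k + 2 * δ) / x with hθ
  have hθ0 : 0 < θ := div_pos (by linarith) hx
  have hθσ : θ < σ k := by
    rw [hθ, div_lt_iff₀ hx]; linarith
  have hθx : θ * x = μ l - μ k + 2 * δ := by rw [hθ]; field_simp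
  obtain ⟨κ₂, hκ₂, C₂, hC₂, b₂⟩ := hY.exists_measureReal_blockSd_le k hθ0.le hθσ
  obtain ⟨κ₃, hκ₃, hmean⟩ := hY.exists_mean_rate hδ
  refine ⟨min κ₂ κ₃, lt_min hκ₂ hκ₃, C₂ + 2, by positivity, fun j hj => ?_⟩
  have hsub : {ω | tStat (fun t => Y k t ω) 0 j (μ l + δ) < -x} ⊆
      {ω | blockSd (fun t => Y k t ω) 0 j ≤ θ} ∪
      {ω | δ < |blockMean (fun t => Y k t ω) 0 j - μ k|} := by
    intro ω hω
    by_contra hcon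
    simp only [Set.mem_union, Set.mem_ofPred_eq, not_or, not_le, not_lt] at hcon hω
    obtain ⟨h1, h2⟩ := hcon
    have h2 := abs_le.1 h2
    have hsd : 0 < blockSd (fun t => Y k t ω) 0 j := hθ0.trans h1
    unfold tStat at hω
    rw [div_lt_iff₀ hsd] at hω
    have : θ * x ≤ x * blockSd (fun t => Y k t ω) 0 j := by
      rw [mul_comm θ]; gcongr
    linarith [h2.1]
  have e : ∀ κ', min κ₂ κ₃ ≤ κ' →
      Real.exp (-κ' * j) ≤ Real.exp (-(min κ₂ κ₃) * j) := by
    intro κ' hle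
    gcongr
  calc _ ≤ _ := measureReal_mono hsub
    _ ≤ C₂ * Real.exp (-κ₂ * j) + 2 * Real.exp (-κ₃ * j) :=
      (measureReal_union_le _ _).trans (add_le_add (b₂ 0 j) (hmean k 0 j hj))
    _ ≤ C₂ * Real.exp (-(min κ₂ κ₃) * j) + 2 * Real.exp (-(min κ₂ κ₃) * j) := by
      gcongr
      · exact min_le_left _ _
      · exact min_le_right _ _
    _ = _ := by ring

/-- If a block of length `j ≤ ρ * log r` has a small `t`-statistic with probability at least
`exp (-ν j) / 2`, where `ρ ν < 1`, then one of the disjoint blocks among `u`, of order `r`, rewards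
is very likely to have one. -/
lemma measureReal_no_block_le_exp_rpow (hY : IsNormalRewards P μ σ Y) {z : Fin K}
    {j r u : ℕ} {a x ν ρ α β : ℝ} (hj : j ≠ 0) (hr : 1 ≤ r) (hν : 0 ≤ ν) (hρ : 0 < ρ)
    (hα : 0 ≤ α) (hβ : β = (1 - ρ * ν) / 2)
    (hp : 1 / 2 * Real.exp (-ν * j) ≤ (stdGauss j).real {y | vecT y ((a - μ z) / σ z) ≤ -x})
    (hjr : j ≤ ρ * Real.log r) (hlog : Real.log r ≤ (r : ℝ) ^ β)
    (hu : α * r ≤ u) (hu2 : 2 * (ρ * Real.log r) ≤ u) :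
    P.real {ω | ∀ s, s + j ≤ u → -x < tStat (fun t => Y z t ω) s j a} ≤
      Real.exp (-(α / (4 * ρ) * (r : ℝ) ^ β)) := by
  have hr0 : (0 : ℝ) < r := by exact_mod_cast hr
  have hj0 : (0 : ℝ) < j := by positivity
  have hrβ : (0 : ℝ) < (r : ℝ) ^ β := Real.rpow_pos_of_pos hr0 _
  refine (hY.measureReal_no_block_le z (Nat.div_mul_le_self u j) hp).trans
    (Real.exp_le_exp.2 ?_)
  have h2j : 2 * j ≤ u := by
    have : (2 : ℝ) * j ≤ u := by linarith
    exact_mod_cast this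
  have q1 : (r : ℝ) ^ (-(ρ * ν)) ≤ Real.exp (-ν * j) := by
    rw [Real.rpow_def_of_pos hr0]
    refine Real.exp_le_exp.2 ?_
    have := mul_le_mul_of_nonneg_left hjr hν
    linarith
  have q3 : α * r / (2 * ((r : ℝ) ^ β * ρ)) ≤ (u / j : ℕ) := by
    refine le_trans ?_ (div_two_mul_le_natDiv hj h2j)
    have : (j : ℝ) ≤ (r : ℝ) ^ β * ρ := by
      refine hjr.trans ?_
      rw [mul_comm]
      gcongr
    gcongr
  have q5 : α / (4 * ρ) * (r : ℝ) ^ β =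
      1 / 2 * (r : ℝ) ^ (-(ρ * ν)) * (α * r / (2 * ((r : ℝ) ^ β * ρ))) := by
    have h1 : (r : ℝ) ^ (-(ρ * ν)) * r = (r : ℝ) ^ β * (r : ℝ) ^ β := by
      have h2 : (r : ℝ) ^ (-(ρ * ν)) * (r : ℝ) ^ (1 : ℝ) = (r : ℝ) ^ β * (r : ℝ) ^ β := by
        rw [← Real.rpow_add hr0, ← Real.rpow_add hr0, hβ]
        congr 1; ring
      rwa [Real.rpow_one] at h2
    rw [show 1 / 2 * (r : ℝ) ^ (-(ρ * ν)) * (α * r / (2 * ((r : ℝ) ^ β * ρ))) =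
      α / 4 * ((r : ℝ) ^ (-(ρ * ν)) * r) / ((r : ℝ) ^ β * ρ) by ring, h1]
    field_simp
  rw [neg_mul, q5]
  refine neg_le_neg ?_
  gcongr

/-- The probability of `hindered`, for given `t`-statistics bounds. -/
lemma measureReal_hindered_le {k l : Fin K} (hl : ∀ z, μ z ≤ μ l) {δ a x κ C q : ℝ} {u m : ℕ}
    (hκ : 0 < κ) (hC : 0 ≤ C) (ha : 0 < a)
    (hk : ∀ j : ℕ, j ≠ 0 →
      P.real {ω | tStat (fun t => Y k t ω) 0 j (μ l + δ) < -x} ≤ C * Real.exp (-κ * j))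
    (hz : ∀ z, ∀ j : ℕ, a ≤ j → j < m →
      P.real {ω | ∀ s, s + j ≤ u → -x < tStat (fun t => Y z t ω) s j (μ z - δ)} ≤ q) (hq : 0 ≤ q) :
    P.real (hindered μ Y δ a u m k) ≤
      C / (1 - Real.exp (-κ)) * Real.exp (-(κ * a)) + K * (m * q) := by
  calc P.real (hindered μ Y δ a u m k)
      ≤ P.real ({ω | ∃ j ∈ Finset.Ico ⌈a⌉₊ m, tStat (fun t => Y k t ω) 0 j (μ l + δ) < -x} ∪
          {ω | ∃ z ∈ (Finset.univ : Finset (Fin K)), ∃ j ∈ Finset.Ico ⌈a⌉₊ m,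
            ∀ s, s + j ≤ u → -x < tStat (fun t => Y z t ω) s j (μ z - δ)}) := by
        refine measureReal_mono ?_
        rintro ω ⟨z, -, j, hjm, haj, hω⟩
        have hj : j ∈ Finset.Ico ⌈a⌉₊ m := Finset.mem_Ico.2 ⟨Nat.ceil_le.2 haj, hjm⟩
        by_cases hlt : tStat (fun t => Y k t ω) 0 j (μ l + δ) < -x
        · exact Or.inl ⟨j, hj, hlt⟩
        · refine Or.inr ⟨z, Finset.mem_univ z, j, hj, fun s hs => ?_⟩
          refine lt_of_le_of_lt ((not_lt.1 hlt).trans ?_) (hω s hs)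
          exact tStat_anti _ 0 j (by linarith [hl z])
    _ ≤ _ := measureReal_union_le _ _
    _ ≤ _ := by
        refine add_le_add ?_ ?_
        · refine (measureReal_exists_le _ _).trans ?_
          calc _ ≤ ∑ j ∈ Finset.Ico ⌈a⌉₊ m, C * Real.exp (-κ * j) := by
                refine Finset.sum_le_sum fun j hj => hk j ?_
                have h1 := Nat.ceil_le.1 (Finset.mem_Ico.1 hj).1
                rintro rfl
                simp only [Nat.cast_zero] at h1
                linarith
            _ ≤ C * (Real.exp (-κ * ⌈a⌉₊) / (1 - Real.exp (-κ))) := by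
                rw [← Finset.mul_sum]
                gcongr
                exact sum_exp_neg_le hκ ⌈a⌉₊ m
            _ ≤ C * (Real.exp (-(κ * a)) / (1 - Real.exp (-κ))) := by
                have h1 : Real.exp (-κ) ≤ 1 := Real.exp_le_one_iff.2 (by linarith)
                have := mul_le_mul_of_nonneg_left (Nat.le_ceil a) hκ.le
                refine mul_le_mul_of_nonneg_left
                  (div_le_div_of_nonneg_right (Real.exp_le_exp.2 ?_) (by linarith)) hC
                linarith
            _ = _ := by ring
        · refine (measureReal_exists_le _ _).trans ?_
          calc _ ≤ ∑ _z : Fin K, (m * q) := by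
                refine Finset.sum_le_sum fun z _ => (measureReal_exists_le _ _).trans ?_
                calc _ ≤ ∑ j ∈ Finset.Ico ⌈a⌉₊ m, q := Finset.sum_le_sum fun j hj =>
                      hz z j (Nat.ceil_le.1 (Finset.mem_Ico.1 hj).1) (Finset.mem_Ico.1 hj).2
                  _ ≤ m * q := by
                    rw [Finset.sum_const, nsmul_eq_mul, Nat.card_Ico]
                    gcongr
                    exact_mod_cast Nat.sub_le _ _
            _ = _ := by
                rw [Finset.sum_const, Finset.card_univ, Fintype.card_fin, nsmul_eq_mul]

/-- If `ρ` is below `1 / infoM` of the standardized gap, then arm `k` is unlikely to lose a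
challenge before it has `ρ * log r` observations: its `t`-statistics are eventually close to their
limit, and among the many disjoint blocks of the leader there is one with a smaller
`t`-statistic. -/
lemma exists_tendsto_measureReal_hindered (hY : IsNormalRewards P μ σ Y) {c : ℕ → ℝ}
    (hc : IsSamplingThreshold c) {k l : Fin K} (hl : ∀ z, μ z ≤ μ l) (hkl : μ k < μ l) {ρ : ℝ}
    (hρ0 : 0 < ρ) (hρ : ρ * infoM ((μ l - μ k) / σ k) < 1) :
    ∃ δ > 0, Tendsto (fun r : ℕ => P.real (inaccurate μ Y δ (leastLead K (r / 2)) r) +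
      P.real (hindered μ Y δ (c (r / 2 - 1)) (leastLead K (r / 2)) ⌊ρ * Real.log r⌋₊ k))
      atTop (𝓝 0) := by
  have hK : 0 < K := Fin.pos_iff_nonempty.2 ⟨l⟩
  have hK' : (0 : ℝ) < K := by exact_mod_cast hK
  have hσ : ∀ k, (0 : ℝ) < σ k := fun k => NNReal.coe_pos.2 (hY.pos k)
  set g := (μ l - μ k) / σ k with hg
  have hg0 : 0 < g := div_pos (by linarith) (hσ k)
  obtain ⟨h, hgh, hρh⟩ : ∃ h, g < h ∧ ρ * infoM h < 1 := by
    have hcont : ContinuousAt (fun h => ρ * infoM h) g := by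
      unfold infoM
      have : (1 + g ^ 2) ≠ 0 := by positivity
      fun_prop (disch := assumption)
    have h1 : ∀ᶠ h in 𝓝[>] g, ρ * infoM h < 1 :=
      (hcont.mono_left nhdsWithin_le_nhds).eventually_lt_const hρ
    obtain ⟨h, h2, h3⟩ := (h1.and self_mem_nhdsWithin).exists
    exact ⟨h, h3, h2⟩
  set ε := (1 - ρ * infoM h) / (2 * ρ) with hε
  have hε0 : 0 < ε := div_pos (by linarith) (by positivity)
  set η := ρ * (infoM h + ε) with hη
  have hη1 : η < 1 := by
    have : ρ * ε = (1 - ρ * infoM h) / 2 := by rw [hε]; field_simp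
    rw [hη, mul_add, this]; linarith
  set β := (1 - η) / 2 with hβ
  have hβ0 : 0 < β := by rw [hβ]; linarith
  set x := (g + h) / 2 with hx
  have hx1 : g < x := by rw [hx]; linarith
  have hx2 : x < h := by rw [hx]; linarith
  have hx0 : 0 < x := hg0.trans hx1
  obtain ⟨δ₁, hδ₁, hT⟩ := exists_le_measureReal_vecT hx0.le hx2 hε0
  obtain ⟨δ₂, hδ₂, hδ₂le⟩ := exists_pos_forall_le (fun _ : Fin K => True)
    (f := fun z => δ₁ * σ z) fun z _ => mul_pos hδ₁ (hσ z)
  have hgap : 0 < x * σ k - (μ l - μ k) := by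
    rw [hg, div_lt_iff₀ (hσ k)] at hx1; linarith
  set δ := min δ₂ ((x * σ k - (μ l - μ k)) / 4) with hδdef
  have hδ : 0 < δ := lt_min hδ₂ (by positivity)
  have hδz : ∀ z, δ / σ z ≤ δ₁ := fun z => by
    rw [div_le_iff₀ (hσ z)]
    exact (min_le_left _ _).trans (hδ₂le z trivial)
  have hδg : 4 * δ ≤ x * σ k - (μ l - μ k) := by
    have : δ ≤ (x * σ k - (μ l - μ k)) / 4 := min_le_right _ _
    linarith
  obtain ⟨κ₂, hκ₂, D₂, hD₂, hk⟩ := hY.exists_measureReal_tStat_lt_le (k := k) (l := l) hx0 hδ hkl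
    (by linarith)
  obtain ⟨κ₃, hκ₃, hmean⟩ := hY.exists_mean_rate hδ
  refine ⟨δ, hδ, ?_⟩
  set α : ℝ := 1 / (2 * (2 : ℕ) * K : ℝ) with hα
  have hα0 : 0 < α := by positivity
  set D₃ : ℝ := 2 * K / (1 - Real.exp (-κ₃)) with hD₃
  have hD₃0 : 0 ≤ D₃ := by
    have : Real.exp (-κ₃) ≤ 1 := Real.exp_le_one_iff.2 (by linarith)
    exact div_nonneg (by positivity) (by linarith)
  set τ : ℝ := α / (4 * ρ) with hτ
  have hτ0 : 0 < τ := by positivity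
  have hr2 : Tendsto (fun r : ℕ => r / 2 - 1) atTop atTop := by
    refine tendsto_atTop.2 fun b => ?_
    filter_upwards [eventually_ge_atTop (2 * b + 2)] with R hR
    omega
  have hca : Tendsto (fun r : ℕ => c (r / 2 - 1)) atTop atTop := hc.tendsto.comp hr2
  have hlim : Tendsto (fun r : ℕ => D₃ * Real.exp (-(κ₃ * α) * r) +
      ((D₂ / (1 - Real.exp (-κ₂))) * Real.exp (-(κ₂ * c (r / 2 - 1))) +
        K * ρ * ((r : ℝ) ^ β * Real.exp (-(τ * (r : ℝ) ^ β))))) atTop (𝓝 0) := by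
    have h1 := (Real.tendsto_exp_neg_atTop_nhds_zero.comp
      (hca.const_mul_atTop hκ₂)).const_mul (D₂ / (1 - Real.exp (-κ₂)))
    have h2 := tendsto_const_mul_mul_exp_neg ((tendsto_rpow_atTop hβ0).comp
      (tendsto_natCast_atTop_atTop (R := ℝ))) hτ0 (K * ρ)
    have := (tendsto_const_mul_exp_neg (κ := κ₃ * α) (by positivity) D₃).add (h1.add h2)
    simpa using this
  refine squeeze_zero' (Eventually.of_forall fun R => by positivity) ?_ hlim
  obtain ⟨J, hJ⟩ := eventually_atTop.1 hT
  have hlogβ : ∀ᶠ r : ℕ in atTop, Real.log r ≤ (r : ℝ) ^ β := by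
    have := (isLittleO_log_rpow_atTop hβ0).bound one_pos
    filter_upwards [tendsto_natCast_atTop_atTop.eventually this,
      tendsto_log_natCast.eventually_gt_atTop 0] with r hr hr0
    rw [one_mul, Real.norm_of_nonneg hr0.le, Real.norm_of_nonneg (by positivity)] at hr
    exact hr
  have hlogsmall : ∀ᶠ r : ℕ in atTop, 2 * (ρ * Real.log r) ≤ α * r := by
    have := (tendsto_log_div_natCast).eventually_le_const (u := α / (2 * ρ)) (by positivity)
    filter_upwards [this, eventually_gt_atTop 0] with R hR hR0
    have hR0' : (0 : ℝ) < R := by exact_mod_cast hR0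
    rw [div_le_div_iff₀ hR0' (by positivity)] at hR
    linarith
  filter_upwards [eventually_le_leastLead hK two_pos, hca.eventually_ge_atTop (J + 1), hlogβ,
    hlogsmall, tendsto_log_natCast.eventually_gt_atTop 0, eventually_ge_atTop 1]
    with r hur har hlogr hsm hlog hr1
  rw [← hα] at hur
  have hr0 : (0 : ℝ) < r := by exact_mod_cast hr1
  set a := c (r / 2 - 1) with ha
  set u := leastLead K (r / 2) with hu
  set m := ⌊ρ * Real.log r⌋₊ with hm
  have hu0 : (0 : ℝ) < u := lt_of_lt_of_le (by positivity) hur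
  have hune : u ≠ 0 := by rintro h; rw [h] at hu0; simp at hu0
  have ha0 : 0 < a := by linarith [Nat.cast_nonneg (α := ℝ) J]
  have hmle : (m : ℝ) ≤ ρ * Real.log r := Nat.floor_le (by positivity)
  refine add_le_add ((measureReal_inaccurate_le (P := P) hκ₃ hmean hune r).trans ?_) ?_
  · rw [← hD₃]
    gcongr D₃ * Real.exp ?_
    have := mul_le_mul_of_nonneg_left hur hκ₃.le
    linarith
  refine (measureReal_hindered_le hl hκ₂ hD₂.le ha0 hk (q := Real.exp (-(τ * (r : ℝ) ^ β)))
    (fun z j haj hjm => ?_) (Real.exp_pos _).le).trans ?_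
  · have hjJ : J ≤ j := by
      have : (J : ℝ) ≤ j := by linarith
      exact_mod_cast this
    have hj : j ≠ 0 := by
      rintro rfl
      simp only [Nat.cast_zero] at haj
      linarith
    have hj2 : (j : ℝ) ≤ ρ * Real.log r := le_trans (by exact_mod_cast hjm.le) hmle
    refine hY.measureReal_no_block_le_exp_rpow (ν := infoM h + ε) hj hr1
      (by have := infoM_pos (g := h) (by linarith); linarith) hρ0 hα0.le hβ ?_ hj2 hlogr hur
      (hsm.trans hur)
    refine (hJ j hjJ).trans (measureReal_mono fun y hy => ?_)
    have e2 : (μ z - δ - μ z) / σ z = -(δ / σ z) := by ring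
    rw [e2]
    exact (vecT_anti y (neg_le_neg (hδz z))).trans hy
  · refine add_le_add le_rfl ?_
    rw [mul_assoc (K : ℝ), ← mul_assoc ρ]
    gcongr
    exact hmle.trans (by gcongr)

end IsNormalRewards

end

noncomputable section

section Measurability

open scoped Classical

/-! ### Measurability of the procedure -/

variable {Ω : Type*} [MeasurableSpace Ω] {K : ℕ} {c : ℕ → ℝ}

/-- A countably valued choice among measurable events is measurable. -/
lemma measurable_pred_comp {α : Type*} [Countable α] {X : Ω → α} {Q : α → Ω → Prop}
    (hX : ∀ v, Measurable fun ω => X ω = v) (hQ : ∀ v, Measurable (Q v)) :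
    Measurable fun ω => Q (X ω) ω := by
  have h : (fun ω => Q (X ω) ω) = fun ω => ∃ v, X ω = v ∧ Q v ω := by
    ext ω; simp
  rw [h]
  exact Measurable.exists fun v => (hX v).and (hQ v)

instance : Countable (State K) :=
  Function.Injective.countable (f := fun s : State K => (s.count, s.prev))
    (by rintro ⟨_, _⟩ ⟨_, _⟩ h; simpa using h)

/-- A random set of arms has measurable level sets if all its inclusion events are measurable. -/
lemma measurable_finset_eq {X : Ω → Finset (Fin K)} (h : ∀ k, Measurable fun ω => k ∈ X ω)
    (S : Finset (Fin K)) : Measurable fun ω => X ω = S := by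
  simp only [Finset.ext_iff]
  exact Measurable.forall fun k => (h k).iff measurable_const

variable {Y : Fin K → ℕ → Ω → ℝ}

lemma measurable_blockMean (hY : ∀ k t, Measurable (Y k t)) (k : Fin K) (s m : ℕ) :
    Measurable fun ω => blockMean (fun t => Y k t ω) s m := by
  unfold blockMean
  fun_prop

lemma measurable_tStat (hY : ∀ k t, Measurable (Y k t)) (k : Fin K) (s m : ℕ) {a : Ω → ℝ}
    (ha : Measurable a) : Measurable fun ω => tStat (fun t => Y k t ω) s m (a ω) := by
  have := measurable_blockMean hY k s m
  unfold tStat blockSd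
  fun_prop

lemma measurable_le_pred {f g : Ω → ℝ} (hf : Measurable f) (hg : Measurable g) :
    Measurable fun ω => f ω ≤ g ω := measurableSet_setOfPred.1 (measurableSet_le hf hg)

lemma measurable_candidates_eq (hY : ∀ k t, Measurable (Y k t)) (n : Fin K → ℕ)
    (S : Finset (Fin K)) : Measurable fun ω => candidates (fun j t => Y j t ω) n = S := by
  refine measurable_finset_eq (fun k => ?_) S
  simp only [candidates, Finset.mem_filter]
  refine measurable_const.and (Measurable.forall fun j => Measurable.imp measurable_const ?_)
  exact measurable_le_pred (measurable_blockMean hY _ _ _) (measurable_blockMean hY _ _ _)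

lemma measurable_leader_eq (hY : ∀ k t, Measurable (Y k t)) {p : Finset (Fin K) → Ω → Fin K}
    (hp : ∀ S k, Measurable fun ω => p S ω = k) (n : Fin K → ℕ) (prev : Option (Fin K))
    (k : Fin K) :
    Measurable fun ω => leader (fun j t => Y j t ω) (fun S => p S ω) n prev = k := by
  refine measurable_pred_comp (X := fun ω => candidates (fun j t => Y j t ω) n)
    (Q := fun S ω => (match prev with
      | none => p S ω
      | some z => if z ∈ S then z else p S ω) = k) (measurable_candidates_eq hY n) fun S => ?_
  cases prev with
  | none => exact hp S k
  | some z =>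
    by_cases hz : z ∈ S
    · simp only [hz, if_true]; exact measurable_const
    · simp only [hz, if_false]; exact hp S k

lemma measurable_winsChallenge (hY : ∀ k t, Measurable (Y k t)) (n : Fin K → ℕ) (z k : Fin K) :
    Measurable fun ω => WinsChallenge c (fun j t => Y j t ω) n z k := by
  have hm := measurable_blockMean hY
  unfold WinsChallenge
  refine measurable_const.and (measurable_const.or
    ((measurable_le_pred (hm _ _ _) (hm _ _ _)).or (Measurable.exists fun s =>
      measurable_const.and ?_)))
  exact measurable_le_pred (measurable_tStat hY _ _ _ (hm _ _ _))
    (measurable_tStat hY _ _ _ (hm _ _ _))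

lemma measurable_sampled_eq (hY : ∀ k t, Measurable (Y k t)) (n : Fin K → ℕ) (z : Fin K)
    (S : Finset (Fin K)) : Measurable fun ω => sampled c (fun j t => Y j t ω) n z = S := by
  refine measurable_pred_comp (X := fun ω => winners c (fun j t => Y j t ω) n z)
    (Q := fun W _ => (if W = ∅ then {z} else W) = S) (measurable_finset_eq fun k => ?_)
    fun _ => measurable_const
  simp only [mem_winners]
  exact measurable_winsChallenge hY n z k

lemma measurable_sampledAt_eq (hY : ∀ k t, Measurable (Y k t)) {p : Finset (Fin K) → Ω → Fin K}
    (hp : ∀ S k, Measurable fun ω => p S ω = k) (s : State K) (S : Finset (Fin K)) :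
    Measurable fun ω => sampledAt c (fun j t => Y j t ω) (fun S => p S ω) s = S :=
  measurable_pred_comp (Q := fun z ω => sampled c (fun j t => Y j t ω) s.count z = S)
    (measurable_leader_eq hY hp s.count s.prev) fun z => measurable_sampled_eq hY s.count z S

variable {pick : ℕ → Finset (Fin K) → Ω → Fin K}

lemma measurable_state_eq (hY : ∀ k t, Measurable (Y k t))
    (hp : ∀ r S k, Measurable fun ω => pick r S ω = k) (r : ℕ) (s : State K) :
    Measurable fun ω => state c (fun j t => Y j t ω) (fun q S => pick q S ω) r = s := by
  induction r using Nat.strong_induction_on generalizing s with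
  | _ r ih =>
    match r with
    | 0 => simp only [state]; exact measurable_const
    | 1 => simp only [state]; exact measurable_const
    | 2 => simp only [state]; exact measurable_const
    | r + 3 =>
      refine measurable_pred_comp
        (X := fun ω => state c (fun j t => Y j t ω) (fun q S => pick q S ω) (r + 2))
        (Q := fun s' ω => (⟨fun k => s'.count k +
          if k ∈ sampledAt c (fun j t => Y j t ω) (fun S => pick (r + 2) S ω) s' then 1 else 0,
          some (leader (fun j t => Y j t ω) (fun S => pick (r + 2) S ω) s'.count s'.prev)⟩ :
            State K) = s) (ih (r + 2) (by omega)) fun s' => ?_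
      refine measurable_pred_comp
        (X := fun ω => sampledAt c (fun j t => Y j t ω) (fun S => pick (r + 2) S ω) s')
        (Q := fun S ω => (⟨fun k => s'.count k + if k ∈ S then 1 else 0,
          some (leader (fun j t => Y j t ω) (fun S => pick (r + 2) S ω) s'.count s'.prev)⟩ :
            State K) = s) (measurable_sampledAt_eq hY (hp _) s') fun S => ?_
      exact measurable_pred_comp
        (Q := fun z _ => (⟨fun k => s'.count k + if k ∈ S then 1 else 0, some z⟩ : State K) = s)
        (measurable_leader_eq hY (hp _) s'.count s'.prev) fun z => measurable_const

lemma measurable_count (hY : ∀ k t, Measurable (Y k t))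
    (hp : ∀ r S k, Measurable fun ω => pick r S ω = k) (r : ℕ) (k : Fin K) :
    Measurable fun ω => count c (fun j t => Y j t ω) (fun q S => pick q S ω) r k :=
  measurable_to_countable' fun n => measurableSet_setOfPred.2 <|
    measurable_pred_comp (Q := fun s _ => s.count k ∈ ({n} : Set ℕ)) (measurable_state_eq hY hp r)
      fun _ => measurable_const

lemma measurable_total (hY : ∀ k t, Measurable (Y k t))
    (hp : ∀ r S k, Measurable fun ω => pick r S ω = k) (r : ℕ) :
    Measurable fun ω => total c (fun j t => Y j t ω) (fun q S => pick q S ω) r :=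
  Finset.measurable_fun_sum _ fun k _ => measurable_count hY hp r k

lemma measurable_lastRound (hY : ∀ k t, Measurable (Y k t))
    (hp : ∀ r S k, Measurable fun ω => pick r S ω = k) (N : ℕ) :
    Measurable fun ω => lastRound c (fun j t => Y j t ω) (fun q S => pick q S ω) N :=
  measurable_findGreatest fun r _ => measurableSet_le (measurable_total hY hp r) measurable_const

lemma measurable_recommended_eq (hY : ∀ k t, Measurable (Y k t))
    (hp : ∀ r S k, Measurable fun ω => pick r S ω = k) (r : ℕ) (S : Finset (Fin K)) :
    Measurable fun ω => recommended c (fun j t => Y j t ω) (fun q S => pick q S ω) r = S := by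
  unfold recommended
  by_cases hr : r ≤ 1
  · simp only [hr, if_true]; exact measurable_const
  · simp only [hr, if_false]
    exact measurable_pred_comp
      (Q := fun s ω => sampledAt c (fun j t => Y j t ω) (fun S => pick r S ω) s = S)
      (measurable_state_eq hY hp r) fun s => measurable_sampledAt_eq hY (hp r) s S

lemma measurable_allocation (hY : ∀ k t, Measurable (Y k t))
    (hp : ∀ r S k, Measurable fun ω => pick r S ω = k)
    {sub : ℕ → Finset (Fin K) → ℕ → Ω → Finset (Fin K)}
    (hs : ∀ r S m T, Measurable fun ω => sub r S m ω = T) (N : ℕ) (k : Fin K) :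
    Measurable fun ω => allocation c (fun j t => Y j t ω) (fun q S => pick q S ω)
      (fun q S m => sub q S m ω) N k := by
  have hn : ∀ {f : Ω → ℕ}, Measurable f → ∀ v, Measurable fun ω => f ω = v := fun hf v =>
    measurableSet_setOfPred.1 (hf (measurableSet_singleton v))
  refine measurable_to_countable' fun n => measurableSet_setOfPred.2 ?_
  refine measurable_pred_comp (Q := fun r ω => (count c (fun j t => Y j t ω)
    (fun q S => pick q S ω) r k + if total c (fun j t => Y j t ω) (fun q S => pick q S ω) r < N ∧
      k ∈ sub r (recommended c (fun j t => Y j t ω) (fun q S => pick q S ω) r)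
        (N - total c (fun j t => Y j t ω) (fun q S => pick q S ω) r) ω then 1 else 0) = n)
    (hn (measurable_lastRound hY hp N)) fun r => ?_
  refine measurable_pred_comp (Q := fun a ω => (a + if total c (fun j t => Y j t ω)
    (fun q S => pick q S ω) r < N ∧
      k ∈ sub r (recommended c (fun j t => Y j t ω) (fun q S => pick q S ω) r)
        (N - total c (fun j t => Y j t ω) (fun q S => pick q S ω) r) ω then 1 else 0) = n)
    (hn (measurable_count hY hp r k)) fun a => ?_
  refine measurable_pred_comp (Q := fun t ω => (a + if t < N ∧
      k ∈ sub r (recommended c (fun j t => Y j t ω) (fun q S => pick q S ω) r)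
        (N - t) ω then 1 else 0) = n) (hn (measurable_total hY hp r)) fun t => ?_
  refine measurable_pred_comp (Q := fun S ω => (a + if t < N ∧ k ∈ sub r S (N - t) ω
    then 1 else 0) = n) (measurable_recommended_eq hY hp r) fun S => ?_
  exact measurable_pred_comp (Q := fun T _ => (a + if t < N ∧ k ∈ T then 1 else 0) = n)
    (hs r S (N - t)) fun T => measurable_const

end Measurability

end

noncomputable section

variable {Ω : Type*} [MeasurableSpace Ω] {P : Measure Ω}
variable {K : ℕ} {c : ℕ → ℝ} {μ : Fin K → ℝ} {σ : Fin K → ℝ≥0} {Y : Fin K → ℕ → Ω → ℝ}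
variable {pick : ℕ → Finset (Fin K) → Ω → Fin K}
variable {sub : ℕ → Finset (Fin K) → ℕ → Ω → Finset (Fin K)}

/-! ### Expected numbers of observations -/

lemma IsUniformRandomization.measurable_pick (hrand : IsUniformRandomization P Y pick sub) :
    ∀ r S k, Measurable fun ω => pick r S ω = k := fun r S k =>
  measurableSet_setOfPred.1 (hrand.measurableSet_pick r S k)

variable [IsProbabilityMeasure P]

/-- A uniformly drawn arm almost surely belongs to the set from which it is drawn. -/
lemma IsUniformRandomization.ae_pick_mem (hrand : IsUniformRandomization P Y pick sub) :
    ∀ᵐ ω ∂P, ∀ r (S : Finset (Fin K)), S.Nonempty → pick r S ω ∈ S := by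
  refine ae_all_iff.2 fun r => ae_all_iff.2 fun S => ?_
  by_cases hS : S.Nonempty
  swap
  · exact Eventually.of_forall fun ω h => absurd h hS
  have hm : MeasurableSet {ω | pick r S ω ∈ S} := by
    have h1 : {ω | pick r S ω ∈ S} = ⋃ k ∈ S, {ω | pick r S ω = k} := by
      ext ω; simp
    rw [h1]
    exact Finset.measurableSet_biUnion _ fun k _ => hrand.measurableSet_pick r S k
  have hP : P {ω | pick r S ω ∈ S} = 1 := by
    have h1 : {ω | pick r S ω ∈ S} = ⋃ k ∈ S, {ω | pick r S ω = k} := by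
      ext ω; simp
    rw [h1, measure_biUnion_finset]
    · rw [Finset.sum_congr rfl fun k hk => hrand.pick_uniform r S k hk, Finset.sum_const,
        nsmul_eq_mul]
      exact ENNReal.mul_inv_cancel (by simpa using hS.ne_empty) (ENNReal.natCast_ne_top _)
    · intro i _ j _ hij
      refine Set.disjoint_left.2 fun ω h1 h2 => hij ?_
      exact Eq.trans (Eq.symm h1) h2
    · exact fun k _ => hrand.measurableSet_pick r S k
  filter_upwards [(prob_compl_eq_zero_iff hm).2 hP] with ω hω _ using hω

/-- The event that the leader of round `r` is not as good as arm `l`. -/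
def inferiorLead (c : ℕ → ℝ) (μ : Fin K → ℝ) (Y : Fin K → ℕ → Ω → ℝ)
    (pick : ℕ → Finset (Fin K) → Ω → Fin K) (l : Fin K) (r : ℕ) : Set Ω :=
  {ω | μ (leaderAt c (fun j t => Y j t ω) (fun q S => pick q S ω) r) ≠ μ l}

lemma measurableSet_inferiorLead (hY : ∀ k t, Measurable (Y k t))
    (hp : ∀ r S k, Measurable fun ω => pick r S ω = k) (l : Fin K) (r : ℕ) :
    MeasurableSet (inferiorLead c μ Y pick l r) := by
  refine measurableSet_setOfPred.2 ?_
  refine measurable_pred_comp (Q := fun z _ => μ z ≠ μ l) (fun v => ?_) fun _ => measurable_const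
  exact measurable_pred_comp
    (Q := fun s ω => leader (fun j t => Y j t ω) (fun S => pick r S ω) s.count s.prev = v)
    (measurable_state_eq hY hp r) fun s => measurable_leader_eq hY (hp r) s.count s.prev v

lemma measurableSet_upset (hY : ∀ k t, Measurable (Y k t)) (k l : Fin K) (R j : ℕ) :
    MeasurableSet (upset μ Y k l R j) := by
  have hm := measurable_blockMean hY
  refine measurableSet_setOfPred.2 ?_
  refine Measurable.exists fun z => measurable_const.and (Measurable.exists fun n =>
    measurable_const.and (measurable_const.and ((measurable_le_pred (hm _ _ _) (hm _ _ _)).or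
      (Measurable.exists fun s => measurable_const.and ?_))))
  exact measurable_le_pred (measurable_tStat hY _ _ _ (hm _ _ _))
    (measurable_tStat hY _ _ _ (hm _ _ _))

lemma integrable_count (hY : ∀ k t, Measurable (Y k t))
    (hp : ∀ r S k, Measurable fun ω => pick r S ω = k) (r : ℕ) (k : Fin K) :
    Integrable (fun ω => (count c (fun j t => Y j t ω) (fun q S => pick q S ω) r k : ℝ)) P := by
  refine Integrable.of_bound (C := r)
    (measurable_from_top.comp (measurable_count hY hp r k)).aestronglyMeasurable
    (Eventually.of_forall fun ω => ?_)
  rw [Real.norm_of_nonneg (Nat.cast_nonneg _)]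
  exact_mod_cast (count_le r k).trans (Nat.sub_le _ _)

namespace IsNormalRewards

/-- The leader is inferior with probability `o(1 / r)`. -/
lemma tendsto_mul_measureReal_inferiorLead (hY : IsNormalRewards P μ σ Y)
    (hc : IsSamplingThreshold c) (hrand : IsUniformRandomization P Y pick sub) {l : Fin K}
    (hl : ∀ z, μ z ≤ μ l) :
    Tendsto (fun r : ℕ => (r : ℝ) * P.real (inferiorLead c μ Y pick l r)) atTop (𝓝 0) := by
  have : Nonempty (Fin K) := ⟨l⟩
  obtain ⟨δ, hδ, hsep, hlim⟩ := hY.tendsto_mul_measureReal_blocked hc l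
  refine squeeze_zero' (Eventually.of_forall fun R => by positivity) ?_ hlim
  filter_upwards [eventually_ge_atTop 6] with R hR
  refine mul_le_mul_of_nonneg_left ?_ (Nat.cast_nonneg R)
  refine le_trans ?_ (measureReal_union_le _ _)
  refine ENNReal.toReal_mono (measure_ne_top _ _) (measure_mono_ae ?_)
  filter_upwards [hrand.ae_pick_mem] with ω hp hω
  by_contra hcon
  have hcon : ω ∉ inaccurate μ Y δ (leastLead K (R / 3)) R ∪
    blocked μ Y δ (c (R / 3 - 1)) (leastLead K (R / 3)) l := hcon
  simp only [Set.mem_union, not_or] at hcon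
  refine hω (leader_optimal (r₀ := R / 3) (δ := δ) (u₀ := leastLead K (R / 3)) hp hc.monotone hsep
    (by omega) (mul_leastLead_add_one_le K (by omega)) (by omega) (fun k u h1 h2 => ?_) hl
    fun z hz j hj hcj => ?_)
  · by_contra! h
    exact hcon.1 ⟨k, u, h1, h2, h⟩
  · by_contra! h
    exact hcon.2 ⟨z, hz, j, hj, hcj, h.1, h.2⟩

lemma sum_measureReal_inferiorLead_isLittleO (hY : IsNormalRewards P μ σ Y)
    (hc : IsSamplingThreshold c) (hrand : IsUniformRandomization P Y pick sub) {l : Fin K}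
    (hl : ∀ z, μ z ≤ μ l) :
    (fun R : ℕ => ∑ r ∈ Finset.range R, P.real (inferiorLead c μ Y pick l r)) =o[atTop]
      fun R : ℕ => Real.log R := by
  have h1 : (fun r : ℕ => P.real (inferiorLead c μ Y pick l r)) =o[atTop]
      fun r : ℕ => 1 / ((r : ℝ) + 1) := by
    refine isLittleO_of_tendsto (fun r h => absurd h (by positivity)) ?_
    have h2 := (hY.tendsto_mul_measureReal_inferiorLead hc hrand hl).const_mul 2
    rw [mul_zero] at h2
    refine squeeze_zero' (Eventually.of_forall fun R => by positivity) ?_ h2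
    filter_upwards [eventually_ge_atTop 1] with R hR
    have hR' : (1 : ℝ) ≤ R := by exact_mod_cast hR
    rw [div_div_eq_mul_div, div_one, mul_comm, ← mul_assoc]
    exact mul_le_mul_of_nonneg_right (by linarith) measureReal_nonneg
  refine (h1.sum_range (fun r => by positivity)
    Real.tendsto_sum_range_one_div_nat_succ_atTop).trans_isBigO ?_
  refine IsBigO.of_bound 2 ?_
  filter_upwards [tendsto_log_natCast.eventually_ge_atTop 1] with R hR
  rw [Real.norm_of_nonneg (by positivity), Real.norm_of_nonneg (by linarith)]
  have h3 := harmonic_le_one_add_log R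
  have h4 : ((harmonic R : ℚ) : ℝ) = ∑ i ∈ Finset.range R, 1 / ((i : ℝ) + 1) := by
    simp [harmonic]
  linarith

/-- Expectation of the pathwise bound for the number of observations from an inferior arm. -/
lemma expectedCount_le (hY : IsNormalRewards P μ σ Y) (hc : IsSamplingThreshold c)
    (hrand : IsUniformRandomization P Y pick sub) {k l : Fin K} (hkl : μ k < μ l) {m R : ℕ}
    (hm : 1 ≤ m) (hcR : c (K * R) ≤ m) :
    expectedCount P c Y pick R k ≤ m +
      ∑ r ∈ Finset.range R, P.real (inferiorLead c μ Y pick l r) +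
      ∑ j ∈ Finset.Ico m R, P.real (upset μ Y k l R j) := by
  classical
  have hA := fun r => measurableSet_inferiorLead (c := c) (μ := μ) hY.meas hrand.measurable_pick l r
  have hU := fun j => measurableSet_upset (μ := μ) hY.meas k l R j
  have iA : ∀ r ∈ Finset.range R,
      Integrable ((inferiorLead c μ Y pick l r).indicator (1 : Ω → ℝ)) P := fun r _ =>
    (integrable_const (1 : ℝ)).indicator (hA r)
  have iU : ∀ j ∈ Finset.Ico m R, Integrable ((upset μ Y k l R j).indicator (1 : Ω → ℝ)) P :=
    fun j _ => (integrable_const (1 : ℝ)).indicator (hU j)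
  have iA' := integrable_finsetSum _ iA
  have iU' := integrable_finsetSum _ iU
  calc expectedCount P c Y pick R k
      ≤ ∫ ω, ((m : ℝ) + ∑ r ∈ Finset.range R, (inferiorLead c μ Y pick l r).indicator 1 ω +
          ∑ j ∈ Finset.Ico m R, (upset μ Y k l R j).indicator 1 ω) ∂P := by
        refine integral_mono (integrable_count hY.meas hrand.measurable_pick R k)
          (((integrable_const _).add iA').add iU') fun ω => ?_
        set y : Fin K → ℕ → ℝ := fun j t => Y j t ω with hy
        have h1 := count_le_add (c := c) (y := y) (pick := fun q S => pick q S ω) (R := R) hkl hm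
          (fun j => ω ∈ upset μ Y k l R j) hc.monotone hcR
          (fun z hz j n _ hjn hnR h => ⟨z, hz, n, hjn, hnR, h⟩) R le_rfl
        have h2 : (Finset.range (count c y (fun q S => pick q S ω) R k)).sum
            (fun j => if m ≤ j ∧ ω ∈ upset μ Y k l R j then 1 else 0) ≤
            ∑ j ∈ Finset.Ico m R, if ω ∈ upset μ Y k l R j then 1 else 0 := by
          rw [← Finset.sum_filter_add_sum_filter_not _ (fun j => m ≤ j)]
          have e2 : ∀ S : Finset ℕ, ∑ j ∈ S with ¬ m ≤ j,
              (if m ≤ j ∧ ω ∈ upset μ Y k l R j then 1 else 0) = 0 := fun S =>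
            Finset.sum_eq_zero fun j hj => if_neg fun h => (Finset.mem_filter.1 hj).2 h.1
          rw [e2, add_zero]
          refine (Finset.sum_le_sum fun j hj => ?_).trans
            (Finset.sum_le_sum_of_subset fun j hj => ?_)
          · simp only [(Finset.mem_filter.1 hj).2, true_and, le_refl]
          · have h3 := Finset.mem_filter.1 hj
            have h4 := Finset.mem_range.1 h3.1
            have h5 := count_le (c := c) (y := y) (pick := fun q S => pick q S ω) R k
            exact Finset.mem_Ico.2 ⟨h3.2, by omega⟩
        have h3 : (Finset.range R).sum (fun s => if μ (leaderAt c y (fun q S => pick q S ω) s) = μ l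
            then 0 else 1) = ∑ s ∈ Finset.range R,
              if ω ∈ inferiorLead c μ Y pick l s then 1 else 0 := by
          refine Finset.sum_congr rfl fun s _ => ?_
          rw [← ite_not]
          exact if_congr Iff.rfl rfl rfl
        have h4 := h1.trans (Nat.add_le_add_left h2 _)
        rw [h3] at h4
        simp only [Set.indicator_apply, Pi.one_apply]
        exact_mod_cast h4
    _ = _ := by
        have e1 := integral_add ((integrable_const (m : ℝ)).add iA') iU'
        have e2 := integral_add (integrable_const (m : ℝ)) iA'
        simp only [Pi.add_apply] at e1
        rw [e1, e2, integral_finsetSum _ iA, integral_finsetSum _ iU]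
        simp only [integral_const, probReal_univ, one_smul]
        congr 1
        · congr 1
          exact Finset.sum_congr rfl fun r _ => integral_indicator_one (hA r)
        · exact Finset.sum_congr rfl fun j _ => integral_indicator_one (hU j)

lemma eventually_expectedCount_le (hY : IsNormalRewards P μ σ Y) (hc : IsSamplingThreshold c)
    (hrand : IsUniformRandomization P Y pick sub) {k l : Fin K} (hl : ∀ z, μ z ≤ μ l)
    (hkl : μ k < μ l) {x : ℝ} (hx : 1 / infoM ((μ l - μ k) / σ k) < x) :
    ∀ᶠ r : ℕ in atTop, expectedCount P c Y pick r k ≤ x * Real.log r := by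
  have hK : 0 < K := Fin.pos_iff_nonempty.2 ⟨l⟩
  set g := (μ l - μ k) / σ k with hg
  have hg0 : 0 < g := div_pos (by linarith) (NNReal.coe_pos.2 (hY.pos k))
  obtain ⟨h, h0, hh, hhx⟩ : ∃ h, 0 < h ∧ h < g ∧ 1 / infoM h < x := by
    have hcont : ContinuousAt (fun h => 1 / infoM h) g := by
      have h1 := (infoM_pos hg0.ne').ne'
      unfold infoM at *
      have : (1 + g ^ 2) ≠ 0 := by positivity
      fun_prop (disch := assumption)
    have h1 : ∀ᶠ h in 𝓝[<] g, 1 / infoM h < x :=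
      (hcont.mono_left nhdsWithin_le_nhds).eventually_lt_const hx
    obtain ⟨h, h2, h3⟩ := (h1.and (Ioo_mem_nhdsLT hg0)).exists
    exact ⟨h, h3.1, h3.2, h2⟩
  have hM : 0 < infoM h := infoM_pos h0.ne'
  obtain ⟨C, hC⟩ := hY.exists_sum_measureReal_upset_le hkl h0 hh
  set ε := (x - 1 / infoM h) / 2 with hε
  have hε0 : 0 < ε := by rw [hε]; linarith
  have hcK : ∀ᶠ r : ℕ in atTop, c (K * r) ≤ Real.log r / infoM h := by
    have hKr : Tendsto (fun r : ℕ => K * r) atTop atTop := tendsto_id.const_mul_atTop' hK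
    have h1 := hKr.eventually (hc.isLittleO_log.bound (c := 1 / (2 * infoM h)) (by positivity))
    filter_upwards [h1, eventually_ge_atTop K, eventually_ge_atTop 1] with r hr hrK hr1
    have hr0 : (0 : ℝ) < r := by exact_mod_cast hr1
    have hK0 : (0 : ℝ) < K := by exact_mod_cast hK
    have h3 : Real.log ((K * r : ℕ) : ℝ) ≤ 2 * Real.log r := by
      push_cast
      rw [Real.log_mul hK0.ne' hr0.ne']
      have := Real.log_le_log hK0 (by exact_mod_cast hrK : (K : ℝ) ≤ r)
      linarith
    rw [Real.norm_of_nonneg (hc.nonneg _), Real.norm_of_nonneg (Real.log_natCast_nonneg _)] at hr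
    calc c (K * r) ≤ 1 / (2 * infoM h) * Real.log ((K * r : ℕ) : ℝ) := hr
      _ ≤ 1 / (2 * infoM h) * (2 * Real.log r) := by gcongr
      _ = _ := by field_simp
  have hlead := (hY.sum_measureReal_inferiorLead_isLittleO hc hrand hl).bound hε0
  filter_upwards [hcK, hlead, tendsto_log_natCast.eventually_ge_atTop ((C + 1) / ε),
    tendsto_log_natCast.eventually_gt_atTop 0, eventually_ge_atTop 1] with r hcr hlr hCr hlog hr1
  rw [Real.norm_of_nonneg (Finset.sum_nonneg fun _ _ => measureReal_nonneg),
    Real.norm_of_nonneg hlog.le] at hlr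
  rw [div_le_iff₀ hε0] at hCr
  set m := ⌈Real.log r / infoM h⌉₊ with hm
  have hm1 : 1 ≤ m := Nat.one_le_ceil_iff.2 (by positivity)
  have hm2 : Real.log r / infoM h ≤ m := Nat.le_ceil _
  have hm3 : (m : ℝ) < Real.log r / infoM h + 1 := Nat.ceil_lt_add_one (by positivity)
  have h1 := hY.expectedCount_le hc hrand hkl hm1 (hcr.trans hm2)
  have h2 := hC r m hr1 hm1 hm2
  have h3 : x * Real.log r = Real.log r / infoM h + 2 * (Real.log r * ε) := by
    rw [hε]; ring
  linarith

lemma eventually_le_expectedCount (hY : IsNormalRewards P μ σ Y) (hc : IsSamplingThreshold c)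
    (hrand : IsUniformRandomization P Y pick sub) {k l : Fin K} (hl : ∀ z, μ z ≤ μ l)
    (hkl : μ k < μ l) {x : ℝ} (hx : x < 1 / infoM ((μ l - μ k) / σ k)) :
    ∀ᶠ r : ℕ in atTop, x * Real.log r ≤ expectedCount P c Y pick r k := by
  have : Nonempty (Fin K) := ⟨l⟩
  have hK : 0 < K := Fin.pos_iff_nonempty.2 ⟨l⟩
  have hM : 0 < infoM ((μ l - μ k) / σ k) :=
    infoM_pos (div_pos (by linarith) (NNReal.coe_pos.2 (hY.pos k))).ne'
  obtain ⟨ρ, hρ1, hρ2⟩ := exists_between (max_lt hx (one_div_pos.2 hM))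
  have hρ0 : 0 < ρ := (le_max_right _ _).trans_lt hρ1
  have hxρ : x < ρ := (le_max_left _ _).trans_lt hρ1
  obtain ⟨δ, hδ, hlim⟩ := hY.exists_tendsto_measureReal_hindered hc hl hkl hρ0
    ((lt_div_iff₀ hM).1 hρ2)
  have hlogsmall : ∀ᶠ r : ℕ in atTop, ρ * Real.log r ≤ 1 / (2 * (2 : ℕ) * K : ℝ) * r := by
    have := (tendsto_log_div_natCast).eventually_le_const
      (u := 1 / (2 * (2 : ℕ) * K : ℝ) / ρ) (by positivity)
    filter_upwards [this, eventually_gt_atTop 0] with R hR hR0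
    have hR0' : (0 : ℝ) < R := by exact_mod_cast hR0
    rw [div_le_div_iff₀ hR0' hρ0] at hR
    linarith
  set ε := (ρ - x) / (4 * ρ) with hε
  have hε0 : 0 < ε := div_pos (by linarith) (by positivity)
  filter_upwards [hlim.eventually_le_const hε0, hlogsmall, eventually_le_leastLead hK two_pos,
    eventually_ge_atTop 4, tendsto_log_natCast.eventually_ge_atTop (2 / (ρ - x)),
    tendsto_log_natCast.eventually_gt_atTop 0] with r hPr hsm hur hr4 hlog hlog0
  set u := leastLead K (r / 2) with hu
  set m := ⌊ρ * Real.log r⌋₊ with hm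
  have hmle : (m : ℝ) ≤ ρ * Real.log r := Nat.floor_le (by positivity)
  have hmu : m ≤ u := by
    have : (m : ℝ) ≤ u := hmle.trans (hsm.trans hur)
    exact_mod_cast this
  have hur2 : u ≤ r / 2 := leastLead_le K _
  set B : Set Ω := inaccurate μ Y δ u r ∪ hindered μ Y δ (c (r / 2 - 1)) u m k with hB
  have hPB : P.real B ≤ ε := (measureReal_union_le _ _).trans hPr
  -- A measurable superset of the exceptional event, so that its indicator can be integrated.
  set T := toMeasurable P B with hT
  have hTm : MeasurableSet T := measurableSet_toMeasurable P B
  have hPT : P.real T ≤ ε := by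
    rw [measureReal_def, hT, measure_toMeasurable]; exact hPB
  have hTi : Integrable (T.indicator (1 : Ω → ℝ)) P := (integrable_const (1 : ℝ)).indicator hTm
  have hle : ∫ ω, ((m : ℝ) - m * T.indicator 1 ω) ∂P ≤ expectedCount P c Y pick r k := by
    refine integral_mono_ae ((integrable_const _).sub (hTi.const_mul _))
      (integrable_count hY.meas hrand.measurable_pick r k) ?_
    filter_upwards [hrand.ae_pick_mem] with ω hp
    by_cases hω : ω ∈ T
    · simp [hω]
    simp only [Set.indicator_of_notMem hω, mul_zero, sub_zero, Nat.cast_le]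
    have hωB : ω ∉ B := fun h => hω (subset_toMeasurable P B h)
    simp only [hB, Set.mem_union, not_or] at hωB
    refine le_trans ?_ (count_mono k (show r / 2 + m ≤ r by omega))
    refine le_count_of_blocks (r₀ := r / 2) (u₀ := u) (δ := δ) (μ := μ) hp hc.monotone (by omega)
      (mul_leastLead_add_one_le K (by omega)) hmu (fun k' n h1 h2 => ?_) fun z hz j hj hcj => ?_
    · by_contra! h
      exact hωB.1 ⟨k', n, h1, by omega, h⟩
    · by_contra! h
      exact hωB.2 ⟨z, hz, j, hj, hcj, h⟩
  rw [integral_sub (integrable_const _) (hTi.const_mul _),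
    integral_const_mul, integral_indicator_one hTm, integral_const, probReal_univ, one_smul] at hle
  refine le_trans ?_ hle
  have hm2 : ρ * Real.log r < m + 1 := Nat.lt_floor_add_one _
  have h1 : (m : ℝ) * P.real T ≤ ρ * Real.log r * ε := by gcongr
  have h2 : ρ * Real.log r * ε = (ρ - x) * Real.log r / 4 := by rw [hε]; field_simp
  rw [div_le_iff₀ (by linarith)] at hlog
  linarith

/-- The numbers of observations from inferior arms are asymptotically optimal. -/
lemma tendsto_expectedCount_div_log (hY : IsNormalRewards P μ σ Y) (hc : IsSamplingThreshold c)
    (hrand : IsUniformRandomization P Y pick sub) {k l : Fin K} (hl : ∀ z, μ z ≤ μ l)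
    (hkl : μ k < μ l) :
    Tendsto (fun r : ℕ => expectedCount P c Y pick r k / Real.log r) atTop
      (𝓝 (1 / infoM ((μ l - μ k) / σ k))) := by
  refine tendsto_order.2 ⟨fun x hx => ?_, fun x hx => ?_⟩
  · obtain ⟨x', h1, h2⟩ := exists_between hx
    filter_upwards [hY.eventually_le_expectedCount hc hrand hl hkl h2,
      tendsto_log_natCast.eventually_gt_atTop 0] with r hr hlog
    exact h1.trans_le ((le_div_iff₀ hlog).2 hr)
  · obtain ⟨x', h1, h2⟩ := exists_between hx
    filter_upwards [hY.eventually_expectedCount_le hc hrand hl hkl h1,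
      tendsto_log_natCast.eventually_gt_atTop 0] with r hr hlog
    exact ((div_le_iff₀ hlog).2 hr).trans_lt h2

end IsNormalRewards

end

noncomputable section

/-! ### Regret for a given total number of observations -/

section LastRound

variable {K : ℕ} {c : ℕ → ℝ} {y : Fin K → ℕ → ℝ} {pick : ℕ → Finset (Fin K) → Fin K}

lemma lastRound_le (N : ℕ) : lastRound c y pick N ≤ N + 1 := Nat.findGreatest_le _

lemma div_le_lastRound (N : ℕ) : N / K ≤ lastRound c y pick N := by
  refine Nat.le_findGreatest ((Nat.div_le_self _ _).trans (Nat.le_succ N)) ?_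
  exact (total_le _).trans ((Nat.mul_le_mul_left K (Nat.sub_le _ _)).trans (Nat.mul_div_le N K))

variable (sub : ℕ → Finset (Fin K) → ℕ → Finset (Fin K))

lemma le_allocation (N : ℕ) (k : Fin K) :
    count c y pick (N / K) k ≤ allocation c y pick sub N k :=
  (count_mono k (div_le_lastRound N)).trans (Nat.le_add_right _ _)

lemma allocation_le (N : ℕ) (k : Fin K) :
    allocation c y pick sub N k ≤ count c y pick (N + 1) k + 1 := by
  refine Nat.add_le_add (count_mono k (lastRound_le N)) ?_
  split_ifs <;> omega

end LastRound

variable {Ω : Type*} [MeasurableSpace Ω] {P : Measure Ω} [IsProbabilityMeasure P]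
variable {K : ℕ} {c : ℕ → ℝ} {μ : Fin K → ℝ} {σ : Fin K → ℝ≥0} {Y : Fin K → ℕ → Ω → ℝ}
variable {pick : ℕ → Finset (Fin K) → Ω → Fin K}
variable {sub : ℕ → Finset (Fin K) → ℕ → Ω → Finset (Fin K)}

lemma integrable_allocation (hY : ∀ k t, Measurable (Y k t))
    (hrand : IsUniformRandomization P Y pick sub) (N : ℕ) (k : Fin K) :
    Integrable (fun ω => (allocation c (fun j t => Y j t ω) (fun q S => pick q S ω)
      (fun q S m => sub q S m ω) N k : ℝ)) P := by
  have hs : ∀ r S m T, Measurable fun ω => sub r S m ω = T := fun r S m T =>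
    measurableSet_setOfPred.1 (hrand.measurableSet_sub r S m T)
  refine Integrable.of_bound (C := N + 1) (measurable_from_top.comp
    (measurable_allocation hY hrand.measurable_pick hs N k)).aestronglyMeasurable
    (Eventually.of_forall fun ω => ?_)
  rw [Real.norm_of_nonneg (Nat.cast_nonneg _)]
  exact_mod_cast (allocation_le _ N k).trans (Nat.add_le_add_right (count_le _ k) 1)

lemma expectedCount_le_expectedAllocation (hY : ∀ k t, Measurable (Y k t))
    (hrand : IsUniformRandomization P Y pick sub) (N : ℕ) (k : Fin K) :
    expectedCount P c Y pick (N / K) k ≤ expectedAllocation P c Y pick sub N k :=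
  integral_mono (integrable_count hY hrand.measurable_pick _ k)
    (integrable_allocation hY hrand N k) fun _ => Nat.cast_le.2 (le_allocation _ N k)

lemma expectedAllocation_le (hY : ∀ k t, Measurable (Y k t))
    (hrand : IsUniformRandomization P Y pick sub) (N : ℕ) (k : Fin K) :
    expectedAllocation P c Y pick sub N k ≤ expectedCount P c Y pick (N + 1) k + 1 := by
  have hi := integrable_count (P := P) (c := c) hY hrand.measurable_pick (N + 1) k
  calc expectedAllocation P c Y pick sub N k
      ≤ ∫ ω, ((count c (fun j t => Y j t ω) (fun q S => pick q S ω) (N + 1) k : ℝ) + 1) ∂P :=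
        integral_mono (integrable_allocation hY hrand N k) (hi.add (integrable_const _))
          fun _ => (Nat.cast_le.2 (allocation_le _ N k)).trans_eq (Nat.cast_succ _)
    _ = _ := by
        rw [integral_add hi (integrable_const _)]
        simp [expectedCount]

lemma tendsto_log_natDiv_div_log (hK : 0 < K) :
    Tendsto (fun N : ℕ => Real.log (N / K : ℕ) / Real.log N) atTop (𝓝 1) := by
  have h1 : Tendsto (fun N : ℕ => 1 - Real.log (2 * K) / Real.log N) atTop (𝓝 1) := by
    simpa using (tendsto_log_natCast.const_div_atTop (Real.log (2 * K))).const_sub 1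
  refine tendsto_of_tendsto_of_tendsto_of_le_of_le' h1 tendsto_const_nhds ?_ ?_
  · filter_upwards [tendsto_log_natCast.eventually_gt_atTop 0, eventually_ge_atTop (2 * K)]
      with N hlog hN
    have hK0 : (0 : ℝ) < K := by exact_mod_cast hK
    have hN0 : (0 : ℝ) < N := by exact_mod_cast (by omega : 0 < N)
    rw [le_div_iff₀ hlog, sub_mul, one_mul, div_mul_cancel₀ _ hlog.ne',
      ← Real.log_div hN0.ne' (by positivity)]
    exact Real.log_le_log (by positivity) (div_two_mul_le_natDiv hK.ne' hN)
  · filter_upwards [tendsto_log_natCast.eventually_gt_atTop 0, eventually_ge_atTop K]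
      with N hlog hN
    rw [div_le_one hlog]
    exact Real.log_le_log (by exact_mod_cast Nat.div_pos hN hK)
      (by exact_mod_cast Nat.div_le_self N K)

lemma tendsto_log_add_one_div_log :
    Tendsto (fun N : ℕ => Real.log (N + 1 : ℕ) / Real.log N) atTop (𝓝 1) := by
  have h1 : Tendsto (fun N : ℕ => 1 + Real.log 2 / Real.log N) atTop (𝓝 1) := by
    simpa using (tendsto_log_natCast.const_div_atTop (Real.log 2)).const_add 1
  refine tendsto_of_tendsto_of_tendsto_of_le_of_le' tendsto_const_nhds h1 ?_ ?_
  · filter_upwards [tendsto_log_natCast.eventually_gt_atTop 0, eventually_ge_atTop 1]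
      with N hlog hN
    rw [one_le_div hlog]
    exact Real.log_le_log (by exact_mod_cast hN) (by exact_mod_cast Nat.le_succ N)
  · filter_upwards [tendsto_log_natCast.eventually_gt_atTop 0, eventually_ge_atTop 1]
      with N hlog hN
    have hN0 : (0 : ℝ) < N := by exact_mod_cast hN
    rw [div_le_iff₀ hlog, add_mul, one_mul, div_mul_cancel₀ _ hlog.ne', add_comm (Real.log N),
      ← Real.log_mul two_ne_zero hN0.ne']
    exact Real.log_le_log (by positivity) (by exact_mod_cast (by omega : N + 1 ≤ 2 * N))

lemma IsNormalRewards.tendsto_expectedAllocation_div_log (hY : IsNormalRewards P μ σ Y)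
    (hc : IsSamplingThreshold c) (hrand : IsUniformRandomization P Y pick sub) {k l : Fin K}
    (hl : ∀ z, μ z ≤ μ l) (hkl : μ k < μ l) :
    Tendsto (fun N : ℕ => expectedAllocation P c Y pick sub N k / Real.log N) atTop
      (𝓝 (1 / infoM ((μ l - μ k) / σ k))) := by
  have hK : 0 < K := Fin.pos_iff_nonempty.2 ⟨l⟩
  have hE := hY.tendsto_expectedCount_div_log hc hrand hl hkl
  have hdiv : Tendsto (fun N : ℕ => N / K) atTop atTop := Nat.tendsto_div_const_atTop hK.ne'
  have h1 := (hE.comp hdiv).mul (tendsto_log_natDiv_div_log hK)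
  have h2 := ((hE.comp (tendsto_add_atTop_nat 1)).mul tendsto_log_add_one_div_log).add
    (tendsto_log_natCast.const_div_atTop 1)
  rw [mul_one] at h1
  rw [mul_one, add_zero] at h2
  refine tendsto_of_tendsto_of_tendsto_of_le_of_le' h1 h2 ?_ ?_
  · filter_upwards [tendsto_log_natCast.eventually_gt_atTop 0,
      hdiv.eventually (tendsto_log_natCast.eventually_gt_atTop 0)] with N hlog hlog'
    simp only [Function.comp_apply] at hlog' ⊢
    rw [div_mul_div_cancel₀ hlog'.ne']
    gcongr
    exact expectedCount_le_expectedAllocation hY.meas hrand N k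
  · filter_upwards [tendsto_log_natCast.eventually_gt_atTop 0,
      (tendsto_add_atTop_nat 1).eventually (tendsto_log_natCast.eventually_gt_atTop 0)]
      with N hlog hlog'
    simp only [Function.comp_apply] at hlog' ⊢
    rw [div_mul_div_cancel₀ hlog'.ne', ← add_div]
    gcongr
    exact expectedAllocation_le hY.meas hrand N k

end

end SSTC

theorem theorem2 {Ω : Type*} [MeasurableSpace Ω] (P : Measure Ω) [IsProbabilityMeasure P]
    {K : ℕ} (hK : 1 ≤ K)
    (c : ℕ → ℝ) (hc : IsSamplingThreshold c)
    (μ : Fin K → ℝ) (σ : Fin K → ℝ≥0) (hσ : ∀ k, 0 < σ k)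
    (Y : Fin K → ℕ → Ω → ℝ) (hYmeas : ∀ k t, Measurable (Y k t))
    (hYlaw : ∀ k t, P.map (Y k t) = gaussianReal (μ k) (σ k ^ 2))
    (hYindep : iIndepFun (fun p : Fin K × ℕ => Y p.1 p.2) P)
    (pick : ℕ → Finset (Fin K) → Ω → Fin K)
    (sub : ℕ → Finset (Fin K) → ℕ → Ω → Finset (Fin K))
    (hrand : SSTC.IsUniformRandomization P Y pick sub) :
    (∀ k, μ k < SSTC.bestMean μ →
      limsup (fun r : ℕ => ((SSTC.expectedCount P c Y pick r k / Real.log r : ℝ) : EReal)) atTop ≤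
        ((1 / SSTC.infoM ((SSTC.bestMean μ - μ k) / σ k) : ℝ) : EReal)) ∧
    Tendsto (fun N : ℕ => SSTC.regret P c μ Y pick sub N / Real.log N) atTop
      (𝓝 (SSTC.regretLowerBound μ σ)) := by
  have hY : SSTC.IsNormalRewards P μ σ Y := ⟨hσ, hYmeas, hYlaw, hYindep⟩
  have : Nonempty (Fin K) := Fin.pos_iff_nonempty.1 hK
  obtain ⟨l, hl⟩ := Finite.exists_max μ
  have hbest : SSTC.bestMean μ = μ l :=
    le_antisymm (ciSup_le hl) (le_ciSup (Set.finite_range μ).bddAbove l)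
  refine ⟨fun k hk => ?_, ?_⟩
  · rw [hbest] at hk ⊢
    exact ((continuous_coe_real_ereal.tendsto _).comp
      (hY.tendsto_expectedCount_div_log hc hrand hl hk)).limsup_eq.le
  · have h1 : SSTC.regretLowerBound μ σ = ∑ k, if μ k < SSTC.bestMean μ then
        (SSTC.bestMean μ - μ k) / SSTC.infoM ((SSTC.bestMean μ - μ k) / σ k) else 0 :=
      Finset.sum_filter _ _
    rw [h1]
    simp only [SSTC.regret, Finset.sum_div]
    refine tendsto_finsetSum _ fun k _ => ?_
    rw [hbest]
    split_ifs with hk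
    · have h2 := (hY.tendsto_expectedAllocation_div_log hc hrand hl hk).const_mul (μ l - μ k)
      rw [mul_one_div] at h2
      exact h2.congr fun N => (mul_div_assoc _ _ _).symm
    · rw [show μ l - μ k = 0 by linarith [hl k, not_lt.1 hk]]
      simp
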